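/- Let $\mathcal C$ be a braided monoidal category with braiding $\Psi_{X,Y}\colon X\otimes Y\to Y\otimes X$ (associativity and unit isomorphisms are suppressed in the formulas; $\circ$ is composition, identities are written $1$). A Hopf algebra $H$ in $\mathcal C$ is a bialgebra $(H,\mu,\eta,\Delta,\varepsilon)$ in $\mathcal C$ with an antipode $S$ that is an invertible morphism. A right crossed module over $H$ is an object $X$ with a right $H$-module structure $\triangleleft\colon X\otimes H\to X$ and a right $H$-comodule structure $\beta\colon X\to X\otimes H$ such that $$(1_X\otimes\mu)(\Psi_{H,X}\otimes 1_H)(1_H\otimes\beta)(1_H\otimes\triangleleft)(\Psi_{X,H}\otimes 1_H)(1_X\otimes\Delta)=(\triangleleft\otimes\mu)(1_X\otimes\Psi_{H,H}\otimes 1_H)(\beta\otimes\Delta)$$ as morphisms $X\otimes H\to X\otimes H$. The category $\mathcal C^H_H$ of right crossed modules, with the morphisms of $\mathcal C$ that are both module and comodule maps, is braided monoidal: $X\otimes Y$ has action $(\triangleleft\otimes\triangleleft)(1_X\otimes\Psi_{Y,H}\otimes 1_H)(1_X\otimes 1_Y\otimes\Delta)$ and coaction $(1_X\otimes 1_Y\otimes\mu)(1_X\otimes\Psi_{H,Y}\otimes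 1_H)(\beta\otimes\beta)$, the unit object has the trivial structure, and the braiding is $(1_Y\otimes\triangleleft)(\Psi_{X,Y}\otimes 1_H)(1_X\otimes\beta)\colon X\otimes Y\to Y\otimes X$. Let $A$ be a Hopf algebra in $\mathcal C$ and $B$ a Hopf algebra in $\mathcal C^A_A$; write $\triangleleft,\beta$ for the action and coaction of $A$ on $B$. The cross product $A\ltimes B$ is the object $A\otimes B$ of $\mathcal C$ with unit $\eta_A\otimes\eta_B$, counit $\varepsilon_A\otimes\varepsilon_B$ and $$\mu_{A\ltimes B}=(\mu_A\otimes\mu_B)(1_A\otimes 1_A\otimes\triangleleft\otimes 1_B)(1_A\otimes\Psi_{B,A}\otimes 1_A\otimes 1_B)(1_A\otimes 1_B\otimes\Delta_A\otimes 1_B),$$ $$\Delta_{A\ltimes B}=(1_A\otimes 1_B\otimes\mu_A\otimes 1_B)(1_A\otimes\Psi_{A,B}\otimes 1_A\otimes 1_B)(1_A\otimes 1_A\otimes\beta\otimes 1_B)(\Delta_A\otimes\Delta_B),$$ $$S_{A\ltimes B}=(1_A\otimes\triangleleft)(\Psi_{B,A}\otimes 1_A)(1_B\otimes\Delta_A)(S_B\otimes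 S_A)(1_B\otimes\mu_A)(\Psi_{A,B}\otimes 1_A)(1_A\otimes\beta).$$ Then $A\ltimes B$ is a Hopf algebra in $\mathcal C$ (with invertible antipode), and the braided categories $(\mathcal C^A_A)^B_B$ and $\mathcal C^{A\ltimes B}_{A\ltimes B}$ are isomorphic. More precisely, for every crossed module $X$ over $B$ in $\mathcal C^A_A$, the action $$X\otimes A\otimes B\xrightarrow{\ \triangleleft_A\otimes 1_B\ }X\otimes B\xrightarrow{\ \triangleleft_B\ }X$$ and the coaction $$X\xrightarrow{\ \beta_B\ }X\otimes B\xrightarrow{\ \beta_A\otimes 1_B\ }X\otimes A\otimes B$$ make the underlying object $X$ of $\mathcal C$ a right crossed module over $A\ltimes B$, and the functor $(\mathcal C^A_A)^B_B\to\mathcal C^{A\ltimes B}_{A\ltimes B}$ defined in this way on objects, and as the identity on underlying morphisms of $\mathcal C$, is an isomorphism of categories and a strict braided monoidal functor (its structure isomorphisms $F(X)\otimes F(Y)\to F(X\otimes Y)$ and $\underline 1\to F(\underline 1)$ are identities of $\mathcal C$). -/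

import Mathlib

open CategoryTheory MonoidalCategory
open scoped MonObj ComonObj HopfObj

universe v u

namespace Braided

/-!
Hopf algebras in a braided category are Mathlib's `HopfObj` together with `IsIso 𝒮[H]`.

The definitions are `IsCrossedModule`, `tensorAct`, `tensorCoact`, `unitAct`, `unitCoact`, `yBr`,
`CrossedModule` with its braided monoidal structure, and the cross product at the end.
Everything else consists of proved facts which show that crossed modules form a braided category.
-/

/-! ### Auxiliary calculus

`sA Z f`, `sC Z f`, `sX Z f` are `id_Z ⊗ f`, bracketed to the left. -/

set_option linter.unusedSimpArgs false
set_option linter.unusedSectionVars false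
set_option linter.style.longLine false
set_option linter.unusedVariables false

section Strand

variable {C : Type u} [Category.{v} C] [MonoidalCategory C]

def sA (Z : C) {X Y W : C} (f : X ⊗ Y ⟶ W) : (Z ⊗ X) ⊗ Y ⟶ Z ⊗ W :=
  (α_ Z X Y).hom ≫ Z ◁ f

def sC (Z : C) {X Y W : C} (f : W ⟶ X ⊗ Y) : Z ⊗ W ⟶ (Z ⊗ X) ⊗ Y :=
  Z ◁ f ≫ (α_ Z X Y).inv

def sX (Z : C) {X Y V W : C} (f : X ⊗ Y ⟶ V ⊗ W) : (Z ⊗ X) ⊗ Y ⟶ (Z ⊗ V) ⊗ W :=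
  (α_ Z X Y).hom ≫ Z ◁ f ≫ (α_ Z V W).inv

theorem whiskerLeft_inj {X Y : C} {f g : X ⟶ Y} (h : 𝟙_ C ◁ f = 𝟙_ C ◁ g) : f = g := by
  simpa using h

theorem sA_inj {X Y W : C} {f g : X ⊗ Y ⟶ W} (h : sA (𝟙_ C) f = sA (𝟙_ C) g) : f = g := by
  simpa [sA] using h

theorem sX_inj {X Y V W : C} {f g : X ⊗ Y ⟶ V ⊗ W} (h : sX (𝟙_ C) f = sX (𝟙_ C) g) : f = g := by
  simpa [sX] using h

theorem sA_nat {Z Z' X Y W : C} (z : Z ⟶ Z') (f : X ⊗ Y ⟶ W) :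
    z ▷ X ▷ Y ≫ sA Z' f = sA Z f ≫ z ▷ W := by
  simp [sA, whisker_exchange]

theorem sC_nat {Z Z' X Y W : C} (z : Z ⟶ Z') (f : W ⟶ X ⊗ Y) :
    z ▷ W ≫ sC Z' f = sC Z f ≫ z ▷ X ▷ Y := by
  simp [sC, ← whisker_exchange_assoc]

theorem sX_nat {Z Z' X Y V W : C} (z : Z ⟶ Z') (f : X ⊗ Y ⟶ V ⊗ W) :
    z ▷ X ▷ Y ≫ sX Z' f = sX Z f ≫ z ▷ V ▷ W := by
  rw [sX, sX, associator_naturality_left_assoc, ← whisker_exchange_assoc,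
    Category.assoc, Category.assoc, associator_inv_naturality_left]

variable [BraidedCategory C]

def sB (Z X Y : C) : (Z ⊗ X) ⊗ Y ⟶ (Z ⊗ Y) ⊗ X := sX Z (β_ X Y).hom

def sBi (Z X Y : C) : (Z ⊗ Y) ⊗ X ⟶ (Z ⊗ X) ⊗ Y := sX Z (β_ X Y).inv

theorem sB_nat {Z Z' : C} (z : Z ⟶ Z') (X Y : C) :
    z ▷ X ▷ Y ≫ sB Z' X Y = sB Z X Y ≫ z ▷ Y ▷ X := sX_nat _ _

theorem sBi_nat {Z Z' : C} (z : Z ⟶ Z') (X Y : C) :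
    z ▷ Y ▷ X ≫ sBi Z' X Y = sBi Z X Y ≫ z ▷ X ▷ Y := sX_nat _ _

@[simp]
theorem sB_sBi (Z X Y : C) : sB Z X Y ≫ sBi Z X Y = 𝟙 _ := by simp [sB, sBi, sX]

@[simp]
theorem sBi_sB (Z X Y : C) : sBi Z X Y ≫ sB Z X Y = 𝟙 _ := by simp [sB, sBi, sX]


open BraidedCategory in
theorem sA_sB (Z : C) {X Y W : C} (f : X ⊗ Y ⟶ W) (V : C) :
    sA Z f ▷ V ≫ sB Z W V = sB (Z ⊗ X) Y V ≫ sB Z X V ▷ Y ≫ sA (Z ⊗ V) f := by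
  simp only [sA, sB, sX]
  calc
    _ = 𝟙 _ ⊗≫ Z ◁ (f ▷ V ≫ (β_ W V).hom) ⊗≫ 𝟙 _ := by monoidal
    _ = _ := by rw [braiding_naturality_left, braiding_tensor_left_hom]; monoidal

open BraidedCategory in
theorem sA_sB' (Z : C) {X Y W : C} (f : X ⊗ Y ⟶ W) (V : C) :
    sA (Z ⊗ V) f ≫ sB Z V W = sB Z V X ▷ Y ≫ sB (Z ⊗ X) V Y ≫ sA Z f ▷ V := by
  simp only [sA, sB, sX]
  calc
    _ = 𝟙 _ ⊗≫ Z ◁ (V ◁ f ≫ (β_ V W).hom) ⊗≫ 𝟙 _ := by monoidal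
    _ = _ := by rw [braiding_naturality_right, braiding_tensor_right_hom]; monoidal

open BraidedCategory in
theorem sC_sB (Z : C) {X Y W : C} (f : W ⟶ X ⊗ Y) (V : C) :
    sC Z f ▷ V ≫ sB (Z ⊗ X) Y V ≫ sB Z X V ▷ Y = sB Z W V ≫ sC (Z ⊗ V) f := by
  simp only [sC, sB, sX]
  symm
  calc
    _ = 𝟙 _ ⊗≫ Z ◁ ((β_ W V).hom ≫ V ◁ f) ⊗≫ 𝟙 _ := by monoidal
    _ = _ := by rw [← braiding_naturality_left, braiding_tensor_left_hom]; monoidal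

open BraidedCategory in
theorem sC_sB' (Z : C) {X Y W : C} (f : W ⟶ X ⊗ Y) (V : C) :
    sC (Z ⊗ V) f ≫ sB Z V X ▷ Y ≫ sB (Z ⊗ X) V Y = sB Z V W ≫ sC Z f ▷ V := by
  simp only [sC, sB, sX]
  symm
  calc
    _ = 𝟙 _ ⊗≫ Z ◁ ((β_ V W).hom ≫ f ▷ V) ⊗≫ 𝟙 _ := by monoidal
    _ = _ := by rw [← braiding_naturality_right, braiding_tensor_right_hom]; monoidal

theorem sB_yb (Z X Y V : C) :
    sB (Z ⊗ X) Y V ≫ sB Z X V ▷ Y ≫ sB (Z ⊗ V) X Y =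
      sB Z X Y ▷ V ≫ sB (Z ⊗ Y) X V ≫ sB Z Y V ▷ X := by
  simp only [sB, sX]
  have := BraidedCategory.yang_baxter X Y V
  calc
    _ = 𝟙 _ ⊗≫ Z ◁ ((X ◁ (β_ Y V).hom) ⊗≫ (β_ X V).hom ▷ Y ⊗≫ V ◁ (β_ X Y).hom) ⊗≫ 𝟙 _ := by monoidal
    _ = 𝟙 _ ⊗≫ Z ◁ ((α_ X Y V).inv ≫ (β_ X Y).hom ▷ V ≫ (α_ Y X V).hom ≫
      Y ◁ (β_ X V).hom ≫ (α_ Y V X).inv ≫ (β_ Y V).hom ▷ X ≫ (α_ V Y X).hom) ⊗≫ 𝟙 _ := by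
        rw [this]; monoidal
    _ = _ := by monoidal

theorem sA_nat' {Z Z' X Y W : C} (z : Z ⟶ Z') (f : X ⊗ Y ⟶ W) :
    sA Z f ≫ z ▷ W = z ▷ X ▷ Y ≫ sA Z' f := (sA_nat z f).symm

theorem sA_natp_w1 {Z Z' X Y W : C} (z : Z ⟶ Z') (f : X ⊗ Y ⟶ W) (V1 : C) :
    sA Z f ▷ V1 ≫ z ▷ W ▷ V1 =
      z ▷ X ▷ Y ▷ V1 ≫ sA Z' f ▷ V1 := by
  simpa only [comp_whiskerRight, Category.assoc] using
    congrArg (· ▷ V1) (sA_nat' z f)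

theorem sC_nat_w1 {Z Z' X Y W : C} (z : Z ⟶ Z') (f : W ⟶ X ⊗ Y) (V1 : C) :
    z ▷ W ▷ V1 ≫ sC Z' f ▷ V1 =
      sC Z f ▷ V1 ≫ z ▷ X ▷ Y ▷ V1 := by
  simpa only [comp_whiskerRight, Category.assoc] using
    congrArg (· ▷ V1) (sC_nat z f)

theorem sC_nat_w2 {Z Z' X Y W : C} (z : Z ⟶ Z') (f : W ⟶ X ⊗ Y) (V1 V2 : C) :
    z ▷ W ▷ V1 ▷ V2 ≫ sC Z' f ▷ V1 ▷ V2 =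
      sC Z f ▷ V1 ▷ V2 ≫ z ▷ X ▷ Y ▷ V1 ▷ V2 := by
  simpa only [comp_whiskerRight, Category.assoc] using
    congrArg (· ▷ V2) (sC_nat_w1 z f V1)

theorem sB_nat_w1 {Z Z' : C} (z : Z ⟶ Z') (X Y : C) (V1 : C) :
    z ▷ X ▷ Y ▷ V1 ≫ sB Z' X Y ▷ V1 =
      sB Z X Y ▷ V1 ≫ z ▷ Y ▷ X ▷ V1 := by
  simpa only [comp_whiskerRight, Category.assoc] using
    congrArg (· ▷ V1) (sB_nat z X Y)

theorem sB_nat_w2 {Z Z' : C} (z : Z ⟶ Z') (X Y : C) (V1 V2 : C) :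
    z ▷ X ▷ Y ▷ V1 ▷ V2 ≫ sB Z' X Y ▷ V1 ▷ V2 =
      sB Z X Y ▷ V1 ▷ V2 ≫ z ▷ Y ▷ X ▷ V1 ▷ V2 := by
  simpa only [comp_whiskerRight, Category.assoc] using
    congrArg (· ▷ V2) (sB_nat_w1 z X Y V1)

theorem sB_nat_w3 {Z Z' : C} (z : Z ⟶ Z') (X Y : C) (V1 V2 V3 : C) :
    z ▷ X ▷ Y ▷ V1 ▷ V2 ▷ V3 ≫ sB Z' X Y ▷ V1 ▷ V2 ▷ V3 =
      sB Z X Y ▷ V1 ▷ V2 ▷ V3 ≫ z ▷ Y ▷ X ▷ V1 ▷ V2 ▷ V3 := by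
  simpa only [comp_whiskerRight, Category.assoc] using
    congrArg (· ▷ V3) (sB_nat_w2 z X Y V1 V2)

theorem sA_sB_w1 (Z : C) {X Y W : C} (f : X ⊗ Y ⟶ W) (V : C) (V1 : C) :
    sA Z f ▷ V ▷ V1 ≫ sB Z W V ▷ V1 =
      sB (Z ⊗ X) Y V ▷ V1 ≫ sB Z X V ▷ Y ▷ V1 ≫ sA (Z ⊗ V) f ▷ V1 := by
  simpa only [comp_whiskerRight, Category.assoc] using
    congrArg (· ▷ V1) (sA_sB Z f V)

theorem sA_sB_w2 (Z : C) {X Y W : C} (f : X ⊗ Y ⟶ W) (V : C) (V1 V2 : C) :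
    sA Z f ▷ V ▷ V1 ▷ V2 ≫ sB Z W V ▷ V1 ▷ V2 =
      sB (Z ⊗ X) Y V ▷ V1 ▷ V2 ≫ sB Z X V ▷ Y ▷ V1 ▷ V2 ≫ sA (Z ⊗ V) f ▷ V1 ▷ V2 := by
  simpa only [comp_whiskerRight, Category.assoc] using
    congrArg (· ▷ V2) (sA_sB_w1 Z f V V1)

theorem sA_sBp_w1 (Z : C) {X Y W : C} (f : X ⊗ Y ⟶ W) (V : C) (V1 : C) :
    sA (Z ⊗ V) f ▷ V1 ≫ sB Z V W ▷ V1 =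
      sB Z V X ▷ Y ▷ V1 ≫ sB (Z ⊗ X) V Y ▷ V1 ≫ sA Z f ▷ V ▷ V1 := by
  simpa only [comp_whiskerRight, Category.assoc] using
    congrArg (· ▷ V1) (sA_sB' Z f V)

theorem sA_sBp_w2 (Z : C) {X Y W : C} (f : X ⊗ Y ⟶ W) (V : C) (V1 V2 : C) :
    sA (Z ⊗ V) f ▷ V1 ▷ V2 ≫ sB Z V W ▷ V1 ▷ V2 =
      sB Z V X ▷ Y ▷ V1 ▷ V2 ≫ sB (Z ⊗ X) V Y ▷ V1 ▷ V2 ≫ sA Z f ▷ V ▷ V1 ▷ V2 := by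
  simpa only [comp_whiskerRight, Category.assoc] using
    congrArg (· ▷ V2) (sA_sBp_w1 Z f V V1)

theorem sB_sC (Z : C) {X Y W : C} (f : W ⟶ X ⊗ Y) (V : C) :
    sB Z W V ≫ sC (Z ⊗ V) f = sC Z f ▷ V ≫ sB (Z ⊗ X) Y V ≫ sB Z X V ▷ Y := (sC_sB Z f V).symm

theorem sB_sC_w1 (Z : C) {X Y W : C} (f : W ⟶ X ⊗ Y) (V : C) (V1 : C) :
    sB Z W V ▷ V1 ≫ sC (Z ⊗ V) f ▷ V1 =
      sC Z f ▷ V ▷ V1 ≫ sB (Z ⊗ X) Y V ▷ V1 ≫ sB Z X V ▷ Y ▷ V1 := by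
  simpa only [comp_whiskerRight, Category.assoc] using
    congrArg (· ▷ V1) (sB_sC Z f V)

theorem sB_sC_w2 (Z : C) {X Y W : C} (f : W ⟶ X ⊗ Y) (V : C) (V1 V2 : C) :
    sB Z W V ▷ V1 ▷ V2 ≫ sC (Z ⊗ V) f ▷ V1 ▷ V2 =
      sC Z f ▷ V ▷ V1 ▷ V2 ≫ sB (Z ⊗ X) Y V ▷ V1 ▷ V2 ≫ sB Z X V ▷ Y ▷ V1 ▷ V2 := by
  simpa only [comp_whiskerRight, Category.assoc] using
    congrArg (· ▷ V2) (sB_sC_w1 Z f V V1)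

theorem sB_sC' (Z : C) {X Y W : C} (f : W ⟶ X ⊗ Y) (V : C) :
    sB Z V W ≫ sC Z f ▷ V = sC (Z ⊗ V) f ≫ sB Z V X ▷ Y ≫ sB (Z ⊗ X) V Y := (sC_sB' Z f V).symm

theorem sB_sCp_w1 (Z : C) {X Y W : C} (f : W ⟶ X ⊗ Y) (V : C) (V1 : C) :
    sB Z V W ▷ V1 ≫ sC Z f ▷ V ▷ V1 =
      sC (Z ⊗ V) f ▷ V1 ≫ sB Z V X ▷ Y ▷ V1 ≫ sB (Z ⊗ X) V Y ▷ V1 := by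
  simpa only [comp_whiskerRight, Category.assoc] using
    congrArg (· ▷ V1) (sB_sC' Z f V)

end Strand

section CM

variable {C : Type u} [Category.{v} C] [MonoidalCategory C] [BraidedCategory C]

/-- `act` is a right `H`-module structure on `X`, `coact` is a right `H`-comodule structure on `X`,
and they satisfy the compatibility axiom of a right crossed module:
`(1 ⊗ Δ)`, `Ψ_{X,H} ⊗ 1`, `1 ⊗ act`, `1 ⊗ coact`, `Ψ_{H,X} ⊗ 1`, `1 ⊗ μ` (in this order) compose
to `(act ⊗ μ) ∘ (1 ⊗ Ψ_{H,H} ⊗ 1) ∘ (coact ⊗ Δ)`. -/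
structure IsCrossedModule (H : C) [HopfObj H] {X : C} (act : X ⊗ H ⟶ X) (coact : X ⟶ X ⊗ H) :
    Prop where
  act_one : X ◁ η[H] ≫ act = (ρ_ X).hom
  act_mul : X ◁ μ[H] ≫ act = (α_ X H H).inv ≫ act ▷ H ≫ act
  coact_counit : coact ≫ X ◁ ε[H] = (ρ_ X).inv
  coact_comul : coact ≫ X ◁ Δ[H] = coact ≫ coact ▷ H ≫ (α_ X H H).hom
  compat :
    X ◁ Δ[H] ≫ (α_ X H H).inv ≫ (β_ X H).hom ▷ H ≫ (α_ H X H).hom ≫ H ◁ act ≫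
      H ◁ coact ≫ (α_ H X H).inv ≫ (β_ H X).hom ▷ H ≫ (α_ X H H).hom ≫ X ◁ μ[H] =
    (coact ⊗ₘ Δ[H]) ≫ tensorμ X H H H ≫ (act ⊗ₘ μ[H])

variable {H : C} [HopfObj H]

theorem sA_assoc (Z : C) : sA Z μ[H] ▷ H ≫ sA Z μ[H] = sA (Z ⊗ H) μ[H] ≫ sA Z μ[H] := by
  simp only [sA]
  calc
    _ = 𝟙 _ ⊗≫ Z ◁ (μ[H] ▷ H ≫ μ[H]) ⊗≫ 𝟙 _ := by monoidal
    _ = _ := by rw [MonObj.mul_assoc]; monoidal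

theorem sC_coassoc (Z : C) : sC Z Δ[H] ≫ sC Z Δ[H] ▷ H = sC Z Δ[H] ≫ sC (Z ⊗ H) Δ[H] := by
  simp only [sC]
  symm
  calc
    _ = 𝟙 _ ⊗≫ Z ◁ (Δ[H] ≫ H ◁ Δ[H]) ⊗≫ 𝟙 _ := by monoidal
    _ = _ := by rw [ComonObj.comul_assoc]; monoidal

theorem sA_sC (Z : C) : sA Z μ[H] ≫ sC Z Δ[H] =
    sC (Z ⊗ H) Δ[H] ≫ sC Z Δ[H] ▷ H ▷ H ≫ sB (Z ⊗ H) H H ▷ H ≫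
      sA Z μ[H] ▷ H ▷ H ≫ sA (Z ⊗ H) μ[H] := by
  simp only [sA, sC, sB, sX]
  calc
    _ = 𝟙 _ ⊗≫ Z ◁ (μ[H] ≫ Δ[H]) ⊗≫ 𝟙 _ := by monoidal
    _ = _ := by
      rw [BimonObj.mul_comul, tensorμ, MonoidalCategory.tensorHom_def', MonoidalCategory.tensorHom_def]; monoidal

section single
variable {X : C} {a : X ⊗ H ⟶ X} {c : X ⟶ X ⊗ H}

theorem IsCrossedModule.sA_act (h : IsCrossedModule H a c) (Z : C) : sA Z a ▷ H ≫ sA Z a = sA (Z ⊗ X) μ[H] ≫ sA Z a := by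
  simp only [sA]
  symm
  calc
    _ = 𝟙 _ ⊗≫ Z ◁ (X ◁ μ[H] ≫ a) ⊗≫ 𝟙 _ := by monoidal
    _ = _ := by rw [h.act_mul]; monoidal

theorem IsCrossedModule.sC_coact (h : IsCrossedModule H a c) (Z : C) :
    sC Z c ≫ sC Z c ▷ H = sC Z c ≫ sC (Z ⊗ X) Δ[H] := by
  simp only [sC]
  symm
  calc
    _ = 𝟙 _ ⊗≫ Z ◁ (c ≫ X ◁ Δ[H]) ⊗≫ 𝟙 _ := by monoidal
    _ = _ := by rw [h.coact_comul]; monoidal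

theorem IsCrossedModule.s_compat (h : IsCrossedModule H a c) (Z : C) :
    sC (Z ⊗ X) Δ[H] ≫ sB Z X H ▷ H ≫ sA (Z ⊗ H) a ≫ sC (Z ⊗ H) c ≫ sB Z H X ▷ H ≫
      sA (Z ⊗ X) μ[H] =
    sC (Z ⊗ X) Δ[H] ≫ sC Z c ▷ H ▷ H ≫ sB (Z ⊗ X) H H ▷ H ≫
      sA Z a ▷ H ▷ H ≫ sA (Z ⊗ X) μ[H] := by
  simp only [sA, sC, sB, sX]
  have := h.compat
  calc
    _ = 𝟙 _ ⊗≫ Z ◁ (X ◁ Δ[H] ≫ (α_ X H H).inv ≫ (β_ X H).hom ▷ H ≫ (α_ H X H).hom ≫ H ◁ a ≫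
      H ◁ c ≫ (α_ H X H).inv ≫ (β_ H X).hom ▷ H ≫ (α_ X H H).hom ≫ X ◁ μ[H]) ⊗≫ 𝟙 _ := by monoidal
    _ = _ := by
      rw [h.compat, tensorμ, MonoidalCategory.tensorHom_def', MonoidalCategory.tensorHom_def]; monoidal

end single

section tensor

/-- The diagonal action on `X ⊗ Y`: split `H` by `Δ`, move the first leg past `Y` by `Ψ_{Y,H}`,
then act. -/
def tensorAct {X Y : C} (a : X ⊗ H ⟶ X) (b : Y ⊗ H ⟶ Y) : (X ⊗ Y) ⊗ H ⟶ X ⊗ Y :=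
  (X ⊗ Y) ◁ Δ[H] ≫ tensorμ X Y H H ≫ (a ⊗ₘ b)

/-- The diagonal coaction on `X ⊗ Y`: coact, move the first `H` past `Y` by `Ψ_{H,Y}`,
then multiply. -/
def tensorCoact {X Y : C} (c : X ⟶ X ⊗ H) (d : Y ⟶ Y ⊗ H) : X ⊗ Y ⟶ (X ⊗ Y) ⊗ H :=
  (c ⊗ₘ d) ≫ tensorμ X H Y H ≫ (X ⊗ Y) ◁ μ[H]

def tA (Z : C) {X Y : C} (a : X ⊗ H ⟶ X) (b : Y ⊗ H ⟶ Y) :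
    ((Z ⊗ X) ⊗ Y) ⊗ H ⟶ (Z ⊗ X) ⊗ Y :=
  sC ((Z ⊗ X) ⊗ Y) Δ[H] ≫ sB (Z ⊗ X) Y H ▷ H ≫ sA Z a ▷ Y ▷ H ≫ sA (Z ⊗ X) b

def tC (Z : C) {X Y : C} (c : X ⟶ X ⊗ H) (d : Y ⟶ Y ⊗ H) :
    (Z ⊗ X) ⊗ Y ⟶ ((Z ⊗ X) ⊗ Y) ⊗ H :=
  sC (Z ⊗ X) d ≫ sC Z c ▷ Y ▷ H ≫ sB (Z ⊗ X) H Y ▷ H ≫ sA ((Z ⊗ X) ⊗ Y) μ[H]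

variable {X Y : C} {a : X ⊗ H ⟶ X} {c : X ⟶ X ⊗ H} {b : Y ⊗ H ⟶ Y} {d : Y ⟶ Y ⊗ H}

theorem tA_eq (Z : C) : tA Z a b = (α_ Z X Y).hom ▷ H ≫ sA Z (tensorAct a b) ≫ (α_ Z X Y).inv := by
  simp only [tA, sA, sC, sB, sX, tensorAct, tensorμ, MonoidalCategory.tensorHom_def]
  monoidal

theorem tC_eq (Z : C) :
    tC Z c d = (α_ Z X Y).hom ≫ sC Z (tensorCoact c d) ≫ (α_ Z X Y).inv ▷ H := by
  simp only [tC, sA, sC, sB, sX, tensorCoact, tensorμ, MonoidalCategory.tensorHom_def']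
  monoidal


theorem tensorAct_mul (h : IsCrossedModule H a c) (k : IsCrossedModule H b d) :
    (X ⊗ Y) ◁ μ[H] ≫ tensorAct a b =
      (α_ (X ⊗ Y) H H).inv ≫ tensorAct a b ▷ H ≫ tensorAct a b := by
  have ha : a ▷ H ≫ a = (α_ X H H).hom ≫ X ◁ μ[H] ≫ a := by simp [h.act_mul]
  have hb : b ▷ H ≫ b = (α_ Y H H).hom ≫ Y ◁ μ[H] ≫ b := by simp [k.act_mul]
  rw [Iso.eq_inv_comp]
  simp only [tensorAct, comp_whiskerRight, Category.assoc]
  rw [← whisker_exchange_assoc, tensorμ_natural_left_assoc, tensorHom_comp_tensorHom, ha, hb,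
    ← tensorHom_comp_tensorHom, ← tensorHom_comp_tensorHom, ← whisker_exchange_assoc,
    tensor_associativity_assoc, ← tensorμ_natural_right_assoc]
  have := congrArg (fun t => (X ⊗ Y) ◁ t) (BimonObj.mul_comul H)
  simp only [whiskerLeft_comp] at this
  rw [reassoc_of% this, MonoidalCategory.tensorHom_def Δ[H] Δ[H]]
  simp

theorem tensorCoact_comul (h : IsCrossedModule H a c) (k : IsCrossedModule H b d) :
    tensorCoact c d ≫ (X ⊗ Y) ◁ Δ[H] =
      tensorCoact c d ≫ tensorCoact c d ▷ H ≫ (α_ (X ⊗ Y) H H).hom := by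
  have hc : c ≫ c ▷ H = c ≫ X ◁ Δ[H] ≫ (α_ X H H).inv := by simp [reassoc_of% h.coact_comul]
  have hd : d ≫ d ▷ H = d ≫ Y ◁ Δ[H] ≫ (α_ Y H H).inv := by simp [reassoc_of% k.coact_comul]
  have n1 := tensorμ_natural c (𝟙 H) d (𝟙 H)
  have n2 := tensorμ_natural (𝟙 X) Δ[H] (𝟙 Y) Δ[H]
  have n3 := associator_monoidal X H H Y H H
  simp only [tensorHom_id, id_tensorHom, id_whiskerRight] at n1 n2
  have this := congrArg (fun t => (X ⊗ Y) ◁ t) (BimonObj.mul_comul H)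
  simp only [whiskerLeft_comp] at this
  simp only [tensorCoact, comp_whiskerRight, Category.assoc]
  rw [this, ← reassoc_of% n2, tensorHom_comp_tensorHom_assoc, h.coact_comul, k.coact_comul]
  rw [← tensorHom_comp_tensorHom_assoc, ← tensorHom_comp_tensorHom_assoc, ← reassoc_of% n3]
  have m1 : c ≫ c ▷ H ≫ (α_ X H H).hom = c ≫ X ◁ Δ[H] := h.coact_comul.symm
  have m2 : d ≫ d ▷ H ≫ (α_ Y H H).hom = d ≫ Y ◁ Δ[H] := k.coact_comul.symm
  rw [reassoc_of% n1, whisker_exchange_assoc, whisker_exchange_assoc]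
  congr 2
  rw [MonoidalCategory.tensorHom_def' μ[H] μ[H]]
  simp


theorem tensorAct_one (h : IsCrossedModule H a c) (k : IsCrossedModule H b d) :
    (X ⊗ Y) ◁ η[H] ≫ tensorAct a b = (ρ_ (X ⊗ Y)).hom := by
  have := congrArg (fun t => (X ⊗ Y) ◁ t) (Bimon.one_comul H)
  simp only [whiskerLeft_comp] at this
  rw [tensorAct, reassoc_of% this, tensorμ_natural_right_assoc, tensorHom_comp_tensorHom,
    h.act_one, k.act_one, ← tensor_right_unitality]

theorem tensorCoact_counit (h : IsCrossedModule H a c) (k : IsCrossedModule H b d) :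
    tensorCoact c d ≫ (X ⊗ Y) ◁ ε[H] = (ρ_ (X ⊗ Y)).inv := by
  have := congrArg (fun t => (X ⊗ Y) ◁ t) (Bimon.mul_counit H)
  simp only [whiskerLeft_comp] at this
  have n2 := tensorμ_natural (𝟙 X) ε[H] (𝟙 Y) ε[H]
  simp only [id_tensorHom, whiskerLeft_id] at n2
  simp only [tensorCoact, Category.assoc]
  rw [this, ← reassoc_of% n2, tensorHom_comp_tensorHom_assoc, h.coact_counit, k.coact_counit,
    ← cancel_mono (ρ_ (X ⊗ Y)).hom]
  simp only [Category.assoc]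
  rw [← rightUnitor_monoidal]
  simp


theorem t_compat (h : IsCrossedModule H a c) (k : IsCrossedModule H b d) (Z : C) :
    sC ((Z ⊗ X) ⊗ Y) Δ[H] ≫ sB (Z ⊗ X) Y H ▷ H ≫ sB Z X H ▷ Y ▷ H ≫ tA (Z ⊗ H) a b ≫
      tC (Z ⊗ H) c d ≫ sB Z H X ▷ Y ▷ H ≫ sB (Z ⊗ X) H Y ▷ H ≫ sA ((Z ⊗ X) ⊗ Y) μ[H] =
    sC ((Z ⊗ X) ⊗ Y) Δ[H] ≫ tC Z c d ▷ H ▷ H ≫ sB ((Z ⊗ X) ⊗ Y) H H ▷ H ≫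
      tA Z a b ▷ H ▷ H ≫ sA ((Z ⊗ X) ⊗ Y) μ[H] := by
  have yb := congrArg (· ▷ H ▷ H ▷ H) (sB_yb (Z ⊗ X) H Y H)
  simp only [comp_whiskerRight, Category.assoc] at yb
  calc
    _ = sC ((Z ⊗ X) ⊗ Y) Δ[H] ≫ sB (Z ⊗ X) Y H ▷ H ≫
      (sC (Z ⊗ X) Δ[H] ≫ sB Z X H ▷ H ≫ sA (Z ⊗ H) a ≫ sC (Z ⊗ H) c ≫ sB Z H X ▷ H ≫
      sA (Z ⊗ X) μ[H]) ▷ Y ▷ H ≫ sA ((Z ⊗ X) ⊗ H) b ≫ sC ((Z ⊗ X) ⊗ H) d ≫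
        sB (Z ⊗ X) H Y ▷ H ≫ sA ((Z ⊗ X) ⊗ Y) μ[H] := by
      simp only [comp_whiskerRight, Category.assoc]
      rw [reassoc_of% @sA_nat, reassoc_of% @sA_nat, reassoc_of% @sA_nat, reassoc_of% @sC_nat, reassoc_of% @sC_nat, reassoc_of% @sC_nat]
      simp only [tA, tC, Category.assoc, reassoc_of% @sA_nat', reassoc_of% @sC_nat,
        reassoc_of% @sB_nat_w1, reassoc_of% @sA_sB_w1, sA_assoc, reassoc_of% @sB_sCp_w1,
        reassoc_of% @sC_coassoc]
    _ = (sC ((Z ⊗ X) ⊗ Y) Δ[H] ≫ sB (Z ⊗ X) Y H ▷ H ≫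
      (sC Z c ▷ H ≫ sB (Z ⊗ X) H H ≫ sA Z a ▷ H) ▷ Y ▷ H) ≫
      (sC (((Z ⊗ X) ⊗ H) ⊗ Y) Δ[H] ≫ sB ((Z ⊗ X) ⊗ H) Y H ▷ H ≫ sA (((Z ⊗ X) ⊗ H) ⊗ H) b ≫
       sC (((Z ⊗ X) ⊗ H) ⊗ H) d ≫ sB ((Z ⊗ X) ⊗ H) H Y ▷ H ≫ sA (((Z ⊗ X) ⊗ H) ⊗ Y) μ[H]) ≫
        sB (Z ⊗ X) H Y ▷ H ≫ sA ((Z ⊗ X) ⊗ Y) μ[H] := by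
      rw [h.s_compat]
      simp only [comp_whiskerRight, Category.assoc]
      rw [reassoc_of% @sA_nat, reassoc_of% @sC_nat]
      simp only [reassoc_of% @sA_sB_w1, sA_assoc, reassoc_of% @sB_sCp_w1, reassoc_of% @sC_coassoc,
        reassoc_of% @sA_nat', reassoc_of% @sC_nat, reassoc_of% @sB_nat_w1]
    _ = _ := by
      rw [k.s_compat]
      simp only [comp_whiskerRight, Category.assoc, reassoc_of% @sA_nat', reassoc_of% @sA_sBp_w2,
        reassoc_of% @sC_nat, reassoc_of% @sC_nat_w2, reassoc_of% @sB_nat_w1,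
        reassoc_of% @sB_nat_w3, reassoc_of% @sB_nat_w2, reassoc_of% @sB_sC_w2, tC, tA,
        reassoc_of% @sB_sCp_w1, reassoc_of% @sC_nat_w1, reassoc_of% @sA_sB_w2,
        reassoc_of% @sA_sB_w1, reassoc_of% @sA_natp_w1, sA_assoc, reassoc_of% @sC_coassoc]
      rw [← reassoc_of% @sB_nat_w3, reassoc_of% yb]
      simp only [reassoc_of% @sB_nat_w2]

theorem sX_compat {X : C} (a : X ⊗ H ⟶ X) (c : X ⟶ X ⊗ H) (Z : C) : 
    sX Z (X ◁ Δ[H] ≫ (α_ X H H).inv ≫ (β_ X H).hom ▷ H ≫ (α_ H X H).hom ≫ H ◁ a ≫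
      H ◁ c ≫ (α_ H X H).inv ≫ (β_ H X).hom ▷ H ≫ (α_ X H H).hom ≫ X ◁ μ[H]) =
    sC (Z ⊗ X) Δ[H] ≫ sB Z X H ▷ H ≫ sA (Z ⊗ H) a ≫ sC (Z ⊗ H) c ≫ sB Z H X ▷ H ≫
      sA (Z ⊗ X) μ[H] := by
  simp only [sA, sC, sB, sX]
  monoidal

theorem sX_compat' {X : C} (a : X ⊗ H ⟶ X) (c : X ⟶ X ⊗ H) (Z : C) :
    sX Z ((c ⊗ₘ Δ[H]) ≫ tensorμ X H H H ≫ (a ⊗ₘ μ[H])) =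
    sC (Z ⊗ X) Δ[H] ≫ sC Z c ▷ H ▷ H ≫ sB (Z ⊗ X) H H ▷ H ≫
      sA Z a ▷ H ▷ H ≫ sA (Z ⊗ X) μ[H] := by
  simp only [sA, sC, sB, sX, tensorμ]
  rw [MonoidalCategory.tensorHom_def' c, MonoidalCategory.tensorHom_def a]
  monoidal

open BraidedCategory in
theorem sB_tensor_left (Z X Y V : C) :
    sB Z (X ⊗ Y) V = (α_ Z X Y).inv ▷ V ≫ sB (Z ⊗ X) Y V ≫ sB Z X V ▷ Y ≫ (α_ (Z ⊗ V) X Y).hom := by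
  simp only [sB, sX, braiding_tensor_left_hom]; monoidal

open BraidedCategory in
theorem sB_tensor_right (Z X Y V : C) :
    sB Z V (X ⊗ Y) = (α_ (Z ⊗ V) X Y).inv ≫ sB Z V X ▷ Y ≫ sB (Z ⊗ X) V Y ≫ (α_ Z X Y).hom ▷ V := by
  simp only [sB, sX, braiding_tensor_right_hom]; monoidal

theorem sA_tensorAct (Z : C) :
    sA Z (tensorAct a b) = (α_ Z X Y).inv ▷ H ≫ tA Z a b ≫ (α_ Z X Y).hom := by
  rw [tA_eq]; simp

theorem sC_tensorCoact (Z : C) :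
    sC Z (tensorCoact c d) = (α_ Z X Y).inv ≫ tC Z c d ≫ (α_ Z X Y).hom ▷ H := by
  rw [tC_eq]; simp

theorem IsCrossedModule.tensor (h : IsCrossedModule H a c) (k : IsCrossedModule H b d) :
    IsCrossedModule H (tensorAct a b) (tensorCoact c d) where
  act_one := tensorAct_one h k
  act_mul := tensorAct_mul h k
  coact_counit := tensorCoact_counit h k
  coact_comul := tensorCoact_comul h k
  compat := by
    apply sX_inj
    rw [sX_compat, sX_compat']
    simp only [sA_tensorAct, sC_tensorCoact, sB_tensor_left, sB_tensor_right, comp_whiskerRight,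
      Category.assoc, Iso.hom_inv_id_assoc, Iso.inv_hom_id_assoc, hom_inv_whiskerRight_assoc]
    have e := t_compat h k (𝟙_ C)
    have e2 := (α_ (𝟙_ C) X Y).inv ▷ H ≫= e =≫ (α_ (𝟙_ C) X Y).hom ▷ H
    simp only [Category.assoc, sA_nat', reassoc_of% @sC_nat, reassoc_of% @sB_nat] at e2 ⊢
    rw [e2, reassoc_of% @sB_nat_w1]
    simp

theorem tensorAct_hom {X' Y' : C} {a' : X' ⊗ H ⟶ X'} {b' : Y' ⊗ H ⟶ Y'} {f : X ⟶ X'} {g : Y ⟶ Y'}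
    (hf : a ≫ f = f ▷ H ≫ a') (hg : b ≫ g = g ▷ H ≫ b') :
    tensorAct a b ≫ (f ⊗ₘ g) = (f ⊗ₘ g) ▷ H ≫ tensorAct a' b' := by
  simp only [tensorAct, Category.assoc, tensorHom_comp_tensorHom, hf, hg]
  rw [← tensorHom_comp_tensorHom, ← tensorμ_natural_left_assoc, whisker_exchange_assoc]

theorem tensorCoact_hom {X' Y' : C} {c' : X' ⟶ X' ⊗ H} {d' : Y' ⟶ Y' ⊗ H} {f : X ⟶ X'} {g : Y ⟶ Y'}
    (hf : f ≫ c' = c ≫ f ▷ H) (hg : g ≫ d' = d ≫ g ▷ H) :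
    (f ⊗ₘ g) ≫ tensorCoact c' d' = tensorCoact c d ≫ (f ⊗ₘ g) ▷ H := by
  have n := tensorμ_natural f (𝟙 H) g (𝟙 H)
  simp only [tensorHom_id, id_tensorHom, id_whiskerRight] at n
  simp only [tensorCoact, Category.assoc, tensorHom_comp_tensorHom_assoc, hf, hg]
  rw [← tensorHom_comp_tensorHom_assoc, reassoc_of% n, whisker_exchange]

theorem tensorAct_assoc {W : C} (e : W ⊗ H ⟶ W) :
    tensorAct (tensorAct a b) e ≫ (α_ X Y W).hom =
      (α_ X Y W).hom ▷ H ≫ tensorAct a (tensorAct b e) := by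
  have n := tensorμ_natural (𝟙 (X ⊗ Y)) (𝟙 W) Δ[H] (𝟙 H)
  have n' := tensorμ_natural (𝟙 X) (𝟙 (Y ⊗ W)) (𝟙 H) Δ[H]
  have e1 : tensorAct a b ⊗ₘ e = ((X ⊗ Y) ◁ Δ[H]) ▷ (W ⊗ H) ≫ tensorμ X Y H H ▷ (W ⊗ H) ≫
      ((a ⊗ₘ b) ⊗ₘ e) := by
    rw [tensorAct, MonoidalCategory.tensorHom_def, comp_whiskerRight, comp_whiskerRight,
      Category.assoc, Category.assoc, ← MonoidalCategory.tensorHom_def]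
  have e2 : a ⊗ₘ tensorAct b e = (X ⊗ H) ◁ (Y ⊗ W) ◁ Δ[H] ≫ (X ⊗ H) ◁ tensorμ Y W H H ≫
      (a ⊗ₘ (b ⊗ₘ e)) := by
    rw [tensorAct, MonoidalCategory.tensorHom_def', whiskerLeft_comp, whiskerLeft_comp,
      Category.assoc, Category.assoc, ← MonoidalCategory.tensorHom_def']
  have f1 : tensorAct (tensorAct a b) e = ((X ⊗ Y) ⊗ W) ◁ Δ[H] ≫ tensorμ (X ⊗ Y) W H H ≫
    (tensorAct a b ⊗ₘ e) := rfl
  have f2 : tensorAct a (tensorAct b e) = (X ⊗ (Y ⊗ W)) ◁ Δ[H] ≫ tensorμ X (Y ⊗ W) H H ≫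
    (a ⊗ₘ tensorAct b e) := rfl
  simp only [tensorHom_id, id_tensorHom, id_whiskerRight, whiskerLeft_id] at n n'
  have m' := congrArg (fun t => (X ⊗ (Y ⊗ W)) ◁ t) (ComonObj.comul_assoc H)
  simp only [whiskerLeft_comp] at m'
  have q := associator_monoidal X Y W H H H
  rw [f1, f2, e1, e2]
  simp only [Category.assoc]
  rw [← reassoc_of% n, ← reassoc_of% n', reassoc_of% m', associator_naturality, reassoc_of% q,
    MonoidalCategory.tensorHom_def, Category.assoc, whisker_exchange_assoc, whisker_exchange_assoc]

theorem tensorCoact_assoc {W : C} (e : W ⟶ W ⊗ H) :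
    (α_ X Y W).hom ≫ tensorCoact c (tensorCoact d e) =
      tensorCoact (tensorCoact c d) e ≫ (α_ X Y W).hom ▷ H := by
  have n := tensorμ_natural (𝟙 (X ⊗ Y)) μ[H] (𝟙 W) (𝟙 H)
  have n' := tensorμ_natural (𝟙 X) (𝟙 H) (𝟙 (Y ⊗ W)) μ[H]
  have e1 : tensorCoact c d ⊗ₘ e = ((c ⊗ₘ d) ⊗ₘ e) ≫ tensorμ X H Y H ▷ (W ⊗ H) ≫
      ((X ⊗ Y) ◁ μ[H]) ▷ (W ⊗ H) := by
    rw [tensorCoact, MonoidalCategory.tensorHom_def', comp_whiskerRight, comp_whiskerRight,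
      ← Category.assoc, ← MonoidalCategory.tensorHom_def']
  have e2 : c ⊗ₘ tensorCoact d e = (c ⊗ₘ (d ⊗ₘ e)) ≫ (X ⊗ H) ◁ tensorμ Y H W H ≫
      (X ⊗ H) ◁ (Y ⊗ W) ◁ μ[H] := by
    rw [tensorCoact, MonoidalCategory.tensorHom_def, whiskerLeft_comp, whiskerLeft_comp,
      ← Category.assoc, ← MonoidalCategory.tensorHom_def]
  have f1 : tensorCoact (tensorCoact c d) e = (tensorCoact c d ⊗ₘ e) ≫ tensorμ (X ⊗ Y) H W H ≫
    ((X ⊗ Y) ⊗ W) ◁ μ[H] := rfl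
  have f2 : tensorCoact c (tensorCoact d e) = (c ⊗ₘ tensorCoact d e) ≫ tensorμ X H (Y ⊗ W) H ≫
    (X ⊗ (Y ⊗ W)) ◁ μ[H] := rfl
  simp only [tensorHom_id, id_tensorHom, id_whiskerRight, whiskerLeft_id] at n n'
  have m' := congrArg (fun t => (X ⊗ (Y ⊗ W)) ◁ t) (MonObj.mul_assoc H)
  simp only [whiskerLeft_comp] at m'
  have q := tensor_associativity X H Y H W H
  rw [f1, f2, e1, e2]
  simp only [Category.assoc]
  rw [reassoc_of% n, reassoc_of% n', ← associator_naturality_assoc, ← reassoc_of% q,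
    MonoidalCategory.tensorHom_def (α_ X Y W).hom, Category.assoc, whisker_exchange,
    whisker_exchange_assoc, m']

/-- The braiding of crossed modules: coact on `Y`, braid `X` with `Y`, act on `X`. -/
def yBr (X : C) {Y : C} (a : X ⊗ H ⟶ X) (d : Y ⟶ Y ⊗ H) : X ⊗ Y ⟶ Y ⊗ X :=
  X ◁ d ≫ (α_ X Y H).inv ≫ (β_ X Y).hom ▷ H ≫ (α_ Y X H).hom ≫ Y ◁ a

def yB (Z : C) (a : X ⊗ H ⟶ X) (d : Y ⟶ Y ⊗ H) : (Z ⊗ X) ⊗ Y ⟶ (Z ⊗ Y) ⊗ X :=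
  sC (Z ⊗ X) d ≫ sB Z X Y ▷ H ≫ sA (Z ⊗ Y) a

theorem sX_yBr (Z : C) : sX Z (yBr X a d) = yB Z a d := by
  simp only [yB, yBr, sA, sC, sB, sX]; monoidal

theorem yB_act (h : IsCrossedModule H a c) (k : IsCrossedModule H b d) (Z : C) :
    tA Z a b ≫ yB Z a d = yB Z a d ▷ H ≫ tA Z b a := by
  calc
    _ = (sC ((Z ⊗ X) ⊗ Y) Δ[H] ≫ sB (Z ⊗ X) Y H ▷ H ≫ sA ((Z ⊗ X) ⊗ H) b ≫ sC ((Z ⊗ X) ⊗ H) d ≫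
        sB (Z ⊗ X) H Y ▷ H ≫ sA ((Z ⊗ X) ⊗ Y) μ[H]) ≫ sB Z X Y ▷ H ≫ sA (Z ⊗ Y) a := by
      simp only [tA, yB, Category.assoc]
      rw [reassoc_of% @sA_nat, reassoc_of% @sC_nat]
      simp only [reassoc_of% @sA_sB_w1, h.sA_act, reassoc_of% @sA_nat']
    _ = _ := by
      rw [k.s_compat]
      simp only [Category.assoc, reassoc_of% @sA_nat', reassoc_of% @sA_sBp_w2, yB,
        comp_whiskerRight, tA, reassoc_of% @sC_nat, reassoc_of% @sA_sB_w1, reassoc_of% @sA_natp_w1,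
        h.sA_act, reassoc_of% @sB_nat_w1]

theorem yB_coact (h : IsCrossedModule H a c) (k : IsCrossedModule H b d) (Z : C) :
    yB Z a d ≫ tC Z d c = tC Z c d ≫ yB Z a d ▷ H := by
  calc
    _ = sC (Z ⊗ X) d ≫ sB Z X Y ▷ H ≫ (sC ((Z ⊗ Y) ⊗ X) Δ[H] ≫ sB (Z ⊗ Y) X H ▷ H ≫
      sA ((Z ⊗ Y) ⊗ H) a ≫ sC ((Z ⊗ Y) ⊗ H) c ≫ sB (Z ⊗ Y) H X ▷ H ≫ sA ((Z ⊗ Y) ⊗ X) μ[H]) := by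
      simp only [tC, yB, Category.assoc]
      rw [← reassoc_of% @sC_nat, ← reassoc_of% @sA_nat]
      simp only [reassoc_of% @sB_sCp_w1, reassoc_of% k.sC_coact, reassoc_of% @sC_nat]
    _ = _ := by
      rw [h.s_compat]
      simp only [reassoc_of% @sC_nat, reassoc_of% @sB_sC_w2, reassoc_of% @sB_nat_w1, tC, yB,
        comp_whiskerRight, Category.assoc, reassoc_of% @sA_nat', sA_nat', reassoc_of% @sB_sCp_w1,
        reassoc_of% @sC_nat_w1, reassoc_of% k.sC_coact]

theorem yB_hexagon (h : IsCrossedModule H a c) {W : C} (e : W ⟶ W ⊗ H) (Z : C) :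
    tC (Z ⊗ X) d e ≫ sB Z X Y ▷ W ▷ H ≫ sB (Z ⊗ Y) X W ▷ H ≫ sA ((Z ⊗ Y) ⊗ W) a =
      yB Z a d ▷ W ≫ yB (Z ⊗ Y) a e := by
  simp only [tC, Category.assoc, reassoc_of% @sA_nat', yB, comp_whiskerRight, reassoc_of% @sC_nat,
    reassoc_of% @sA_sB_w1, h.sA_act, reassoc_of% @sB_nat_w1]

theorem yB_hexagon' {W : C} {q : W ⊗ H ⟶ W} {e : W ⟶ W ⊗ H} (h : IsCrossedModule H q e) (Z : C) :
    sC ((Z ⊗ X) ⊗ Y) e ≫ sB (Z ⊗ X) Y W ▷ H ≫ sB Z X W ▷ Y ▷ H ≫ tA (Z ⊗ W) a b =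
      yB (Z ⊗ X) b e ≫ yB Z a e ▷ Y := by
  simp only [tA, reassoc_of% @sC_nat, reassoc_of% @sB_nat_w1, yB, comp_whiskerRight,
    Category.assoc, reassoc_of% @sA_nat', sA_nat', reassoc_of% @sB_sCp_w1, reassoc_of% h.sC_coact]


theorem yBr_act (h : IsCrossedModule H a c) (k : IsCrossedModule H b d) :
    tensorAct a b ≫ yBr X a d = yBr X a d ▷ H ≫ tensorAct b a := by
  have e := yB_act h k (𝟙_ C)
  simp only [← sX_yBr, tA_eq] at e
  apply whiskerLeft_inj
  simp only [sA, sX, Category.assoc, comp_whiskerRight, Iso.inv_hom_id_assoc,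
    inv_hom_whiskerRight_assoc, cancel_epi, whisker_assoc] at e
  simpa only [← Category.assoc, cancel_mono, whiskerLeft_comp] using e

theorem yBr_coact (h : IsCrossedModule H a c) (k : IsCrossedModule H b d) :
    yBr X a d ≫ tensorCoact d c = tensorCoact c d ≫ yBr X a d ▷ H := by
  have e := yB_coact h k (𝟙_ C)
  simp only [← sX_yBr, tC_eq] at e
  apply whiskerLeft_inj
  simp [sC, sX] at e ⊢
  simpa only [← Category.assoc, cancel_mono] using e

open BraidedCategory in
theorem yBr_hexagon (h : IsCrossedModule H a c) {W : C} (e : W ⟶ W ⊗ H) :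
    (α_ X Y W).hom ≫ yBr X a (tensorCoact d e) ≫ (α_ Y W X).hom =
      yBr X a d ▷ W ≫ (α_ Y X W).hom ≫ Y ◁ yBr X a e := by
  have q := yB_hexagon (d := d) h e (𝟙_ C)
  calc
    _ = 𝟙 _ ⊗≫ (tC (𝟙_ C ⊗ X) d e ≫ sB (𝟙_ C) X Y ▷ W ▷ H ≫ sB (𝟙_ C ⊗ Y) X W ▷ H ≫
        sA ((𝟙_ C ⊗ Y) ⊗ W) a) ⊗≫ 𝟙 _ := by
      simp only [yBr, tensorCoact, tC, sA, sB, sC, sX, tensorμ, braiding_tensor_right_hom,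
        MonoidalCategory.tensorHom_def']
      monoidal
    _ = _ := by
      rw [q]
      simp only [yB, yBr, sA, sB, sC, sX]
      monoidal

open BraidedCategory in
theorem yBr_hexagon' {W : C} {q : W ⊗ H ⟶ W} {e : W ⟶ W ⊗ H} (h : IsCrossedModule H q e) :
    (α_ X Y W).inv ≫ yBr (X ⊗ Y) (tensorAct a b) e ≫ (α_ W X Y).inv =
      X ◁ yBr Y b e ≫ (α_ X W Y).inv ≫ yBr X a e ▷ Y := by
  have q := yB_hexagon' (a := a) (b := b) h (𝟙_ C)
  calc
    _ = 𝟙 _ ⊗≫ (sC ((𝟙_ C ⊗ X) ⊗ Y) e ≫ sB (𝟙_ C ⊗ X) Y W ▷ H ≫ sB (𝟙_ C) X W ▷ Y ▷ H ≫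
        tA (𝟙_ C ⊗ W) a b) ⊗≫ 𝟙 _ := by
      simp only [yBr, tensorAct, tA, sA, sB, sC, sX, tensorμ, braiding_tensor_left_hom,
        MonoidalCategory.tensorHom_def]
      monoidal
    _ = _ := by
      rw [q]
      simp only [yB, yBr, sA, sB, sC, sX]
      monoidal

theorem yBr_nat {X' Y' : C} {a' : X' ⊗ H ⟶ X'} {d' : Y' ⟶ Y' ⊗ H} {f : X ⟶ X'} {g : Y ⟶ Y'}
    (hf : a ≫ f = f ▷ H ≫ a') (hg : g ≫ d' = d ≫ g ▷ H) :
    (f ⊗ₘ g) ≫ yBr X' a' d' = yBr X a d ≫ (g ⊗ₘ f) := by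
  calc
    _ = 𝟙 _ ⊗≫ f ▷ Y ⊗≫ X' ◁ (g ≫ d') ⊗≫ (β_ X' Y').hom ▷ H ⊗≫ Y' ◁ a' := by
      rw [yBr, MonoidalCategory.tensorHom_def]; monoidal
    _ = 𝟙 _ ⊗≫ (f ▷ Y ≫ X' ◁ d) ⊗≫ (X' ◁ g ≫ (β_ X' Y').hom) ▷ H ⊗≫ Y' ◁ a' := by
      rw [hg]; monoidal
    _ = 𝟙 _ ⊗≫ X ◁ d ⊗≫ (f ▷ Y ≫ (β_ X' Y).hom) ▷ H ⊗≫ (g ▷ (X' ⊗ H) ≫ Y' ◁ a') := by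
      rw [← whisker_exchange, BraidedCategory.braiding_naturality_right]; monoidal
    _ = 𝟙 _ ⊗≫ X ◁ d ⊗≫ (β_ X Y).hom ▷ H ⊗≫ Y ◁ (f ▷ H ≫ a') ⊗≫ g ▷ X' := by
      rw [← whisker_exchange, BraidedCategory.braiding_naturality_left]; monoidal
    _ = _ := by
      rw [← hf, yBr, MonoidalCategory.tensorHom_def']; monoidal

section inverse

variable [IsIso 𝒮[H]]

theorem conv1 : Δ[H] ≫ (β_ H H).inv ≫ (𝟙 H ⊗ₘ inv 𝒮[H]) ≫ μ[H] = ε[H] ≫ η[H] := by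
  rw [← cancel_mono 𝒮[H]]
  simp only [Category.assoc, HopfObj.mul_antipode, HopfObj.one_antipode]
  rw [tensorHom_comp_tensorHom_assoc, ← BraidedCategory.braiding_inv_naturality_assoc]
  simp

theorem conv2 : Δ[H] ≫ (β_ H H).inv ≫ (inv 𝒮[H] ⊗ₘ 𝟙 H) ≫ μ[H] = ε[H] ≫ η[H] := by
  rw [← cancel_mono 𝒮[H]]
  simp only [Category.assoc, HopfObj.mul_antipode, HopfObj.one_antipode]
  rw [tensorHom_comp_tensorHom_assoc, ← BraidedCategory.braiding_inv_naturality_assoc]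
  simp

def phi (a : X ⊗ H ⟶ X) (d : Y ⟶ Y ⊗ H) (f : H ⟶ H) : X ⊗ Y ⟶ X ⊗ Y :=
  X ◁ (d ≫ Y ◁ f ≫ (β_ H Y).inv) ≫ (α_ X H Y).inv ≫ a ▷ Y

open BraidedCategory in
theorem phi_comp (h : IsCrossedModule H a c) (k : IsCrossedModule H b d) (f g : H ⟶ H)
    (w : Δ[H] ≫ (β_ H H).inv ≫ (f ⊗ₘ g) ≫ μ[H] = ε[H] ≫ η[H]) :
    phi a d f ≫ phi a d g = 𝟙 _ := by
  have e : d ≫ Y ◁ f ≫ (β_ H Y).inv ≫ H ◁ (d ≫ Y ◁ g ≫ (β_ H Y).inv) ≫ (α_ H H Y).inv ≫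
      μ[H] ▷ Y = (λ_ Y).inv ≫ η[H] ▷ Y := by
    calc
      _ = d ≫ Y ◁ f ≫ ((β_ H Y).inv ≫ H ◁ d) ≫ H ◁ Y ◁ g ≫ H ◁ (β_ H Y).inv ≫ (α_ H H Y).inv ≫
          μ[H] ▷ Y := by monoidal
      _ = (d ≫ Y ◁ f ≫ d ▷ H) ≫ (β_ H (Y ⊗ H)).inv ≫ H ◁ Y ◁ g ≫ H ◁ (β_ H Y).inv ≫
          (α_ H H Y).inv ≫ μ[H] ▷ Y := by
        rw [← braiding_inv_naturality_left]; simp only [Category.assoc]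
      _ = (d ≫ Y ◁ Δ[H]) ≫ (α_ Y H H).inv ≫ (Y ⊗ H) ◁ f ≫ (Y ◁ g) ▷ H ≫ (β_ H (Y ⊗ H)).inv ≫
          H ◁ (β_ H Y).inv ≫ (α_ H H Y).inv ≫ μ[H] ▷ Y := by
        rw [k.coact_comul, whisker_exchange, ← braiding_inv_naturality_left_assoc]
        simp only [Category.assoc, Iso.hom_inv_id_assoc]
      _ = d ≫ Y ◁ (Δ[H] ≫ (β_ H H).inv ≫ (f ⊗ₘ g) ≫ μ[H]) ≫ (β_ H Y).inv := by
        rw [← braiding_inv_naturality_assoc]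
        simp only [whiskerLeft_comp, Category.assoc]
        rw [braiding_inv_naturality_right, braiding_tensor_right_inv, braiding_tensor_left_inv,
          MonoidalCategory.tensorHom_def']
        monoidal
      _ = _ := by
        rw [w, whiskerLeft_comp, Category.assoc, reassoc_of% k.coact_counit,
          braiding_inv_naturality_right]
        simp
  calc
    _ = 𝟙 _ ⊗≫ X ◁ (d ≫ Y ◁ f ≫ (β_ H Y).inv) ⊗≫
        (a ▷ Y ≫ X ◁ (d ≫ Y ◁ g ≫ (β_ H Y).inv)) ⊗≫ a ▷ Y := by
      simp only [phi]; monoidal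
    _ = 𝟙 _ ⊗≫ X ◁ (d ≫ Y ◁ f ≫ (β_ H Y).inv) ⊗≫
        X ◁ H ◁ (d ≫ Y ◁ g ≫ (β_ H Y).inv) ⊗≫ (a ▷ H ≫ a) ▷ Y := by
      rw [← whisker_exchange]; monoidal
    _ = 𝟙 _ ⊗≫ X ◁ (d ≫ Y ◁ f ≫ (β_ H Y).inv ≫ H ◁ (d ≫ Y ◁ g ≫ (β_ H Y).inv) ≫
      (α_ H H Y).inv ≫ μ[H] ▷ Y) ⊗≫ a ▷ Y := by
      have : a ▷ H ≫ a = (α_ X H H).hom ≫ X ◁ μ[H] ≫ a := by simp [h.act_mul]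
      rw [this]; monoidal
    _ = 𝟙 _ ⊗≫ (X ◁ η[H] ≫ a) ▷ Y ⊗≫ 𝟙 _ := by
      rw [e]; monoidal
    _ = _ := by rw [h.act_one]; monoidal

theorem yBr_eq_phi : yBr X a d = phi a d (𝟙 H) ≫ (β_ X Y).hom := by
  simp only [phi, yBr, Category.assoc, BraidedCategory.braiding_naturality_left]
  simp

noncomputable def yBrInv (X : C) {Y : C} (a : X ⊗ H ⟶ X) (d : Y ⟶ Y ⊗ H) : Y ⊗ X ⟶ X ⊗ Y :=
  (β_ X Y).inv ≫ phi a d (inv 𝒮[H])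

theorem yBr_inv (h : IsCrossedModule H a c) (k : IsCrossedModule H b d) :
    yBr X a d ≫ yBrInv X a d = 𝟙 _ := by
  rw [yBr_eq_phi, yBrInv, Category.assoc, Iso.hom_inv_id_assoc, phi_comp h k _ _ conv1]

theorem yBrInv_hom (h : IsCrossedModule H a c) (k : IsCrossedModule H b d) :
    yBrInv X a d ≫ yBr X a d = 𝟙 _ := by
  rw [yBr_eq_phi, yBrInv, Category.assoc, reassoc_of% phi_comp h k _ _ conv2, Iso.inv_hom_id]

end inverse

end tensor

section unit

variable (H) in
/-- The trivial action. -/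
def unitAct : 𝟙_ C ⊗ H ⟶ 𝟙_ C := (λ_ H).hom ≫ ε[H]

variable (H) in
/-- The trivial coaction. -/
def unitCoact : 𝟙_ C ⟶ 𝟙_ C ⊗ H := η[H] ≫ (λ_ H).inv

theorem IsCrossedModule.unit : IsCrossedModule H (unitAct H) (unitCoact H) where
  act_one := by simp [unitAct, unitors_equal]
  act_mul := by
    simp [unitAct, Bimon.mul_counit, MonoidalCategory.tensorHom_def]
  coact_counit := by simp [unitCoact, unitors_inv_equal]
  coact_comul := by
    calc
      _ = 𝟙 _ ⊗≫ (η[H] ≫ Δ[H]) ⊗≫ 𝟙 _ := by rw [unitCoact]; monoidal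
      _ = _ := by
        rw [Bimon.one_comul, unitCoact, MonoidalCategory.tensorHom_def']
        monoidal
  compat := by
    calc
      _ = 𝟙 _ ⊗≫ (Δ[H] ≫ H ◁ ε[H]) ⊗≫ (H ◁ η[H] ≫ μ[H]) ⊗≫ 𝟙 _ := by
        simp only [braiding_tensorUnit_left, braiding_tensorUnit_right, unitAct, unitCoact]
        monoidal
      _ = 𝟙 _ ⊗≫ (Δ[H] ≫ ε[H] ▷ H) ⊗≫ (η[H] ▷ H ≫ μ[H]) ⊗≫ 𝟙 _ := by
        rw [ComonObj.comul_counit, MonObj.mul_one, ComonObj.counit_comul, MonObj.one_mul]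
        monoidal
      _ = 𝟙 _ ⊗≫ Δ[H] ⊗≫ (ε[H] ▷ 𝟙_ C ≫ 𝟙_ C ◁ η[H]) ▷ H ⊗≫ μ[H] ⊗≫ 𝟙 _ := by
        monoidal
      _ = 𝟙 _ ⊗≫ Δ[H] ⊗≫ ((β_ (𝟙_ C) H).hom ≫ H ◁ η[H]) ▷ H ⊗≫ ε[H] ▷ H ▷ H ⊗≫ μ[H] ⊗≫
          𝟙 _ := by
        rw [← whisker_exchange, braiding_tensorUnit_left]; monoidal
      _ = _ := by
        rw [← BraidedCategory.braiding_naturality_left, tensorμ, unitAct, unitCoact,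
          MonoidalCategory.tensorHom_def', MonoidalCategory.tensorHom_def]
        monoidal

variable {X : C} {b : X ⊗ H ⟶ X} {d : X ⟶ X ⊗ H}

theorem leftUnitor_act : tensorAct (unitAct H) b ≫ (λ_ X).hom = (λ_ X).hom ▷ H ≫ b := by
  rw [tensorAct, unitAct, tensorμ, MonoidalCategory.tensorHom_def]
  calc
    _ = 𝟙 _ ⊗≫ X ◁ Δ[H] ⊗≫ ((β_ X H).hom ≫ ε[H] ▷ X) ▷ H ⊗≫ b := by monoidal
    _ = 𝟙 _ ⊗≫ X ◁ (Δ[H] ≫ ε[H] ▷ H) ⊗≫ (β_ X (𝟙_ C)).hom ▷ H ⊗≫ b := by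
      rw [← BraidedCategory.braiding_naturality_right]; monoidal
    _ = _ := by rw [ComonObj.counit_comul, braiding_tensorUnit_right]; monoidal

theorem leftUnitor_coact :
    (λ_ X).hom ≫ d = tensorCoact (unitCoact H) d ≫ (λ_ X).hom ▷ H := by
  rw [tensorCoact, unitCoact, tensorμ, MonoidalCategory.tensorHom_def']
  symm
  calc
    _ = 𝟙 _ ⊗≫ d ⊗≫ (η[H] ▷ X ≫ (β_ H X).hom) ▷ H ⊗≫ X ◁ μ[H] := by monoidal
    _ = 𝟙 _ ⊗≫ d ⊗≫ (β_ (𝟙_ C) X).hom ▷ H ⊗≫ X ◁ (η[H] ▷ H ≫ μ[H]) := by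
      rw [BraidedCategory.braiding_naturality_left]; monoidal
    _ = _ := by rw [MonObj.one_mul, braiding_tensorUnit_left]; monoidal

theorem rightUnitor_act : tensorAct b (unitAct H) ≫ (ρ_ X).hom = (ρ_ X).hom ▷ H ≫ b := by
  rw [tensorAct, unitAct, tensorμ, MonoidalCategory.tensorHom_def', braiding_tensorUnit_left]
  calc
    _ = 𝟙 _ ⊗≫ X ◁ (Δ[H] ≫ H ◁ ε[H]) ⊗≫ b := by monoidal
    _ = _ := by rw [ComonObj.comul_counit]; monoidal

theorem rightUnitor_coact :
    (ρ_ X).hom ≫ d = tensorCoact d (unitCoact H) ≫ (ρ_ X).hom ▷ H := by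
  rw [tensorCoact, unitCoact, tensorμ, MonoidalCategory.tensorHom_def, braiding_tensorUnit_right]
  symm
  calc
    _ = 𝟙 _ ⊗≫ d ⊗≫ X ◁ (H ◁ η[H] ≫ μ[H]) := by monoidal
    _ = _ := by rw [MonObj.mul_one]; monoidal

end unit

end CM


/-- A right crossed module over the Hopf algebra `H`. -/
structure CrossedModule {C : Type u} [Category.{v} C] [MonoidalCategory C] [BraidedCategory C]
    (H : C) [HopfObj H] where
  X : C
  act : X ⊗ H ⟶ X
  coact : X ⟶ X ⊗ H
  isCrossedModule : IsCrossedModule H act coact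

namespace CrossedModule

variable {C : Type u} [Category.{v} C] [MonoidalCategory C] [BraidedCategory C]
  {H : C} [HopfObj H]

/-- Morphisms of `C` which are both module and comodule maps. -/
@[ext]
structure Hom (M N : CrossedModule H) where
  hom : M.X ⟶ N.X
  act_hom : M.act ≫ hom = hom ▷ H ≫ N.act
  hom_coact : hom ≫ N.coact = M.coact ≫ hom ▷ H

instance : Category (CrossedModule H) where
  Hom M N := Hom M N
  id M := ⟨𝟙 M.X, by simp, by simp⟩
  comp f g := ⟨f.hom ≫ g.hom, by simp [reassoc_of% f.act_hom, g.act_hom],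
    by simp [reassoc_of% f.hom_coact, g.hom_coact]⟩

@[ext]
theorem hom_ext {M N : CrossedModule H} {f g : M ⟶ N} (h : f.hom = g.hom) : f = g :=
  Hom.ext h

@[simp]
theorem id_hom (M : CrossedModule H) : Hom.hom (𝟙 M) = 𝟙 M.X := rfl

@[simp]
theorem comp_hom {M N P : CrossedModule H} (f : M ⟶ N) (g : N ⟶ P) :
    (f ≫ g).hom = f.hom ≫ g.hom := rfl

def mkIso {M N : CrossedModule H} (e : M.X ≅ N.X) (h : M.act ≫ e.hom = e.hom ▷ H ≫ N.act)
    (h' : e.hom ≫ N.coact = M.coact ≫ e.hom ▷ H) : M ≅ N where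
  hom := ⟨e.hom, h, h'⟩
  inv := ⟨e.inv, by rw [Iso.comp_inv_eq, Category.assoc, h]; simp,
    by rw [Iso.inv_comp_eq, reassoc_of% h']; simp⟩

variable (H) in
@[simps]
def forget : CrossedModule H ⥤ C where
  obj M := M.X
  map f := f.hom

instance : (forget H).Faithful where
  map_injective h := hom_ext h

def tensor (M N : CrossedModule H) : CrossedModule H :=
  ⟨M.X ⊗ N.X, tensorAct M.act N.act, tensorCoact M.coact N.coact,
    M.isCrossedModule.tensor N.isCrossedModule⟩

def tensorHom {M N M' N' : CrossedModule H} (f : M ⟶ M') (g : N ⟶ N') :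
    tensor M N ⟶ tensor M' N' :=
  ⟨f.hom ⊗ₘ g.hom, tensorAct_hom f.act_hom g.act_hom, tensorCoact_hom f.hom_coact g.hom_coact⟩

theorem whiskerLeft_act (M : CrossedModule H) {N N' : CrossedModule H} (g : N ⟶ N') :
    tensorAct M.act N.act ≫ M.X ◁ g.hom = (M.X ◁ g.hom) ▷ H ≫ tensorAct M.act N'.act := by
  have := tensorAct_hom (a := M.act) (a' := M.act) (f := 𝟙 M.X) (by simp) g.act_hom
  simpa only [id_tensorHom] using this

theorem whiskerLeft_coact (M : CrossedModule H) {N N' : CrossedModule H} (g : N ⟶ N') :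
    M.X ◁ g.hom ≫ tensorCoact M.coact N'.coact =
      tensorCoact M.coact N.coact ≫ (M.X ◁ g.hom) ▷ H := by
  have := tensorCoact_hom (c := M.coact) (c' := M.coact) (f := 𝟙 M.X) (by simp) g.hom_coact
  simpa only [id_tensorHom] using this

theorem whiskerRight_act {M M' : CrossedModule H} (f : M ⟶ M') (N : CrossedModule H) :
    tensorAct M.act N.act ≫ f.hom ▷ N.X = (f.hom ▷ N.X) ▷ H ≫ tensorAct M'.act N.act := by
  have := tensorAct_hom (b := N.act) (b' := N.act) (g := 𝟙 N.X) f.act_hom (by simp)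
  simpa only [tensorHom_id] using this

theorem whiskerRight_coact {M M' : CrossedModule H} (f : M ⟶ M') (N : CrossedModule H) :
    f.hom ▷ N.X ≫ tensorCoact M'.coact N.coact =
      tensorCoact M.coact N.coact ≫ (f.hom ▷ N.X) ▷ H := by
  have := tensorCoact_hom (d := N.coact) (d' := N.coact) (g := 𝟙 N.X) f.hom_coact (by simp)
  simpa only [tensorHom_id] using this

instance : MonoidalCategoryStruct (CrossedModule H) where
  tensorObj := tensor
  tensorHom := tensorHom
  whiskerLeft M _ _ g := ⟨M.X ◁ g.hom, whiskerLeft_act M g, whiskerLeft_coact M g⟩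
  whiskerRight f N := ⟨f.hom ▷ N.X, whiskerRight_act f N, whiskerRight_coact f N⟩
  tensorUnit := ⟨𝟙_ C, unitAct H, unitCoact H, IsCrossedModule.unit⟩
  associator M N P := mkIso (α_ M.X N.X P.X) (tensorAct_assoc _) (tensorCoact_assoc _)
  leftUnitor M := mkIso (λ_ M.X) leftUnitor_act leftUnitor_coact
  rightUnitor M := mkIso (ρ_ M.X) rightUnitor_act rightUnitor_coact

instance : MonoidalCategory (CrossedModule H) where
  tensorHom_def f g := hom_ext (MonoidalCategory.tensorHom_def f.hom g.hom)
  id_tensorHom_id M N := hom_ext (MonoidalCategory.id_tensorHom_id M.X N.X)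
  tensorHom_comp_tensorHom f g f' g' :=
    hom_ext (MonoidalCategory.tensorHom_comp_tensorHom f.hom g.hom f'.hom g'.hom)
  whiskerLeft_id M N := hom_ext (MonoidalCategory.whiskerLeft_id M.X N.X)
  id_whiskerRight M N := hom_ext (MonoidalCategory.id_whiskerRight M.X N.X)
  associator_naturality f g h :=
    hom_ext (MonoidalCategory.associator_naturality f.hom g.hom h.hom)
  leftUnitor_naturality f := hom_ext (MonoidalCategory.leftUnitor_naturality f.hom)
  rightUnitor_naturality f := hom_ext (MonoidalCategory.rightUnitor_naturality f.hom)
  pentagon M N P Q := hom_ext (MonoidalCategory.pentagon M.X N.X P.X Q.X)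
  triangle M N := hom_ext (MonoidalCategory.triangle M.X N.X)

theorem whiskerLeft_yBr (M : CrossedModule H) {N N' : CrossedModule H} (g : N ⟶ N') :
    M.X ◁ g.hom ≫ yBr M.X M.act N'.coact = yBr M.X M.act N.coact ≫ g.hom ▷ M.X := by
  have := yBr_nat (a := M.act) (a' := M.act) (f := 𝟙 M.X) (by simp) g.hom_coact
  simpa only [id_tensorHom, tensorHom_id] using this

theorem whiskerRight_yBr {M M' : CrossedModule H} (f : M ⟶ M') (N : CrossedModule H) :
    f.hom ▷ N.X ≫ yBr M'.X M'.act N.coact = yBr M.X M.act N.coact ≫ N.X ◁ f.hom := by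
  have := yBr_nat f.act_hom (d := N.coact) (d' := N.coact) (g := 𝟙 N.X) (by simp)
  simpa only [id_tensorHom, tensorHom_id] using this

@[simp]
theorem tensorObj_X (M N : CrossedModule H) : (M ⊗ N).X = M.X ⊗ N.X := rfl

theorem tensorObj_act (M N : CrossedModule H) : (M ⊗ N).act = tensorAct M.act N.act := rfl

theorem tensorObj_coact (M N : CrossedModule H) :
    (M ⊗ N).coact = tensorCoact M.coact N.coact := rfl

@[simp]
theorem tensorUnit_X : (𝟙_ (CrossedModule H)).X = 𝟙_ C := rfl

variable [IsIso 𝒮[H]]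

/-- The category of crossed modules is braided by `yBr`. -/
noncomputable instance : BraidedCategory (CrossedModule H) where
  braiding M N := mkIso
    ⟨yBr M.X M.act N.coact, yBrInv M.X M.act N.coact,
      yBr_inv M.isCrossedModule N.isCrossedModule, yBrInv_hom M.isCrossedModule N.isCrossedModule⟩
    (yBr_act M.isCrossedModule N.isCrossedModule) (yBr_coact M.isCrossedModule N.isCrossedModule)
  braiding_naturality_right M _ _ g := hom_ext (whiskerLeft_yBr M g)
  braiding_naturality_left f N := hom_ext (whiskerRight_yBr f N)
  hexagon_forward M N P := hom_ext (yBr_hexagon M.isCrossedModule P.coact)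
  hexagon_reverse M N P := hom_ext (yBr_hexagon' P.isCrossedModule)

theorem braiding_hom_hom (M N : CrossedModule H) :
    (β_ M N).hom.hom = yBr M.X M.act N.coact := rfl

end CrossedModule

section CrossProduct

variable {C : Type u} [Category.{v} C] [MonoidalCategory C] [BraidedCategory C]
  (A : C) [HopfObj A] [IsIso 𝒮[A]] (B : CrossedModule A) [HopfObj B]

/-! The structure morphisms of the Hopf algebra `B` of crossed modules, as morphisms of `C`. -/

def uOne : 𝟙_ C ⟶ B.X := η[B].hom

def uMul : B.X ⊗ B.X ⟶ B.X := μ[B].hom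

def uCounit : B.X ⟶ 𝟙_ C := ε[B].hom

def uComul : B.X ⟶ B.X ⊗ B.X := Δ[B].hom

def uAntipode : B.X ⟶ B.X := 𝒮[B].hom

/-- The unit of the cross product: `η_A ⊗ η_B`. -/
def crossOne : 𝟙_ C ⟶ A ⊗ B.X :=
  (λ_ (𝟙_ C)).inv ≫ (η[A] ⊗ₘ uOne A B)

/-- The multiplication of the cross product: on `A ⊗ B ⊗ A ⊗ B`, apply `Δ` to the second `A`, move
its first leg past the first `B` by `Ψ_{B,A}`, let the second leg act on the first `B`, and multiply
the two factors `A` and the two factors `B`. -/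
def crossMul : (A ⊗ B.X) ⊗ (A ⊗ B.X) ⟶ A ⊗ B.X :=
  (A ⊗ B.X) ◁ Δ[A] ▷ B.X ⊗≫ A ◁ (β_ B.X A).hom ▷ A ▷ B.X ⊗≫
    A ◁ A ◁ B.act ▷ B.X ⊗≫ (μ[A] ⊗ₘ uMul A B)

/-- The counit of the cross product: `ε_A ⊗ ε_B`. -/
def crossCounit : A ⊗ B.X ⟶ 𝟙_ C :=
  (ε[A] ⊗ₘ uCounit A B) ≫ (λ_ (𝟙_ C)).hom

/-- The comultiplication of the cross product: on `A ⊗ B`, apply `Δ_A ⊗ Δ_B`, let `A` coact on the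
first `B`, move the second `A` past the first `B` by `Ψ_{A,B}`, and multiply the two adjacent factors
`A`. -/
def crossComul : A ⊗ B.X ⟶ (A ⊗ B.X) ⊗ (A ⊗ B.X) :=
  (Δ[A] ⊗ₘ uComul A B) ⊗≫ A ◁ A ◁ B.coact ▷ B.X ⊗≫
    A ◁ (β_ A B.X).hom ▷ A ▷ B.X ⊗≫ (A ⊗ B.X) ◁ μ[A] ▷ B.X

/-- The antipode of the cross product. -/
def crossAntipode : A ⊗ B.X ⟶ A ⊗ B.X :=
  A ◁ B.coact ⊗≫ (β_ A B.X).hom ▷ A ⊗≫ B.X ◁ μ[A] ≫ (uAntipode A B ⊗ₘ 𝒮[A]) ≫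
    B.X ◁ Δ[A] ⊗≫ (β_ B.X A).hom ▷ A ⊗≫ A ◁ B.act

variable {A B}

/-- The action `X ⊗ B ⟶ X` of a crossed module over `B`, as a morphism of `C`. -/
def uAct (X : CrossedModule B) : X.X.X ⊗ B.X ⟶ X.X.X := X.act.hom

/-- The coaction `X ⟶ X ⊗ B` of a crossed module over `B`, as a morphism of `C`. -/
def uCoact (X : CrossedModule B) : X.X.X ⟶ X.X.X ⊗ B.X := X.coact.hom

/-- The action of the cross product on a crossed module over `B`: act by `A`, then by `B`. -/
def crossAct (X : CrossedModule B) : X.X.X ⊗ (A ⊗ B.X) ⟶ X.X.X :=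
  (α_ X.X.X A B.X).inv ≫ X.X.act ▷ B.X ≫ uAct X

/-- The coaction of the cross product on a crossed module over `B`: coact by `B`, then by `A`. -/
def crossCoact (X : CrossedModule B) : X.X.X ⟶ X.X.X ⊗ (A ⊗ B.X) :=
  uCoact X ≫ X.X.coact ▷ B.X ≫ (α_ X.X.X A B.X).hom

theorem crossAct_hom {X Y : CrossedModule B} (f : X ⟶ Y) :
    crossAct X ≫ f.hom.hom = f.hom.hom ▷ (A ⊗ B.X) ≫ crossAct Y := by
  have h1 : uAct X ≫ f.hom.hom = f.hom.hom ▷ B.X ≫ uAct Y :=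
    congrArg CrossedModule.Hom.hom f.act_hom
  have h2 := congrArg (· ▷ B.X) f.hom.act_hom
  simp only [comp_whiskerRight] at h2
  simp only [crossAct, Category.assoc]
  rw [h1, reassoc_of% h2]
  simp

theorem hom_crossCoact {X Y : CrossedModule B} (f : X ⟶ Y) :
    f.hom.hom ≫ crossCoact Y = crossCoact X ≫ f.hom.hom ▷ (A ⊗ B.X) := by
  have h1 : f.hom.hom ≫ uCoact Y = uCoact X ≫ f.hom.hom ▷ B.X :=
    congrArg CrossedModule.Hom.hom f.hom_coact
  have h2 := congrArg (· ▷ B.X) f.hom.hom_coact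
  simp only [comp_whiskerRight] at h2
  simp only [crossCoact, Category.assoc]
  rw [reassoc_of% h1, reassoc_of% h2]
  simp

/-- The functor from crossed modules over `B` in crossed modules over `A` to crossed modules over
the cross product, for a Hopf algebra structure on `A ⊗ B` for which `crossAct` and `crossCoact` are
crossed module structures. It does not change underlying objects and morphisms. -/
def crossFunctor [HopfObj (A ⊗ B.X)]
    (h : ∀ X : CrossedModule B, IsCrossedModule (A ⊗ B.X) (crossAct X) (crossCoact X)) :
    CrossedModule B ⥤ CrossedModule (A ⊗ B.X) where
  obj X := ⟨X.X.X, crossAct X, crossCoact X, h X⟩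
  map f := ⟨f.hom.hom, crossAct_hom f, hom_crossCoact f⟩

end CrossProduct

end Braided

/-! A module `X` and a comodule `Y` over `H` suffice to form `twist`: `X ⊗ Y ⟶ Y ⊗ X`, which coacts
on `Y`, braids, and acts on `X`. The whole proof is written in this one morphism. The diagonal
action and coaction are `twist b Δ` and `twist μ d` followed or preceded by one action or coaction
(`tensorAct_eq_twist`, `tensorCoact_eq_twist`). The bialgebra axiom and the crossed module axiom
have the same right-hand side, a coaction, `twist μ Δ`, and an action, with left-hand sides `μ ≫ Δ`
and `twist a Δ ≫ twist μ c`. The calculus of `twist` consists of naturality, multiplicativity in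
each variable (`twist_tensorAct`, `twist_tensorCoact`) and the resulting Yang-Baxter equation.

For `H = A ⊗ B`, acting first by `A` and then by `B`, and coacting in the opposite order, turns
`twist` into `dTwist`, the same construction for `B` with the braiding of crossed modules over `A`
(`twist_dAct_dCoact`). The multiplication of the cross product is itself such a composite action, of
`A ⊗ B` on itself, and the comultiplication is such a composite coaction. Consequently
`twist_cComul` and `twist_cMul` factor a twist with the cross product into a twist with `A` and a
`dTwist` with `B`. Associativity, the bialgebra axiom, the crossed module axiom and the agreement of
tensor products follow by sliding these factors past each other. The mixed conditions needed on the
way are that the structure maps of `B` and of `X` are linear and colinear over `A`.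

The antipode comes from the convolution algebra: the identity of `A ⊗ B` is the product of the
projections onto `A` and onto `B`, composed with the inclusions. Each is invertible through the
antipode of its factor, and the reversed product of inverses is the stated formula. That antipode is
invertible because every `twist` is, by means of the inverse of the antipode of `A`.

Conversely, a crossed module over the cross product restricts along the inclusions and corestricts
along the projections of the two factors. Testing its axioms on these maps gives every axiom over
`A` and `B` (`compat_factors`), and the two passages are inverse on the nose. -/

namespace Braided

/-! ### The twist of a module with a comodule -/

section Twist

variable {C : Type u} [Category.{v} C] [MonoidalCategory C]

/-- `a` is a right action on `X` of an object `H` with unit `e` and multiplication `m`. -/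
structure IsAct {H X : C} (e : 𝟙_ C ⟶ H) (m : H ⊗ H ⟶ H) (a : X ⊗ H ⟶ X) : Prop where
  one : X ◁ e ≫ a = (ρ_ X).hom
  mul : X ◁ m ≫ a = (α_ X H H).inv ≫ a ▷ H ≫ a

/-- `c` is a right coaction on `X` of an object `H` with counit `e` and comultiplication `m`. -/
structure IsCoact {H X : C} (e : H ⟶ 𝟙_ C) (m : H ⟶ H ⊗ H) (c : X ⟶ X ⊗ H) : Prop where
  counit : c ≫ X ◁ e = (ρ_ X).inv
  comul : c ≫ X ◁ m = c ≫ c ▷ H ≫ (α_ X H H).hom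

theorem IsAct.mul' {H X : C} {e : 𝟙_ C ⟶ H} {m : H ⊗ H ⟶ H} {a : X ⊗ H ⟶ X}
    (h : IsAct e m a) : a ▷ H ≫ a = (α_ X H H).hom ≫ X ◁ m ≫ a := by
  simp [h.mul]

theorem IsCoact.comul' {H X : C} {e : H ⟶ 𝟙_ C} {m : H ⟶ H ⊗ H} {c : X ⟶ X ⊗ H}
    (h : IsCoact e m c) : c ≫ c ▷ H = c ≫ X ◁ m ≫ (α_ X H H).inv := by
  simp [reassoc_of% h.comul]

variable [BraidedCategory C]

/-- The morphism `X ⊗ Y ⟶ Y ⊗ X` which coacts on `Y`, braids, and acts on `X`. -/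
def twist {H X Y : C} (a : X ⊗ H ⟶ X) (d : Y ⟶ Y ⊗ H) : X ⊗ Y ⟶ Y ⊗ X :=
  X ◁ d ≫ (α_ X Y H).inv ≫ (β_ X Y).hom ▷ H ≫ (α_ Y X H).hom ≫ Y ◁ a

/-- Linearity is needed only of the map in the acting variable and colinearity only of the map in
the coacting one. Structure maps such as `μ`, `Δ`, units and counits, which have just one of these
properties for the regular structures, can therefore be moved through a twist. -/
theorem twist_nat {H X Y X' Y' : C} {a : X ⊗ H ⟶ X} {d : Y ⟶ Y ⊗ H} {a' : X' ⊗ H ⟶ X'}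
    {d' : Y' ⟶ Y' ⊗ H} {f : X ⟶ X'} {g : Y ⟶ Y'}
    (hf : a ≫ f = f ▷ H ≫ a') (hg : g ≫ d' = d ≫ g ▷ H) :
    (f ⊗ₘ g) ≫ twist a' d' = twist a d ≫ (g ⊗ₘ f) := by
  calc
    _ = 𝟙 _ ⊗≫ f ▷ Y ⊗≫ X' ◁ (g ≫ d') ⊗≫ (β_ X' Y').hom ▷ H ⊗≫ Y' ◁ a' := by
      rw [twist, MonoidalCategory.tensorHom_def]; monoidal
    _ = 𝟙 _ ⊗≫ (f ▷ Y ≫ X' ◁ d) ⊗≫ (X' ◁ g ≫ (β_ X' Y').hom) ▷ H ⊗≫ Y' ◁ a' := by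
      rw [hg]; monoidal
    _ = 𝟙 _ ⊗≫ X ◁ d ⊗≫ (f ▷ Y ≫ (β_ X' Y).hom) ▷ H ⊗≫ (g ▷ (X' ⊗ H) ≫ Y' ◁ a') := by
      rw [← whisker_exchange, BraidedCategory.braiding_naturality_right]; monoidal
    _ = 𝟙 _ ⊗≫ X ◁ d ⊗≫ (β_ X Y).hom ▷ H ⊗≫ Y ◁ (f ▷ H ≫ a') ⊗≫ g ▷ X' := by
      rw [← whisker_exchange, BraidedCategory.braiding_naturality_left]; monoidal
    _ = _ := by
      rw [← hf, twist, MonoidalCategory.tensorHom_def']; monoidal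

theorem twist_nat_left {H X Y X' : C} {a : X ⊗ H ⟶ X} {d : Y ⟶ Y ⊗ H} {a' : X' ⊗ H ⟶ X'}
    {f : X ⟶ X'} (hf : a ≫ f = f ▷ H ≫ a') :
    f ▷ Y ≫ twist a' d = twist a d ≫ Y ◁ f := by
  simpa using twist_nat (d := d) (g := 𝟙 Y) hf (by simp)

theorem twist_nat_right {H X Y Y' : C} {a : X ⊗ H ⟶ X} {d : Y ⟶ Y ⊗ H} {d' : Y' ⟶ Y' ⊗ H}
    {g : Y ⟶ Y'} (hg : g ≫ d' = d ≫ g ▷ H) :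
    X ◁ g ≫ twist a d' = twist a d ≫ g ▷ X := by
  simpa using twist_nat (a := a) (f := 𝟙 X) (by simp) hg

variable {H : C} [HopfObj H]

theorem tensorAct_eq_twist {X Y : C} (a : X ⊗ H ⟶ X) (b : Y ⊗ H ⟶ Y) :
    tensorAct a b = (α_ X Y H).hom ≫ X ◁ twist b Δ[H] ≫ (α_ X H Y).inv ≫ a ▷ Y := by
  rw [tensorAct, tensorμ, twist, MonoidalCategory.tensorHom_def']
  monoidal

theorem tensorCoact_eq_twist {X Y : C} (c : X ⟶ X ⊗ H) (d : Y ⟶ Y ⊗ H) :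
    tensorCoact c d = c ▷ Y ≫ (α_ X H Y).hom ≫ X ◁ twist μ[H] d ≫ (α_ X Y H).inv := by
  rw [tensorCoact, tensorμ, twist, MonoidalCategory.tensorHom_def]
  monoidal

theorem IsAct.sA {X : C} {a : X ⊗ H ⟶ X} (h : IsAct η[H] μ[H] a) (Z : C) :
    sA Z a ▷ H ≫ sA Z a = sA (Z ⊗ X) μ[H] ≫ sA Z a := by
  simp only [Braided.sA]
  calc
    _ = 𝟙 _ ⊗≫ Z ◁ (a ▷ H ≫ a) ⊗≫ 𝟙 _ := by monoidal
    _ = _ := by rw [h.mul']; monoidal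

theorem IsCoact.sC {X : C} {c : X ⟶ X ⊗ H} (h : IsCoact ε[H] Δ[H] c) (Z : C) :
    sC Z c ≫ sC Z c ▷ H = sC Z c ≫ sC (Z ⊗ X) Δ[H] := by
  simp only [Braided.sC]
  calc
    _ = 𝟙 _ ⊗≫ Z ◁ (c ≫ c ▷ H) ⊗≫ 𝟙 _ := by monoidal
    _ = _ := by rw [h.comul']; monoidal

/-- A version of `yB_hexagon` that asks only for an action on `X`, so that it applies to `H` acting
on itself by `μ`. The spectator strand `Z` keeps all tensor products bracketed to the left, where
the sliding rules work as rewrite rules. -/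
theorem yB_tensorCoact {X Y W : C} {a : X ⊗ H ⟶ X} (h : IsAct η[H] μ[H] a) (d : Y ⟶ Y ⊗ H)
    (e : W ⟶ W ⊗ H) (Z : C) :
    tC (Z ⊗ X) d e ≫ sB Z X Y ▷ W ▷ H ≫ sB (Z ⊗ Y) X W ▷ H ≫ sA ((Z ⊗ Y) ⊗ W) a =
      yB Z a d ▷ W ≫ yB (Z ⊗ Y) a e := by
  simp only [tC, Category.assoc, reassoc_of% @sA_nat', yB, comp_whiskerRight, reassoc_of% @sC_nat,
    reassoc_of% @sA_sB_w1, h.sA, reassoc_of% @sB_nat_w1]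

theorem yB_tensorAct {X Y W : C} (a : X ⊗ H ⟶ X) (b : Y ⊗ H ⟶ Y) {e : W ⟶ W ⊗ H}
    (h : IsCoact ε[H] Δ[H] e) (Z : C) :
    sC ((Z ⊗ X) ⊗ Y) e ≫ sB (Z ⊗ X) Y W ▷ H ≫ sB Z X W ▷ Y ▷ H ≫ tA (Z ⊗ W) a b =
      yB (Z ⊗ X) b e ≫ yB Z a e ▷ Y := by
  simp only [tA, reassoc_of% @sC_nat, reassoc_of% @sB_nat_w1, yB, comp_whiskerRight,
    Category.assoc, reassoc_of% @sA_nat', sA_nat', reassoc_of% @sB_sCp_w1, reassoc_of% h.sC]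

-- The coaction on `Y ⊗ W` multiplies the two legs in `H`, and acting by a product is acting
-- successively.
open BraidedCategory in
theorem twist_tensorCoact {X Y W : C} {a : X ⊗ H ⟶ X} (h : IsAct η[H] μ[H] a) (d : Y ⟶ Y ⊗ H)
    (e : W ⟶ W ⊗ H) :
    twist a (tensorCoact d e) =
      (α_ X Y W).inv ≫ twist a d ▷ W ≫ (α_ Y X W).hom ≫ Y ◁ twist a e ≫ (α_ Y W X).inv := by
  have q := yB_tensorCoact h d e (𝟙_ C)
  calc
    _ = 𝟙 _ ⊗≫ (tC (𝟙_ C ⊗ X) d e ≫ sB (𝟙_ C) X Y ▷ W ▷ H ≫ sB (𝟙_ C ⊗ Y) X W ▷ H ≫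
        sA ((𝟙_ C ⊗ Y) ⊗ W) a) ⊗≫ 𝟙 _ := by
      simp only [twist, tensorCoact, tC, sA, sB, sC, sX, tensorμ, braiding_tensor_right_hom,
        MonoidalCategory.tensorHom_def']
      monoidal
    _ = _ := by
      rw [q]
      simp only [yB, twist, sA, sB, sC, sX]
      monoidal

-- Dual to the previous splitting: coassociativity on `W` supplies the two legs used by the diagonal
-- action.
open BraidedCategory in
theorem twist_tensorAct {X Y W : C} (a : X ⊗ H ⟶ X) (b : Y ⊗ H ⟶ Y) {e : W ⟶ W ⊗ H}
    (h : IsCoact ε[H] Δ[H] e) :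
    twist (tensorAct a b) e =
      (α_ X Y W).hom ≫ X ◁ twist b e ≫ (α_ X W Y).inv ≫ twist a e ▷ Y ≫ (α_ W X Y).hom := by
  have q := yB_tensorAct a b h (𝟙_ C)
  calc
    _ = 𝟙 _ ⊗≫ (sC ((𝟙_ C ⊗ X) ⊗ Y) e ≫ sB (𝟙_ C ⊗ X) Y W ▷ H ≫ sB (𝟙_ C) X W ▷ Y ▷ H ≫
        tA (𝟙_ C ⊗ W) a b) ⊗≫ 𝟙 _ := by
      simp only [twist, tensorAct, tA, sA, sB, sC, sX, tensorμ, braiding_tensor_left_hom,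
        MonoidalCategory.tensorHom_def]
      monoidal
    _ = _ := by
      rw [q]
      simp only [yB, twist, sA, sB, sC, sX]
      monoidal

/-! Crossed modules in terms of `twist`. -/

theorem IsCrossedModule.isAct {X : C} {a : X ⊗ H ⟶ X} {c : X ⟶ X ⊗ H}
    (h : IsCrossedModule H a c) : IsAct η[H] μ[H] a := ⟨h.act_one, h.act_mul⟩

theorem IsCrossedModule.isCoact {X : C} {a : X ⊗ H ⟶ X} {c : X ⟶ X ⊗ H}
    (h : IsCrossedModule H a c) : IsCoact ε[H] Δ[H] c := ⟨h.coact_counit, h.coact_comul⟩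

variable (H) in
theorem isAct_mul : IsAct η[H] μ[H] μ[H] := ⟨MonObj.mul_one H, by simp⟩

variable (H) in
theorem isCoact_comul : IsCoact ε[H] Δ[H] Δ[H] := ⟨ComonObj.comul_counit H, by simp⟩

theorem isCrossedModule_iff {X : C} {a : X ⊗ H ⟶ X} {c : X ⟶ X ⊗ H} :
    IsCrossedModule H a c ↔ IsAct η[H] μ[H] a ∧ IsCoact ε[H] Δ[H] c ∧
      twist a Δ[H] ≫ twist μ[H] c = c ▷ H ≫ tensorAct a μ[H] := by
  have e1 : X ◁ Δ[H] ≫ (α_ X H H).inv ≫ (β_ X H).hom ▷ H ≫ (α_ H X H).hom ≫ H ◁ a ≫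
      H ◁ c ≫ (α_ H X H).inv ≫ (β_ H X).hom ▷ H ≫ (α_ X H H).hom ≫ X ◁ μ[H] =
      twist a Δ[H] ≫ twist μ[H] c := by simp [twist]
  have e2 : (c ⊗ₘ Δ[H]) ≫ tensorμ X H H H ≫ (a ⊗ₘ μ[H]) = c ▷ H ≫ tensorAct a μ[H] := by
    rw [tensorAct, MonoidalCategory.tensorHom_def, Category.assoc]
  constructor
  · intro h
    exact ⟨h.isAct, h.isCoact, by rw [← e1, ← e2, h.compat]⟩
  · rintro ⟨h1, h2, h3⟩
    exact ⟨h1.1, h1.2, h2.1, h2.2, by rw [e1, e2, h3]⟩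

/-- The crossed module axiom of `Y` exchanges acting on `Y` with coacting on it; on `X` only
associativity of the action enters. -/
theorem twist_act {X Y : C} {a : X ⊗ H ⟶ X} {b : Y ⊗ H ⟶ Y} {d : Y ⟶ Y ⊗ H}
    (h : IsAct η[H] μ[H] a) (k : IsCrossedModule H b d) :
    tensorAct a b ≫ twist a d = twist a d ▷ H ≫ tensorAct b a := by
  have e (Z : C) : tA Z a b ≫ yB Z a d = yB Z a d ▷ H ≫ tA Z b a := by
    calc
      _ = (sC ((Z ⊗ X) ⊗ Y) Δ[H] ≫ sB (Z ⊗ X) Y H ▷ H ≫ sA ((Z ⊗ X) ⊗ H) b ≫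
          sC ((Z ⊗ X) ⊗ H) d ≫ sB (Z ⊗ X) H Y ▷ H ≫ sA ((Z ⊗ X) ⊗ Y) μ[H]) ≫ sB Z X Y ▷ H ≫
          sA (Z ⊗ Y) a := by
        simp only [tA, yB, Category.assoc]
        rw [reassoc_of% @sA_nat, reassoc_of% @sC_nat]
        simp only [reassoc_of% @sA_sB_w1, h.sA, reassoc_of% @sA_nat']
      _ = _ := by
        rw [k.s_compat]
        simp only [Category.assoc, reassoc_of% @sA_nat', reassoc_of% @sA_sBp_w2, yB,
          comp_whiskerRight, tA, reassoc_of% @sC_nat, reassoc_of% @sA_sB_w1,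
          reassoc_of% @sA_natp_w1, h.sA, reassoc_of% @sB_nat_w1]
  have e := e (𝟙_ C)
  change tensorAct a b ≫ yBr X a d = yBr X a d ▷ H ≫ tensorAct b a
  simp only [← sX_yBr, tA_eq] at e
  apply whiskerLeft_inj
  simp only [sA, sX, Category.assoc, comp_whiskerRight, Iso.inv_hom_id_assoc,
    inv_hom_whiskerRight_assoc, cancel_epi, whisker_assoc] at e
  simpa only [← Category.assoc, cancel_mono, whiskerLeft_comp] using e

/-- The Yang-Baxter equation for a module, a crossed module and a comodule. -/
theorem twist_yang_baxter {X Y W : C} {a : X ⊗ H ⟶ X} {b : Y ⊗ H ⟶ Y} {d : Y ⟶ Y ⊗ H}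
    {e : W ⟶ W ⊗ H} (h : IsAct η[H] μ[H] a) (k : IsCrossedModule H b d)
    (l : IsCoact ε[H] Δ[H] e) :
    twist a d ▷ W ≫ (α_ Y X W).hom ≫ Y ◁ twist a e ≫ (α_ Y W X).inv ≫ twist b e ▷ X =
      (α_ X Y W).hom ≫ X ◁ twist b e ≫ (α_ X W Y).inv ≫ twist a e ▷ Y ≫ (α_ W X Y).hom ≫
        W ◁ twist a d ≫ (α_ W Y X).inv := by
  -- `twist a d` is linear for the diagonal actions, so it slides through the twist with `W`.
  -- Splitting both twists of tensor products leaves the Yang-Baxter equation.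
  have := twist_nat_left (d := e) (twist_act h k)
  rw [twist_tensorAct _ _ l, twist_tensorAct _ _ l] at this
  simp only [Category.assoc] at this
  rw [← cancel_mono (α_ W Y X).hom]
  simp only [Category.assoc, this, Iso.inv_hom_id, Category.comp_id]

end Twist

/-! ### Composite actions and coactions of two factors -/

section Double

variable {C : Type u} [Category.{v} C] [MonoidalCategory C] 

/-- Act by `A`, then by `B`. -/
def dAct {A B X : C} (a : X ⊗ A ⟶ X) (a' : X ⊗ B ⟶ X) : X ⊗ (A ⊗ B) ⟶ X :=
  (α_ X A B).inv ≫ a ▷ B ≫ a'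

/-- Coact by `B`, then by `A`. -/
def dCoact {A B X : C} (c : X ⟶ X ⊗ A) (c' : X ⟶ X ⊗ B) : X ⟶ X ⊗ (A ⊗ B) :=
  c' ≫ c ▷ B ≫ (α_ X A B).hom

variable [BraidedCategory C] 

/-- `twist` for the actions and coactions of `B`, with `twist` for those of `A` as the braiding. -/
def dTwist {A B X Y : C} (a : X ⊗ A ⟶ X) (a' : X ⊗ B ⟶ X) (c : Y ⟶ Y ⊗ A) (c' : Y ⟶ Y ⊗ B) :
    X ⊗ Y ⟶ Y ⊗ X :=
  X ◁ c' ≫ (α_ X Y B).inv ≫ twist a c ▷ B ≫ (α_ Y X B).hom ≫ Y ◁ a'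

/-- Both sides are one string diagram, so coherence is enough and no axiom is used. This is already
the compatibility of the functor with the braidings. -/
theorem twist_dAct_dCoact {A B X Y : C} (a : X ⊗ A ⟶ X) (a' : X ⊗ B ⟶ X) (c : Y ⟶ Y ⊗ A)
    (c' : Y ⟶ Y ⊗ B) : twist (dAct a a') (dCoact c c') = dTwist a a' c c' := by
  simp only [twist, dTwist, dAct, dCoact]
  monoidal

variable {A B : C} [HopfObj A]

/-- The multiplication of the cross product for an action `b` of `A` on `B` and a multiplication `m`
of `B`. -/
def cMul (b : B ⊗ A ⟶ B) (m : B ⊗ B ⟶ B) : (A ⊗ B) ⊗ (A ⊗ B) ⟶ A ⊗ B :=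
  dAct (tensorAct μ[A] b) ((α_ A B B).hom ≫ A ◁ m)

/-- The comultiplication of the cross product for a coaction `k` of `A` on `B` and a comultiplication
`d` of `B`. -/
def cComul (k : B ⟶ B ⊗ A) (d : B ⟶ B ⊗ B) : A ⊗ B ⟶ (A ⊗ B) ⊗ (A ⊗ B) :=
  dCoact (tensorCoact Δ[A] k) (A ◁ d ≫ (α_ A B B).inv)

variable {b : B ⊗ A ⟶ B} {m : B ⊗ B ⟶ B} {k : B ⟶ B ⊗ A} {d : B ⟶ B ⊗ B}
variable {X : C} {a : X ⊗ A ⟶ X} {a' : X ⊗ B ⟶ X} {c : X ⟶ X ⊗ A} {c' : X ⟶ X ⊗ B}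

/-- `cComul` is a composite coaction whose `A`-part is a tensor coaction, so the inner twist over
`A` splits by `twist_tensorCoact`. What then involves `B` reassembles to `dTwist`. -/
theorem twist_cComul (ha : IsAct η[A] μ[A] a) (a' : X ⊗ B ⟶ X) (k : B ⟶ B ⊗ A)
    (d : B ⟶ B ⊗ B) :
    twist (dAct a a') (cComul k d) = (α_ X A B).inv ≫ twist a Δ[A] ▷ B ≫ (α_ A X B).hom ≫
      A ◁ dTwist a a' k d ≫ (α_ A B X).inv := by
  rw [cComul, twist_dAct_dCoact, dTwist, twist_tensorCoact ha, dTwist]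
  calc
    _ = 𝟙 _ ⊗≫ ((X ⊗ A) ◁ d ≫ twist a Δ[A] ▷ (B ⊗ B)) ⊗≫ A ◁ twist a k ▷ B ⊗≫
        A ◁ B ◁ a' ⊗≫ 𝟙 _ := by monoidal
    _ = _ := by rw [whisker_exchange]; monoidal

theorem twist_cMul (hc : IsCoact ε[A] Δ[A] c) (c' : X ⟶ X ⊗ B) (b : B ⊗ A ⟶ B)
    (m : B ⊗ B ⟶ B) :
    twist (cMul b m) (dCoact c c') = (α_ A B X).hom ≫ A ◁ dTwist b m c c' ≫ (α_ A X B).inv ≫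
      twist μ[A] c ▷ B ≫ (α_ X A B).hom := by
  rw [cMul, twist_dAct_dCoact, dTwist, twist_tensorAct _ _ hc, dTwist]
  calc
    _ = 𝟙 _ ⊗≫ A ◁ B ◁ c' ⊗≫ A ◁ twist b c ▷ B ⊗≫ (twist μ[A] c ▷ (B ⊗ B) ≫
        (X ⊗ A) ◁ m) ⊗≫ 𝟙 _ := by monoidal
    _ = _ := by rw [← whisker_exchange]; monoidal

/-- By the bialgebra axiom, `μ` is colinear from `A ⊗ A` with its tensor coaction to `A`. It
therefore slides through `twist b Δ`, which splits into two twists, one for each factor. No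
coactions on `X` and `B` are required, so `X` may be `A` acting on itself. -/
theorem isAct_tensorAct_mul {a : X ⊗ A ⟶ X} (ha : IsAct η[A] μ[A] a)
    {b : B ⊗ A ⟶ B} (hb : IsAct η[A] μ[A] b) : IsAct η[A] μ[A] (tensorAct a b) := by
  constructor
  · have := congrArg (fun t => (X ⊗ B) ◁ t) (Bimon.one_comul A)
    simp only [whiskerLeft_comp] at this
    rw [tensorAct, reassoc_of% this, tensorμ_natural_right_assoc, tensorHom_comp_tensorHom,
      ha.one, hb.one, ← tensor_right_unitality]
  · have := twist_nat_right (a := b) (d := tensorCoact Δ[A] Δ[A]) (d' := Δ[A]) (g := μ[A]) (by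
      rw [tensorCoact, BimonObj.mul_comul, MonoidalCategory.tensorHom_def' μ[A] μ[A]]
      simp)
    rw [twist_tensorCoact hb] at this
    simp only [tensorAct_eq_twist]
    calc
      _ = 𝟙 _ ⊗≫ X ◁ (B ◁ μ[A] ≫ twist b Δ[A]) ⊗≫ a ▷ B ⊗≫ 𝟙 _ := by monoidal
      _ = 𝟙 _ ⊗≫ X ◁ twist b Δ[A] ▷ A ⊗≫ X ◁ A ◁ twist b Δ[A] ⊗≫ (X ◁ μ[A] ≫ a) ▷ B ⊗≫ 𝟙 _ := by
        rw [this]; monoidal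
      _ = 𝟙 _ ⊗≫ X ◁ twist b Δ[A] ▷ A ⊗≫ ((X ⊗ A) ◁ twist b Δ[A] ≫ a ▷ (A ⊗ B)) ⊗≫
          a ▷ B ⊗≫ 𝟙 _ := by
        rw [ha.mul]; monoidal
      _ = _ := by rw [whisker_exchange]; monoidal

theorem isCoact_tensorCoact_comul {c : X ⟶ X ⊗ A} (hc : IsCoact ε[A] Δ[A] c)
    {k : B ⟶ B ⊗ A} (hk : IsCoact ε[A] Δ[A] k) : IsCoact ε[A] Δ[A] (tensorCoact c k) := by
  constructor
  · have := congrArg (fun t => (X ⊗ B) ◁ t) (Bimon.mul_counit A)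
    simp only [whiskerLeft_comp] at this
    have n2 := tensorμ_natural (𝟙 X) ε[A] (𝟙 B) ε[A]
    simp only [id_tensorHom, whiskerLeft_id] at n2
    simp only [tensorCoact, Category.assoc]
    rw [this, ← reassoc_of% n2, tensorHom_comp_tensorHom_assoc, hc.counit, hk.counit,
      ← cancel_mono (ρ_ (X ⊗ B)).hom]
    simp only [Category.assoc]
    rw [← rightUnitor_monoidal]
    simp
  · have := twist_nat_left (d := k) (a := μ[A]) (a' := tensorAct μ[A] μ[A]) (f := Δ[A]) (by
      rw [tensorAct, BimonObj.mul_comul, MonoidalCategory.tensorHom_def Δ[A] Δ[A]]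
      simp)
    rw [twist_tensorAct _ _ hk] at this
    simp only [tensorCoact_eq_twist]
    calc
      _ = 𝟙 _ ⊗≫ c ▷ B ⊗≫ X ◁ (twist μ[A] k ≫ B ◁ Δ[A]) ⊗≫ 𝟙 _ := by monoidal
      _ = 𝟙 _ ⊗≫ (c ≫ X ◁ Δ[A]) ▷ B ⊗≫ X ◁ A ◁ twist μ[A] k ⊗≫ X ◁ twist μ[A] k ▷ A ⊗≫ 𝟙 _ := by
        rw [← this]; monoidal
      _ = 𝟙 _ ⊗≫ c ▷ B ⊗≫ (c ▷ (A ⊗ B) ≫ (X ⊗ A) ◁ twist μ[A] k) ⊗≫ X ◁ twist μ[A] k ▷ A ⊗≫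
          𝟙 _ := by
        rw [hc.comul]; monoidal
      _ = _ := by rw [← whisker_exchange]; monoidal

/-- The twist of the cross product with itself. -/
theorem twist_cMul_cComul (hb : IsAct η[A] μ[A] b) (hk : IsCoact ε[A] Δ[A] k) (m : B ⊗ B ⟶ B)
    (d : B ⟶ B ⊗ B) :
    twist (cMul b m) (cComul k d) = 𝟙 _ ⊗≫ A ◁ twist b Δ[A] ▷ B ⊗≫ twist μ[A] Δ[A] ▷ B ▷ B ⊗≫
      A ◁ A ◁ dTwist b m k d ⊗≫ A ◁ twist μ[A] k ▷ B ⊗≫ 𝟙 _ := by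
  have h1 := twist_cComul (isAct_tensorAct_mul (isAct_mul A) hb) ((α_ A B B).hom ≫ A ◁ m) k d
  have h2 := twist_cMul hk d b m
  rw [cMul, twist_dAct_dCoact] at h2
  rw [cMul, h1, h2, twist_tensorAct _ _ (isCoact_comul A)]
  monoidal

/-- A cross product acts if the action of `B` is a morphism of `A`-modules. -/
theorem IsAct.dAct {e : 𝟙_ C ⟶ B} (ha : IsAct η[A] μ[A] a) (ha' : IsAct e m a')
    (lin : tensorAct a b ≫ a' = a' ▷ A ≫ a) :
    IsAct ((λ_ (𝟙_ C)).inv ≫ (η[A] ⊗ₘ e)) (cMul b m) (dAct a a') := by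
  constructor
  · calc
      _ = 𝟙 _ ⊗≫ (X ◁ η[A] ≫ a) ⊗≫ X ◁ e ≫ a' := by
        rw [MonoidalCategory.tensorHom_def, Braided.dAct]
        calc
          _ = 𝟙 _ ⊗≫ X ◁ η[A] ⊗≫ ((X ⊗ A) ◁ e ≫ a ▷ B) ≫ a' := by monoidal
          _ = _ := by rw [whisker_exchange]; monoidal
      _ = _ := by rw [ha.one, ha'.one]; monoidal
  · simp only [tensorAct_eq_twist, Category.assoc] at lin
    simp only [Braided.dAct, cMul, tensorAct_eq_twist]
    calc
      _ = 𝟙 _ ⊗≫ X ◁ A ◁ twist b Δ[A] ▷ B ⊗≫ X ◁ μ[A] ▷ (B ⊗ B) ⊗≫ ((X ⊗ A) ◁ m ≫ a ▷ B) ⊗≫ a' := by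
        monoidal
      _ = 𝟙 _ ⊗≫ X ◁ A ◁ twist b Δ[A] ▷ B ⊗≫ (X ◁ μ[A] ≫ a) ▷ (B ⊗ B) ⊗≫ X ◁ m ≫ a' := by
        rw [whisker_exchange]; monoidal
      _ = 𝟙 _ ⊗≫ ((X ⊗ A) ◁ twist b Δ[A] ≫ a ▷ (A ⊗ B)) ▷ B ⊗≫ a ▷ B ▷ B ⊗≫ a' ▷ B ≫ a' := by
        rw [ha.mul, ha'.mul]; monoidal
      _ = 𝟙 _ ⊗≫ a ▷ B ▷ A ▷ B ⊗≫ ((α_ X B A).hom ≫ X ◁ twist b Δ[A] ≫ (α_ X A B).inv ≫ a ▷ B ≫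
          a') ▷ B ⊗≫ a' := by
        rw [whisker_exchange]; monoidal
      _ = _ := by rw [lin]; monoidal

/-- A cross product coacts if the coaction of `B` is a morphism of `A`-comodules. -/
theorem IsCoact.dCoact {e : B ⟶ 𝟙_ C} (hc : IsCoact ε[A] Δ[A] c) (hc' : IsCoact e d c')
    (lin : c' ≫ tensorCoact c k = c ≫ c' ▷ A) :
    IsCoact ((ε[A] ⊗ₘ e) ≫ (λ_ (𝟙_ C)).hom) (cComul k d) (dCoact c c') := by
  constructor
  · calc
      _ = (c' ≫ X ◁ e) ⊗≫ (c ≫ X ◁ ε[A]) ⊗≫ 𝟙 _ := by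
        rw [MonoidalCategory.tensorHom_def', Braided.dCoact]
        calc
          _ = 𝟙 _ ⊗≫ c' ≫ (c ▷ B ≫ (X ⊗ A) ◁ e) ⊗≫ X ◁ ε[A] ⊗≫ 𝟙 _ := by monoidal
          _ = _ := by rw [← whisker_exchange]; monoidal
      _ = _ := by rw [hc.counit, hc'.counit]; monoidal
  · rw [tensorCoact_eq_twist] at lin
    simp only [Braided.dCoact, cComul, tensorCoact_eq_twist]
    calc
      _ = c' ⊗≫ (c ▷ B ≫ (X ⊗ A) ◁ d) ⊗≫ X ◁ Δ[A] ▷ (B ⊗ B) ⊗≫ X ◁ A ◁ twist μ[A] k ▷ B ⊗≫ 𝟙 _ := by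
        monoidal
      _ = (c' ≫ X ◁ d) ⊗≫ (c ≫ X ◁ Δ[A]) ▷ (B ⊗ B) ⊗≫ X ◁ A ◁ twist μ[A] k ▷ B ⊗≫ 𝟙 _ := by
        rw [← whisker_exchange]; monoidal
      _ = c' ≫ c' ▷ B ⊗≫ c ▷ B ▷ B ⊗≫ (c ▷ (A ⊗ B) ≫ (X ⊗ A) ◁ twist μ[A] k) ▷ B ⊗≫ 𝟙 _ := by
        rw [hc.comul, hc'.comul]; monoidal
      _ = c' ⊗≫ (c' ≫ c ▷ B ≫ (α_ X A B).hom ≫ X ◁ twist μ[A] k ≫ (α_ X B A).inv) ▷ B ⊗≫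
          c ▷ B ▷ A ▷ B ⊗≫ 𝟙 _ := by
        rw [← whisker_exchange]; monoidal
      _ = _ := by rw [lin]; monoidal

/-- The crossed module axiom for a cross product follows from those for its factors. -/
theorem compat_dAct_dCoact (ha : IsAct η[A] μ[A] a) (hc : IsCoact ε[A] Δ[A] c)
    (hb : IsAct η[A] μ[A] b) (hk : IsCoact ε[A] Δ[A] k)
    (h1 : twist a Δ[A] ≫ twist μ[A] c =
      c ▷ A ≫ (α_ X A A).hom ≫ X ◁ twist μ[A] Δ[A] ≫ (α_ X A A).inv ≫ a ▷ A)
    (h2 : a ≫ c' = c' ▷ A ≫ tensorAct a b)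
    (h3 : a' ≫ c = tensorCoact c k ≫ a' ▷ A)
    (h4 : dTwist a a' k d ≫ dTwist b m c c' =
      c' ▷ B ≫ (α_ X B B).hom ≫ X ◁ dTwist b m k d ≫ (α_ X B B).inv ≫ a' ▷ B) :
    twist (dAct a a') (cComul k d) ≫ twist (cMul b m) (dCoact c c') =
      dCoact c c' ▷ (A ⊗ B) ≫ (α_ X _ _).hom ≫ X ◁ twist (cMul b m) (cComul k d) ≫
        (α_ X _ _).inv ≫ dAct a a' ▷ (A ⊗ B) := by
  -- The hypothesis `h2` is linearity of `c'` over `A`, and `h3` is colinearity of `a'`. After `h4`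
  -- is used in the middle of the diagram, these naturality squares carry `c'` to the front and `a'`
  -- to the end. This exposes `twist a Δ ≫ twist μ c`, to which `h1` applies; the rest is
  -- interchange.
  have n2 := twist_nat_left (d := Δ[A]) h2
  have n3 := twist_nat_right (a := μ[A]) h3
  rw [twist_tensorAct _ _ (isCoact_comul A)] at n2
  rw [twist_tensorCoact (isAct_mul A)] at n3
  rw [twist_cComul ha, twist_cMul hc, twist_cMul_cComul hb hk]
  calc
    _ = 𝟙 _ ⊗≫ twist a Δ[A] ▷ B ⊗≫ A ◁ (dTwist a a' k d ≫ dTwist b m c c') ⊗≫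
        twist μ[A] c ▷ B ⊗≫ 𝟙 _ := by monoidal
    _ = 𝟙 _ ⊗≫ (twist a Δ[A] ≫ A ◁ c') ▷ B ⊗≫ A ◁ X ◁ dTwist b m k d ⊗≫
        (A ◁ a' ≫ twist μ[A] c) ▷ B ⊗≫ 𝟙 _ := by rw [h4]; monoidal
    _ = 𝟙 _ ⊗≫ c' ▷ A ▷ B ⊗≫ X ◁ twist b Δ[A] ▷ B ⊗≫ (twist a Δ[A] ▷ (B ⊗ B) ≫
        (A ⊗ X) ◁ dTwist b m k d) ⊗≫ twist μ[A] c ▷ B ▷ B ⊗≫ X ◁ twist μ[A] k ▷ B ⊗≫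
        a' ▷ A ▷ B ⊗≫ 𝟙 _ := by
      rw [← n2, n3]; monoidal
    _ = 𝟙 _ ⊗≫ c' ▷ A ▷ B ⊗≫ X ◁ twist b Δ[A] ▷ B ⊗≫ (X ⊗ A) ◁ dTwist b m k d ⊗≫
        (twist a Δ[A] ≫ twist μ[A] c) ▷ B ▷ B ⊗≫ X ◁ twist μ[A] k ▷ B ⊗≫
        a' ▷ A ▷ B ⊗≫ 𝟙 _ := by
      rw [← whisker_exchange]; monoidal
    _ = 𝟙 _ ⊗≫ c' ▷ A ▷ B ⊗≫ X ◁ twist b Δ[A] ▷ B ⊗≫ ((X ⊗ A) ◁ dTwist b m k d ≫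
        c ▷ A ▷ (B ⊗ B)) ⊗≫ X ◁ twist μ[A] Δ[A] ▷ B ▷ B ⊗≫ (a ▷ (A ⊗ B) ≫ X ◁ twist μ[A] k) ▷ B ⊗≫
        a' ▷ A ▷ B ⊗≫ 𝟙 _ := by
      rw [h1]; monoidal
    _ = 𝟙 _ ⊗≫ c' ▷ A ▷ B ⊗≫ (X ◁ twist b Δ[A] ≫ c ▷ (A ⊗ B)) ▷ B ⊗≫ (X ⊗ A ⊗ A) ◁ dTwist b m k d ⊗≫
        X ◁ twist μ[A] Δ[A] ▷ (B ⊗ B) ⊗≫ (X ⊗ A) ◁ twist μ[A] k ▷ B ⊗≫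
        a ▷ B ▷ A ▷ B ⊗≫ a' ▷ A ▷ B ⊗≫ 𝟙 _ := by
      rw [← whisker_exchange, whisker_exchange (c ▷ A)]; monoidal
    _ = 𝟙 _ ⊗≫ c' ▷ A ▷ B ⊗≫ c ▷ B ▷ A ▷ B ⊗≫ (X ⊗ A) ◁ twist b Δ[A] ▷ B ⊗≫
        X ◁ ((A ⊗ A) ◁ dTwist b m k d ≫ twist μ[A] Δ[A] ▷ (B ⊗ B)) ⊗≫ (X ⊗ A) ◁ twist μ[A] k ▷ B ⊗≫
        a ▷ B ▷ A ▷ B ⊗≫ a' ▷ A ▷ B ⊗≫ 𝟙 _ := by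
      rw [whisker_exchange]; monoidal
    _ = _ := by rw [whisker_exchange, dCoact, dAct]; monoidal

/-- The Hopf module axiom for a cross product follows from those for its factors. -/
theorem hopf_dAct_dCoact (hb : IsAct η[A] μ[A] b) (hk : IsCoact ε[A] Δ[A] k)
    (h1 : a ≫ c = c ▷ A ≫ (α_ X A A).hom ≫ X ◁ twist μ[A] Δ[A] ≫ (α_ X A A).inv ≫ a ▷ A)
    (h2 : a ≫ c' = c' ▷ A ≫ tensorAct a b)
    (h3 : a' ≫ c = tensorCoact c k ≫ a' ▷ A)
    (h4 : a' ≫ c' = c' ▷ B ≫ (α_ X B B).hom ≫ X ◁ dTwist b m k d ≫ (α_ X B B).inv ≫ a' ▷ B) :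
    dAct a a' ≫ dCoact c c' =
      dCoact c c' ▷ (A ⊗ B) ≫ (α_ X _ _).hom ≫ X ◁ twist (cMul b m) (cComul k d) ≫
        (α_ X _ _).inv ≫ dAct a a' ▷ (A ⊗ B) := by
  rw [tensorAct_eq_twist] at h2
  rw [tensorCoact_eq_twist] at h3
  rw [twist_cMul_cComul hb hk, dAct, dCoact]
  -- The same diagram chase as for the crossed module axiom, with plain actions and coactions on the
  -- left. Linearity of `c'` and colinearity of `a'` are used directly, and bring `a` next to `c` so
  -- that `h1` applies.
  calc
    _ = 𝟙 _ ⊗≫ a ▷ B ≫ (a' ≫ c') ⊗≫ c ▷ B ⊗≫ 𝟙 _ := by monoidal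
    _ = 𝟙 _ ⊗≫ (a ≫ c') ▷ B ⊗≫ X ◁ dTwist b m k d ⊗≫ (a' ≫ c) ▷ B ⊗≫ 𝟙 _ := by rw [h4]; monoidal
    _ = 𝟙 _ ⊗≫ c' ▷ A ▷ B ⊗≫ X ◁ twist b Δ[A] ▷ B ⊗≫ (a ▷ (B ⊗ B) ≫
        X ◁ dTwist b m k d) ⊗≫ c ▷ B ▷ B ⊗≫ X ◁ twist μ[A] k ▷ B ⊗≫
        a' ▷ A ▷ B ⊗≫ 𝟙 _ := by
      rw [h2, h3]; monoidal
    _ = 𝟙 _ ⊗≫ c' ▷ A ▷ B ⊗≫ X ◁ twist b Δ[A] ▷ B ⊗≫ (X ⊗ A) ◁ dTwist b m k d ⊗≫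
        (a ≫ c) ▷ B ▷ B ⊗≫ X ◁ twist μ[A] k ▷ B ⊗≫
        a' ▷ A ▷ B ⊗≫ 𝟙 _ := by
      rw [← whisker_exchange]; monoidal
    _ = 𝟙 _ ⊗≫ c' ▷ A ▷ B ⊗≫ X ◁ twist b Δ[A] ▷ B ⊗≫ ((X ⊗ A) ◁ dTwist b m k d ≫
        c ▷ A ▷ (B ⊗ B)) ⊗≫ X ◁ twist μ[A] Δ[A] ▷ B ▷ B ⊗≫ (a ▷ (A ⊗ B) ≫ X ◁ twist μ[A] k) ▷ B ⊗≫
        a' ▷ A ▷ B ⊗≫ 𝟙 _ := by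
      rw [h1]; monoidal
    _ = 𝟙 _ ⊗≫ c' ▷ A ▷ B ⊗≫ (X ◁ twist b Δ[A] ≫ c ▷ (A ⊗ B)) ▷ B ⊗≫ (X ⊗ A ⊗ A) ◁ dTwist b m k d ⊗≫
        X ◁ twist μ[A] Δ[A] ▷ (B ⊗ B) ⊗≫ (X ⊗ A) ◁ twist μ[A] k ▷ B ⊗≫
        a ▷ B ▷ A ▷ B ⊗≫ a' ▷ A ▷ B ⊗≫ 𝟙 _ := by
      rw [← whisker_exchange, whisker_exchange (c ▷ A)]; monoidal
    _ = 𝟙 _ ⊗≫ c' ▷ A ▷ B ⊗≫ c ▷ B ▷ A ▷ B ⊗≫ (X ⊗ A) ◁ twist b Δ[A] ▷ B ⊗≫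
        X ◁ ((A ⊗ A) ◁ dTwist b m k d ≫ twist μ[A] Δ[A] ▷ (B ⊗ B)) ⊗≫ (X ⊗ A) ◁ twist μ[A] k ▷ B ⊗≫
        a ▷ B ▷ A ▷ B ⊗≫ a' ▷ A ▷ B ⊗≫ 𝟙 _ := by
      rw [whisker_exchange]; monoidal
    _ = _ := by rw [whisker_exchange]; monoidal

end Double

/-! ### Units and counits passing through a twist -/

section Unit

variable {C : Type u} [Category.{v} C] [MonoidalCategory C] [BraidedCategory C] {A : C} [HopfObj A]
  {X Y : C} {a : X ⊗ A ⟶ X} {c : X ⟶ X ⊗ A}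

/-- The trivial coaction produces `η`, which acts as the identity, so only coherence isomorphisms
remain. Together with naturality this moves colinear units and counits through any twist. -/
theorem twist_unitCoact (ha : IsAct η[A] μ[A] a) :
    twist a (unitCoact A) = (ρ_ X).hom ≫ (λ_ X).inv := by
  calc
    _ = 𝟙 _ ⊗≫ (X ◁ η[A] ≫ a) ⊗≫ 𝟙 _ := by
      rw [twist, unitCoact, braiding_tensorUnit_right]; monoidal
    _ = _ := by rw [ha.one]; monoidal

theorem twist_unitAct (hc : IsCoact ε[A] Δ[A] c) :
    twist (unitAct A) c = (λ_ X).hom ≫ (ρ_ X).inv := by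
  calc
    _ = 𝟙 _ ⊗≫ (c ≫ X ◁ ε[A]) ⊗≫ 𝟙 _ := by
      rw [twist, unitAct, braiding_tensorUnit_left]; monoidal
    _ = _ := by rw [hc.counit]; monoidal

theorem whiskerLeft_unit_twist (ha : IsAct η[A] μ[A] a) {d : Y ⟶ Y ⊗ A} {e : 𝟙_ C ⟶ Y}
    (he : e ≫ d = unitCoact A ≫ e ▷ A) :
    X ◁ e ≫ twist a d = (ρ_ X).hom ≫ (λ_ X).inv ≫ e ▷ X := by
  rw [twist_nat_right he, twist_unitCoact ha, Category.assoc]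

theorem twist_counit_whiskerRight (ha : IsAct η[A] μ[A] a) {d : Y ⟶ Y ⊗ A} {f : Y ⟶ 𝟙_ C}
    (hf : f ≫ unitCoact A = d ≫ f ▷ A) :
    twist a d ≫ f ▷ X = X ◁ f ≫ (ρ_ X).hom ≫ (λ_ X).inv := by
  rw [← twist_nat_right hf, twist_unitCoact ha]

theorem whiskerRight_unit_twist (hc : IsCoact ε[A] Δ[A] c) {b : Y ⊗ A ⟶ Y} {e : 𝟙_ C ⟶ Y}
    (he : unitAct A ≫ e = e ▷ A ≫ b) :
    e ▷ X ≫ twist b c = (λ_ X).hom ≫ (ρ_ X).inv ≫ X ◁ e := by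
  rw [twist_nat_left he, twist_unitAct hc, Category.assoc]

theorem twist_counit_whiskerLeft (hc : IsCoact ε[A] Δ[A] c) {b : Y ⊗ A ⟶ Y} {f : Y ⟶ 𝟙_ C}
    (hf : b ≫ f = f ▷ A ≫ unitAct A) :
    twist b c ≫ X ◁ f = f ▷ X ≫ (λ_ X).hom ≫ (ρ_ X).inv := by
  rw [← twist_nat_left hf, twist_unitAct hc]

theorem whiskerLeft_one_twist (ha : IsAct η[A] μ[A] a) :
    X ◁ η[A] ≫ twist a Δ[A] = (ρ_ X).hom ≫ (λ_ X).inv ≫ η[A] ▷ X :=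
  whiskerLeft_unit_twist ha (by
    rw [unitCoact, Bimon.one_comul, MonoidalCategory.tensorHom_def']; monoidal)

theorem twist_counit (hc : IsCoact ε[A] Δ[A] c) :
    twist μ[A] c ≫ X ◁ ε[A] = ε[A] ▷ X ≫ (λ_ X).hom ≫ (ρ_ X).inv :=
  twist_counit_whiskerLeft hc (by
    rw [unitAct, Bimon.mul_counit, MonoidalCategory.tensorHom_def]; monoidal)

open BraidedCategory in
theorem twist_comul_counit (a : X ⊗ A ⟶ X) : twist a Δ[A] ≫ ε[A] ▷ X = a ≫ (λ_ X).inv := by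
  calc
    _ = 𝟙 _ ⊗≫ X ◁ Δ[A] ⊗≫ ((β_ X A).hom ≫ ε[A] ▷ X) ▷ A ⊗≫ 𝟙_ C ◁ a := by
      have := whisker_exchange ε[A] a
      rw [twist]
      calc
        _ = 𝟙 _ ⊗≫ X ◁ Δ[A] ⊗≫ (β_ X A).hom ▷ A ⊗≫ (A ◁ a ≫ ε[A] ▷ X) := by monoidal
        _ = _ := by rw [this]; monoidal
    _ = 𝟙 _ ⊗≫ X ◁ (Δ[A] ≫ ε[A] ▷ A) ⊗≫ a ⊗≫ 𝟙 _ := by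
      rw [← braiding_naturality_right, braiding_tensorUnit_right]; monoidal
    _ = _ := by rw [ComonObj.counit_comul]; monoidal

open BraidedCategory in
theorem one_twist_mul (c : X ⟶ X ⊗ A) : η[A] ▷ X ≫ twist μ[A] c = (λ_ X).hom ≫ c := by
  calc
    _ = 𝟙_ C ◁ c ⊗≫ (η[A] ▷ X ≫ (β_ A X).hom) ▷ A ⊗≫ X ◁ μ[A] := by
      have := whisker_exchange η[A] c
      rw [twist]
      calc
        _ = (η[A] ▷ X ≫ A ◁ c) ⊗≫ (β_ A X).hom ▷ A ⊗≫ X ◁ μ[A] := by monoidal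
        _ = _ := by rw [← this]; monoidal
    _ = 𝟙 _ ⊗≫ c ⊗≫ X ◁ (η[A] ▷ A ≫ μ[A]) := by
      rw [braiding_naturality_left, braiding_tensorUnit_left]; monoidal
    _ = _ := by rw [MonObj.one_mul]; monoidal

end Unit

/-- The conditions which make `B` a bimonoid in the category of crossed modules over `A`, as
equations in `C`. -/
structure IsCrossedBimon {C : Type u} [Category.{v} C] [MonoidalCategory C] [BraidedCategory C]
    (A : C) [HopfObj A] {B : C} (b : B ⊗ A ⟶ B) (k : B ⟶ B ⊗ A) (e : 𝟙_ C ⟶ B) (m : B ⊗ B ⟶ B)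
    (f : B ⟶ 𝟙_ C) (d : B ⟶ B ⊗ B) : Prop where
  crossed : IsCrossedModule A b k
  one_mul : e ▷ B ≫ m = (λ_ B).hom
  isAct : IsAct e m m
  counit_comul : d ≫ f ▷ B = (λ_ B).inv
  isCoact : IsCoact f d d
  one_act : unitAct A ≫ e = e ▷ A ≫ b
  one_coact : e ≫ k = unitCoact A ≫ e ▷ A
  mul_act : tensorAct b b ≫ m = m ▷ A ≫ b
  mul_coact : m ≫ k = tensorCoact k k ≫ m ▷ A
  counit_act : b ≫ f = f ▷ A ≫ unitAct A
  counit_coact : f ≫ unitCoact A = k ≫ f ▷ A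
  comul_act : b ≫ d = d ▷ A ≫ tensorAct b b
  comul_coact : d ≫ tensorCoact k k = k ≫ d ▷ A
  mul_comul : m ≫ d =
    d ▷ B ≫ (α_ B B B).hom ≫ B ◁ dTwist b m k d ≫ (α_ B B B).inv ≫ m ▷ B
  one_comul : e ≫ d = (λ_ (𝟙_ C)).inv ≫ (e ⊗ₘ e)
  mul_counit : m ≫ f = (f ⊗ₘ f) ≫ (λ_ (𝟙_ C)).hom
  one_counit : e ≫ f = 𝟙 _

/-! ### The bialgebra axioms of the cross product -/

section Cross

variable {C : Type u} [Category.{v} C] [MonoidalCategory C] [BraidedCategory C] {A : C} [HopfObj A]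
  {B : C} {b : B ⊗ A ⟶ B} {k : B ⟶ B ⊗ A} {e : 𝟙_ C ⟶ B} {m : B ⊗ B ⟶ B}
  {f : B ⟶ 𝟙_ C} {d : B ⟶ B ⊗ B}

theorem tensorCoact_assoc_inv {X Y W : C} (c : X ⟶ X ⊗ A) (d : Y ⟶ Y ⊗ A) (e : W ⟶ W ⊗ A) :
    tensorCoact (tensorCoact c d) e =
      (α_ X Y W).hom ≫ tensorCoact c (tensorCoact d e) ≫ (α_ X Y W).inv ▷ A := by
  rw [reassoc_of% tensorCoact_assoc e]
  simp

theorem tensorAct_assoc_inv {X Y W : C} (a : X ⊗ A ⟶ X) (b : Y ⊗ A ⟶ Y) (e : W ⊗ A ⟶ W) :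
    tensorAct (tensorAct a b) e =
      (α_ X Y W).hom ▷ A ≫ tensorAct a (tensorAct b e) ≫ (α_ X Y W).inv := by
  rw [← reassoc_of% tensorAct_assoc e]
  simp

theorem tensorHom_tensorμ_tensorHom {H X Y : C} (c : X ⟶ Y ⊗ H) (d : H ⟶ H ⊗ H) (a : Y ⊗ H ⟶ X)
    (m : H ⊗ H ⟶ H) :
    (c ⊗ₘ d) ≫ tensorμ Y H H H ≫ (a ⊗ₘ m) =
      c ▷ H ≫ (α_ Y H H).hom ≫ Y ◁ twist m d ≫ (α_ Y H H).inv ≫ a ▷ H := by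
  rw [tensorμ, twist, MonoidalCategory.tensorHom_def c, MonoidalCategory.tensorHom_def' a]
  monoidal

-- The bialgebra axiom in the form of the Hopf module axiom for `A` over itself. In this form it can
-- be transported to the cross product by `hopf_dAct_dCoact`.
variable (A) in
theorem mul_comul_eq_twist :
    μ[A] ≫ Δ[A] = Δ[A] ▷ A ≫ (α_ A A A).hom ≫ A ◁ twist μ[A] Δ[A] ≫ (α_ A A A).inv ≫ μ[A] ▷ A := by
  rw [BimonObj.mul_comul, tensorHom_tensorμ_tensorHom]

theorem tensorAct_whiskerLeft {X Y Y' : C} (a : X ⊗ A ⟶ X) {b : Y ⊗ A ⟶ Y} {b' : Y' ⊗ A ⟶ Y'}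
    {g : Y ⟶ Y'} (hg : b ≫ g = g ▷ A ≫ b') :
    tensorAct a b ≫ X ◁ g = (X ◁ g) ▷ A ≫ tensorAct a b' := by
  simpa using tensorAct_hom (a := a) (f := 𝟙 X) (by simp) hg

theorem tensorAct_whiskerRight {X X' Y : C} {a : X ⊗ A ⟶ X} {a' : X' ⊗ A ⟶ X'} (b : Y ⊗ A ⟶ Y)
    {g : X ⟶ X'} (hg : a ≫ g = g ▷ A ≫ a') :
    tensorAct a b ≫ g ▷ Y = (g ▷ Y) ▷ A ≫ tensorAct a' b := by
  simpa using tensorAct_hom (b := b) (g := 𝟙 Y) hg (by simp)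

theorem tensorCoact_whiskerLeft {X Y Y' : C} (c : X ⟶ X ⊗ A) {k : Y ⟶ Y ⊗ A} {k' : Y' ⟶ Y' ⊗ A}
    {g : Y ⟶ Y'} (hg : g ≫ k' = k ≫ g ▷ A) :
    X ◁ g ≫ tensorCoact c k' = tensorCoact c k ≫ (X ◁ g) ▷ A := by
  simpa using tensorCoact_hom (c := c) (f := 𝟙 X) (by simp) hg

theorem tensorCoact_whiskerRight {X X' Y : C} {c : X ⟶ X ⊗ A} {c' : X' ⟶ X' ⊗ A} (k : Y ⟶ Y ⊗ A)
    {g : X ⟶ X'} (hg : g ≫ c' = c ≫ g ▷ A) :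
    g ▷ Y ≫ tensorCoact c' k = tensorCoact c k ≫ (g ▷ Y) ▷ A := by
  simpa using tensorCoact_hom (d := k) (g := 𝟙 Y) hg (by simp)

variable (h : IsCrossedBimon A b k e m f d)
include h

namespace IsCrossedBimon

/-- `A` acts diagonally on `A ⊗ B` and `B` acts by multiplying the second factor; the two are
compatible because `m` is linear over `A`. Right unitality and associativity come out together. -/
theorem isAct_cMul : IsAct ((λ_ (𝟙_ C)).inv ≫ (η[A] ⊗ₘ e)) (cMul b m) (cMul b m) := by
  refine IsAct.dAct (isAct_tensorAct_mul (isAct_mul A) h.crossed.isAct) ?_ ?_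
  · constructor
    · calc
        _ = 𝟙 _ ⊗≫ A ◁ (B ◁ e ≫ m) := by monoidal
        _ = _ := by rw [h.isAct.one]; monoidal
    · calc
        _ = 𝟙 _ ⊗≫ A ◁ (B ◁ m ≫ m) := by monoidal
        _ = _ := by rw [h.isAct.mul]; monoidal
  · rw [reassoc_of% tensorAct_assoc b, tensorAct_whiskerLeft _ h.mul_act]
    simp

theorem isCoact_cComul :
    IsCoact ((ε[A] ⊗ₘ f) ≫ (λ_ (𝟙_ C)).hom) (cComul k d) (cComul k d) := by
  refine IsCoact.dCoact (isCoact_tensorCoact_comul (isCoact_comul A) h.crossed.isCoact) ?_ ?_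
  · constructor
    · calc
        _ = A ◁ (d ≫ B ◁ f) ⊗≫ 𝟙 _ := by monoidal
        _ = _ := by rw [h.isCoact.counit]; monoidal
    · calc
        _ = A ◁ (d ≫ B ◁ d) ⊗≫ 𝟙 _ := by monoidal
        _ = _ := by rw [h.isCoact.comul]; monoidal
  · rw [tensorCoact_assoc_inv]
    simp [reassoc_of% tensorCoact_whiskerLeft Δ[A] h.comul_coact]

theorem cMul_one_mul : ((λ_ (𝟙_ C)).inv ≫ (η[A] ⊗ₘ e)) ▷ (A ⊗ B) ≫ cMul b m = (λ_ (A ⊗ B)).hom := by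
  rw [cMul, dAct, tensorAct_eq_twist, MonoidalCategory.tensorHom_def]
  calc
    _ = 𝟙 _ ⊗≫ η[A] ▷ A ▷ B ⊗≫ A ◁ (e ▷ A ≫ twist b Δ[A]) ▷ B ⊗≫ μ[A] ▷ B ▷ B ⊗≫ A ◁ m := by
      monoidal
    _ = 𝟙 _ ⊗≫ (η[A] ▷ A ≫ μ[A]) ▷ B ⊗≫ A ◁ (e ▷ B ≫ m) := by
      rw [whiskerRight_unit_twist (isCoact_comul A) h.one_act]
      calc
        _ = 𝟙 _ ⊗≫ η[A] ▷ A ▷ B ⊗≫ ((A ⊗ A) ◁ e ≫ μ[A] ▷ B) ▷ B ⊗≫ A ◁ m := by monoidal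
        _ = _ := by rw [whisker_exchange]; monoidal
    _ = _ := by rw [MonObj.one_mul, h.one_mul]; monoidal

theorem cComul_counit_comul :
    cComul k d ≫ ((ε[A] ⊗ₘ f) ≫ (λ_ (𝟙_ C)).hom) ▷ (A ⊗ B) = (λ_ (A ⊗ B)).inv := by
  rw [cComul, dCoact, tensorCoact_eq_twist, MonoidalCategory.tensorHom_def']
  calc
    _ = A ◁ d ⊗≫ Δ[A] ▷ B ▷ B ⊗≫ A ◁ (twist μ[A] k ≫ f ▷ A) ▷ B ⊗≫ ε[A] ▷ A ▷ B ⊗≫ 𝟙 _ := by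
      monoidal
    _ = A ◁ (d ≫ f ▷ B) ⊗≫ (Δ[A] ≫ ε[A] ▷ A) ▷ B ⊗≫ 𝟙 _ := by
      rw [twist_counit_whiskerRight (isAct_mul A) h.counit_coact]
      calc
        _ = A ◁ d ⊗≫ (Δ[A] ▷ B ≫ (A ⊗ A) ◁ f) ▷ B ⊗≫ ε[A] ▷ A ▷ B ⊗≫ 𝟙 _ := by monoidal
        _ = _ := by rw [← whisker_exchange]; monoidal
    _ = _ := by rw [ComonObj.counit_comul, h.counit_comul]; monoidal

theorem cMul_cComul :
    cMul b m ≫ cComul k d = (cComul k d ⊗ₘ cComul k d) ≫ tensorμ _ _ _ _ ≫ (cMul b m ⊗ₘ cMul b m) := by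
  rw [tensorHom_tensorμ_tensorHom]
  refine hopf_dAct_dCoact (X := A ⊗ B) (a := tensorAct μ[A] b) (a' := (α_ A B B).hom ≫ A ◁ m)
    (c := tensorCoact Δ[A] k) (c' := A ◁ d ≫ (α_ A B B).inv) (m := m) (d := d)
    h.crossed.isAct h.crossed.isCoact ?_ ?_ ?_ ?_
  -- The Hopf module axiom for `A ⊗ B` over `A`: after applying the bialgebra axiom of `A`, the
  -- three remaining twists differ from the goal by the Yang-Baxter equation for the strands `A`,
  -- `B`, `A`. This is where the crossed module axiom of `B` enters.
  · have yb := twist_yang_baxter (isAct_mul A) h.crossed (isCoact_comul A)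
    rw [tensorAct_eq_twist, tensorCoact_eq_twist]
    calc
      _ = 𝟙 _ ⊗≫ A ◁ twist b Δ[A] ⊗≫ (μ[A] ≫ Δ[A]) ▷ B ⊗≫ A ◁ twist μ[A] k ⊗≫ 𝟙 _ := by monoidal
      _ = 𝟙 _ ⊗≫ (A ◁ twist b Δ[A] ≫ Δ[A] ▷ (A ⊗ B)) ⊗≫ A ◁ twist μ[A] Δ[A] ▷ B ⊗≫
          (μ[A] ▷ (A ⊗ B) ≫ A ◁ twist μ[A] k) ⊗≫ 𝟙 _ := by
        rw [mul_comul_eq_twist]; monoidal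
      _ = 𝟙 _ ⊗≫ Δ[A] ▷ (B ⊗ A) ⊗≫ A ◁ ((α_ A B A).hom ≫ A ◁ twist b Δ[A] ≫ (α_ A A B).inv ≫
          twist μ[A] Δ[A] ▷ B ≫ (α_ A A B).hom ≫ A ◁ twist μ[A] k ≫ (α_ A B A).inv) ⊗≫
          μ[A] ▷ (B ⊗ A) ⊗≫ 𝟙 _ := by
        rw [whisker_exchange Δ[A], ← whisker_exchange μ[A]]; monoidal
      _ = _ := by rw [← yb]; monoidal
  · rw [reassoc_of% tensorAct_whiskerLeft _ h.comul_act, tensorAct_assoc_inv]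
    simp
  · rw [Category.assoc, tensorCoact_whiskerLeft _ h.mul_coact, reassoc_of% tensorCoact_assoc,
      comp_whiskerRight]
  · calc
      _ = 𝟙 _ ⊗≫ A ◁ (m ≫ d) ⊗≫ 𝟙 _ := by monoidal
      _ = _ := by rw [h.mul_comul]; monoidal

theorem one_cComul : ((λ_ (𝟙_ C)).inv ≫ (η[A] ⊗ₘ e)) ≫ cComul k d =
    (λ_ (𝟙_ C)).inv ≫ (((λ_ (𝟙_ C)).inv ≫ (η[A] ⊗ₘ e)) ⊗ₘ ((λ_ (𝟙_ C)).inv ≫ (η[A] ⊗ₘ e))) := by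
  rw [cComul, dCoact, tensorCoact_eq_twist, MonoidalCategory.tensorHom_def η[A] e]
  calc
    _ = 𝟙 _ ⊗≫ η[A] ⊗≫ (A ◁ (e ≫ d) ≫ Δ[A] ▷ (B ⊗ B)) ⊗≫ A ◁ twist μ[A] k ▷ B ⊗≫ 𝟙 _ := by
      monoidal
    _ = 𝟙 _ ⊗≫ (η[A] ≫ Δ[A]) ⊗≫ (A ⊗ A) ◁ (e ≫ d) ⊗≫ A ◁ twist μ[A] k ▷ B ⊗≫ 𝟙 _ := by
      rw [whisker_exchange]; monoidal
    _ = 𝟙 _ ⊗≫ η[A] ⊗≫ A ◁ η[A] ⊗≫ (A ◁ (A ◁ e ▷ 𝟙_ C) ≫ A ◁ (A ◁ B ◁ e)) ⊗≫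
        A ◁ twist μ[A] k ▷ B ⊗≫ 𝟙 _ := by
      rw [h.one_comul, Bimon.one_comul, MonoidalCategory.tensorHom_def η[A] η[A],
        MonoidalCategory.tensorHom_def e e]
      monoidal
    _ = 𝟙 _ ⊗≫ η[A] ⊗≫ A ◁ η[A] ⊗≫ A ◁ (A ◁ e ≫ twist μ[A] k) ⊗≫ A ◁ B ◁ A ◁ e ⊗≫ 𝟙 _ := by
      calc
        _ = 𝟙 _ ⊗≫ η[A] ⊗≫ A ◁ η[A] ⊗≫ A ◁ A ◁ e ⊗≫ A ◁ ((A ⊗ B) ◁ e ≫ twist μ[A] k ▷ B) ⊗≫ 𝟙 _ := by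
          monoidal
        _ = _ := by rw [whisker_exchange]; monoidal
    _ = 𝟙 _ ⊗≫ η[A] ⊗≫ A ◁ (𝟙_ C ◁ η[A] ≫ e ▷ A) ⊗≫ A ◁ B ◁ A ◁ e ⊗≫ 𝟙 _ := by
      rw [whiskerLeft_unit_twist (isAct_mul A) h.one_coact]; monoidal
    _ = _ := by
      rw [whisker_exchange, MonoidalCategory.tensorHom_def]; monoidal

theorem cMul_counit : cMul b m ≫ (ε[A] ⊗ₘ f) ≫ (λ_ (𝟙_ C)).hom =
    (((ε[A] ⊗ₘ f) ≫ (λ_ (𝟙_ C)).hom) ⊗ₘ ((ε[A] ⊗ₘ f) ≫ (λ_ (𝟙_ C)).hom)) ≫ (λ_ (𝟙_ C)).hom := by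
  rw [cMul, dAct, tensorAct_eq_twist, MonoidalCategory.tensorHom_def' ε[A] f]
  calc
    _ = 𝟙 _ ⊗≫ A ◁ twist b Δ[A] ▷ B ⊗≫ (μ[A] ▷ (B ⊗ B) ≫ A ◁ (m ≫ f)) ⊗≫ ε[A] ⊗≫ 𝟙 _ := by
      monoidal
    _ = 𝟙 _ ⊗≫ A ◁ twist b Δ[A] ▷ B ⊗≫ (A ⊗ A) ◁ (m ≫ f) ⊗≫ (μ[A] ≫ ε[A]) ⊗≫ 𝟙 _ := by
      rw [← whisker_exchange]; monoidal
    _ = 𝟙 _ ⊗≫ A ◁ (twist b Δ[A] ▷ B ≫ (A ⊗ B) ◁ f) ⊗≫ A ◁ A ◁ f ⊗≫ A ◁ ε[A] ⊗≫ ε[A] ⊗≫ 𝟙 _ := by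
      rw [h.mul_counit, Bimon.mul_counit, MonoidalCategory.tensorHom_def' ε[A] ε[A],
        MonoidalCategory.tensorHom_def' f f]
      monoidal
    _ = 𝟙 _ ⊗≫ A ◁ B ◁ A ◁ f ⊗≫ A ◁ (twist b Δ[A] ≫ A ◁ f) ⊗≫ A ◁ ε[A] ⊗≫ ε[A] ⊗≫ 𝟙 _ := by
      rw [← whisker_exchange]; monoidal
    _ = 𝟙 _ ⊗≫ A ◁ B ◁ A ◁ f ⊗≫ A ◁ (f ▷ A ≫ 𝟙_ C ◁ ε[A]) ⊗≫ ε[A] ⊗≫ 𝟙 _ := by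
      rw [twist_counit_whiskerLeft (isCoact_comul A) h.counit_act]; monoidal
    _ = _ := by
      rw [← whisker_exchange, MonoidalCategory.tensorHom_def']; monoidal

theorem one_counit_cross :
    ((λ_ (𝟙_ C)).inv ≫ (η[A] ⊗ₘ e)) ≫ (ε[A] ⊗ₘ f) ≫ (λ_ (𝟙_ C)).hom = 𝟙 _ := by
  rw [Category.assoc, tensorHom_comp_tensorHom_assoc, h.one_counit, BimonObj.one_counit]
  simp

end IsCrossedBimon

end Cross

/-! ### Invertibility of the twist -/

section TwistInverse

variable {C : Type u} [Category.{v} C] [MonoidalCategory C] [BraidedCategory C] {H : C} [HopfObj H]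
  {X Y : C}

-- Composing two such maps coacts twice on `Y` and acts twice on `X`. Coassociativity and
-- associativity merge these into one coaction and one action by the convolution product of `f` and
-- `g` taken with the inverse braiding, which `w` makes trivial.
open BraidedCategory in
theorem phi_comp_phi {a : X ⊗ H ⟶ X} {d : Y ⟶ Y ⊗ H} (h : IsAct η[H] μ[H] a)
    (l : IsCoact ε[H] Δ[H] d) (f g : H ⟶ H)
    (w : Δ[H] ≫ (β_ H H).inv ≫ (f ⊗ₘ g) ≫ μ[H] = ε[H] ≫ η[H]) :
    phi a d f ≫ phi a d g = 𝟙 _ := by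
  have e : d ≫ Y ◁ f ≫ (β_ H Y).inv ≫ H ◁ (d ≫ Y ◁ g ≫ (β_ H Y).inv) ≫ (α_ H H Y).inv ≫
      μ[H] ▷ Y = (λ_ Y).inv ≫ η[H] ▷ Y := by
    calc
      _ = d ≫ Y ◁ f ≫ ((β_ H Y).inv ≫ H ◁ d) ≫ H ◁ Y ◁ g ≫ H ◁ (β_ H Y).inv ≫ (α_ H H Y).inv ≫
          μ[H] ▷ Y := by monoidal
      _ = (d ≫ Y ◁ f ≫ d ▷ H) ≫ (β_ H (Y ⊗ H)).inv ≫ H ◁ Y ◁ g ≫ H ◁ (β_ H Y).inv ≫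
          (α_ H H Y).inv ≫ μ[H] ▷ Y := by
        rw [← braiding_inv_naturality_left]; simp only [Category.assoc]
      _ = (d ≫ Y ◁ Δ[H]) ≫ (α_ Y H H).inv ≫ (Y ⊗ H) ◁ f ≫ (Y ◁ g) ▷ H ≫ (β_ H (Y ⊗ H)).inv ≫
          H ◁ (β_ H Y).inv ≫ (α_ H H Y).inv ≫ μ[H] ▷ Y := by
        rw [l.comul, whisker_exchange, ← braiding_inv_naturality_left_assoc]
        simp only [Category.assoc, Iso.hom_inv_id_assoc]
      _ = d ≫ Y ◁ (Δ[H] ≫ (β_ H H).inv ≫ (f ⊗ₘ g) ≫ μ[H]) ≫ (β_ H Y).inv := by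
        rw [← braiding_inv_naturality_assoc]
        simp only [whiskerLeft_comp, Category.assoc]
        rw [braiding_inv_naturality_right, braiding_tensor_right_inv, braiding_tensor_left_inv,
          MonoidalCategory.tensorHom_def']
        monoidal
      _ = _ := by
        rw [w, whiskerLeft_comp, Category.assoc, reassoc_of% l.counit,
          braiding_inv_naturality_right]
        simp
  calc
    _ = 𝟙 _ ⊗≫ X ◁ (d ≫ Y ◁ f ≫ (β_ H Y).inv) ⊗≫
        (a ▷ Y ≫ X ◁ (d ≫ Y ◁ g ≫ (β_ H Y).inv)) ⊗≫ a ▷ Y := by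
      simp only [phi]; monoidal
    _ = 𝟙 _ ⊗≫ X ◁ (d ≫ Y ◁ f ≫ (β_ H Y).inv) ⊗≫
        X ◁ H ◁ (d ≫ Y ◁ g ≫ (β_ H Y).inv) ⊗≫ (a ▷ H ≫ a) ▷ Y := by
      rw [← whisker_exchange]; monoidal
    _ = 𝟙 _ ⊗≫ X ◁ (d ≫ Y ◁ f ≫ (β_ H Y).inv ≫ H ◁ (d ≫ Y ◁ g ≫ (β_ H Y).inv) ≫
      (α_ H H Y).inv ≫ μ[H] ▷ Y) ⊗≫ a ▷ Y := by
      rw [h.mul']; monoidal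
    _ = 𝟙 _ ⊗≫ (X ◁ η[H] ≫ a) ▷ Y ⊗≫ 𝟙 _ := by
      rw [e]; monoidal
    _ = _ := by rw [h.one]; monoidal

/-- Up to the braiding, the twist is `phi` at the identity. For convolution with the inverse
braiding the inverse of the identity is `inv 𝒮`, not `𝒮`, hence the invertibility assumption. -/
theorem isIso_twist [IsIso 𝒮[H]] {a : X ⊗ H ⟶ X} {d : Y ⟶ Y ⊗ H} (h : IsAct η[H] μ[H] a)
    (l : IsCoact ε[H] Δ[H] d) : IsIso (twist a d) := by
  have e : twist a d = phi a d (𝟙 H) ≫ (β_ X Y).hom := yBr_eq_phi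
  have : IsIso (phi a d (𝟙 H)) :=
    ⟨phi a d (inv 𝒮[H]), phi_comp_phi h l _ _ conv1, phi_comp_phi h l _ _ conv2⟩
  rw [e]
  infer_instance

end TwistInverse

/-! ### Inclusions and projections of the two factors -/

section Factors

variable {C : Type u} [Category.{v} C] [MonoidalCategory C]

section Maps

variable (A : C) {B : C}

/-- The inclusion of the first factor of a cross product. -/
def crossInl (e : 𝟙_ C ⟶ B) : A ⟶ A ⊗ B := (ρ_ A).inv ≫ A ◁ e

/-- The projection to the first factor of a cross product. -/
def crossFst (f : B ⟶ 𝟙_ C) : A ⊗ B ⟶ A := A ◁ f ≫ (ρ_ A).hom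

variable [BraidedCategory C] [HopfObj A] (B)

/-- The inclusion of the second factor of a cross product. -/
def crossInr : B ⟶ A ⊗ B := (λ_ B).inv ≫ η[A] ▷ B

/-- The projection to the second factor of a cross product. -/
def crossSnd : A ⊗ B ⟶ B := ε[A] ▷ B ≫ (λ_ B).hom

end Maps

section

variable {A B X : C}

theorem inl_dAct {e : 𝟙_ C ⟶ B} {m : B ⊗ B ⟶ B} (a : X ⊗ A ⟶ X) {a' : X ⊗ B ⟶ X}
    (h : IsAct e m a') : X ◁ crossInl A e ≫ dAct a a' = a := by
  calc
    _ = 𝟙 _ ⊗≫ ((X ⊗ A) ◁ e ≫ a ▷ B) ≫ a' := by rw [crossInl, dAct]; monoidal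
    _ = 𝟙 _ ⊗≫ a ⊗≫ (X ◁ e ≫ a') := by rw [whisker_exchange]; monoidal
    _ = _ := by rw [h.one]; monoidal

theorem dCoact_fst {f : B ⟶ 𝟙_ C} {d : B ⟶ B ⊗ B} (c : X ⟶ X ⊗ A) {c' : X ⟶ X ⊗ B}
    (h : IsCoact f d c') : dCoact c c' ≫ X ◁ crossFst A f = c := by
  calc
    _ = c' ≫ (c ▷ B ≫ (X ⊗ A) ◁ f) ⊗≫ 𝟙 _ := by rw [crossFst, dCoact]; monoidal
    _ = (c' ≫ X ◁ f) ⊗≫ c ⊗≫ 𝟙 _ := by rw [← whisker_exchange]; monoidal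
    _ = _ := by rw [h.counit]; monoidal

end

variable [BraidedCategory C] {A : C} [HopfObj A] {B X : C}

theorem inr_dAct {a : X ⊗ A ⟶ X} (h : IsAct η[A] μ[A] a) (a' : X ⊗ B ⟶ X) :
    X ◁ crossInr A B ≫ dAct a a' = a' := by
  calc
    _ = 𝟙 _ ⊗≫ (X ◁ η[A] ≫ a) ▷ B ⊗≫ a' := by rw [crossInr, dAct]; monoidal
    _ = _ := by rw [h.one]; monoidal

theorem dCoact_snd {c : X ⟶ X ⊗ A} (h : IsCoact ε[A] Δ[A] c) (c' : X ⟶ X ⊗ B) :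
    dCoact c c' ≫ X ◁ crossSnd A B = c' := by
  calc
    _ = c' ⊗≫ (c ≫ X ◁ ε[A]) ▷ B ⊗≫ 𝟙 _ := by rw [crossSnd, dCoact]; monoidal
    _ = _ := by rw [h.counit]; monoidal

end Factors

/-! ### Products and coproducts of the factors, and the antipode -/

namespace IsCrossedBimon

variable {C : Type u} [Category.{v} C] [MonoidalCategory C] [BraidedCategory C] {A : C} [HopfObj A]
  {B : C} {b : B ⊗ A ⟶ B} {k : B ⟶ B ⊗ A} {e : 𝟙_ C ⟶ B} {m : B ⊗ B ⟶ B}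
  {f : B ⟶ 𝟙_ C} {d : B ⟶ B ⊗ B} (h : IsCrossedBimon A b k e m f d)
include h

theorem inner_act : IsAct e m ((α_ A B B).hom ≫ A ◁ m) := by
  constructor
  · calc
      _ = 𝟙 _ ⊗≫ A ◁ (B ◁ e ≫ m) := by monoidal
      _ = _ := by rw [h.isAct.one]; monoidal
  · calc
      _ = 𝟙 _ ⊗≫ A ◁ (B ◁ m ≫ m) := by monoidal
      _ = _ := by rw [h.isAct.mul]; monoidal

theorem inner_coact : IsCoact f d (A ◁ d ≫ (α_ A B B).inv) := by
  constructor
  · calc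
      _ = A ◁ (d ≫ B ◁ f) ⊗≫ 𝟙 _ := by monoidal
      _ = _ := by rw [h.isCoact.counit]; monoidal
  · calc
      _ = A ◁ (d ≫ B ◁ d) ⊗≫ 𝟙 _ := by monoidal
      _ = _ := by rw [h.isCoact.comul]; monoidal

theorem whiskerLeft_inl_mul : (A ⊗ B) ◁ crossInl A e ≫ cMul b m = tensorAct μ[A] b :=
  inl_dAct _ h.inner_act

theorem whiskerLeft_inr_mul : (A ⊗ B) ◁ crossInr A B ≫ cMul b m = (α_ A B B).hom ≫ A ◁ m :=
  inr_dAct (isAct_tensorAct_mul (isAct_mul A) h.crossed.isAct) _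

theorem comul_whiskerLeft_fst : cComul k d ≫ (A ⊗ B) ◁ crossFst A f = tensorCoact Δ[A] k :=
  dCoact_fst _ h.inner_coact

theorem comul_whiskerLeft_snd :
    cComul k d ≫ (A ⊗ B) ◁ crossSnd A B = A ◁ d ≫ (α_ A B B).inv :=
  dCoact_snd (isCoact_tensorCoact_comul (isCoact_comul A) h.crossed.isCoact) _

/-- The unit of `B` is linear over `A`, so it passes through `twist b Δ` unchanged. This and the
next three products replace elementwise computation in the cross product: each inclusion is
multiplicative, elements of `A` before elements of `B` multiply to the identity of `A ⊗ B`, and the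
opposite order costs a twist. -/
theorem inl_inl_mul : (crossInl A e ⊗ₘ crossInl A e) ≫ cMul b m = μ[A] ≫ crossInl A e := by
  rw [MonoidalCategory.tensorHom_def, Category.assoc, h.whiskerLeft_inl_mul, tensorAct_eq_twist,
    crossInl]
  calc
    _ = 𝟙 _ ⊗≫ A ◁ (e ▷ A ≫ twist b Δ[A]) ⊗≫ μ[A] ▷ B := by monoidal
    _ = 𝟙 _ ⊗≫ ((A ⊗ A) ◁ e ≫ μ[A] ▷ B) := by
      rw [whiskerRight_unit_twist (isCoact_comul A) h.one_act]; monoidal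
    _ = _ := by rw [whisker_exchange]; monoidal

theorem inl_inr_mul : (crossInl A e ⊗ₘ crossInr A B) ≫ cMul b m = 𝟙 _ := by
  rw [MonoidalCategory.tensorHom_def, Category.assoc, h.whiskerLeft_inr_mul, crossInl]
  calc
    _ = 𝟙 _ ⊗≫ A ◁ (e ▷ B ≫ m) := by monoidal
    _ = _ := by rw [h.one_mul]; monoidal

theorem inr_inl_mul : (crossInr A B ⊗ₘ crossInl A e) ≫ cMul b m = twist b Δ[A] := by
  rw [MonoidalCategory.tensorHom_def, Category.assoc, h.whiskerLeft_inl_mul, tensorAct_eq_twist,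
    crossInr]
  calc
    _ = 𝟙 _ ⊗≫ (η[A] ▷ (B ⊗ A) ≫ A ◁ twist b Δ[A]) ⊗≫ μ[A] ▷ B := by monoidal
    _ = 𝟙 _ ⊗≫ twist b Δ[A] ⊗≫ (η[A] ▷ A ≫ μ[A]) ▷ B := by rw [← whisker_exchange]; monoidal
    _ = _ := by rw [MonObj.one_mul]; monoidal

theorem inr_inr_mul : (crossInr A B ⊗ₘ crossInr A B) ≫ cMul b m = m ≫ crossInr A B := by
  rw [MonoidalCategory.tensorHom_def, Category.assoc, h.whiskerLeft_inr_mul, crossInr]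
  calc
    _ = 𝟙 _ ⊗≫ (η[A] ▷ (B ⊗ B) ≫ A ◁ m) := by monoidal
    _ = _ := by rw [← whisker_exchange]; monoidal

theorem comul_fst_fst : cComul k d ≫ (crossFst A f ⊗ₘ crossFst A f) = crossFst A f ≫ Δ[A] := by
  rw [MonoidalCategory.tensorHom_def', reassoc_of% h.comul_whiskerLeft_fst, tensorCoact_eq_twist,
    crossFst]
  calc
    _ = Δ[A] ▷ B ⊗≫ A ◁ (twist μ[A] k ≫ f ▷ A) ⊗≫ 𝟙 _ := by monoidal
    _ = (Δ[A] ▷ B ≫ (A ⊗ A) ◁ f) ⊗≫ 𝟙 _ := by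
      rw [twist_counit_whiskerRight (isAct_mul A) h.counit_coact]; monoidal
    _ = _ := by rw [← whisker_exchange]; monoidal

theorem comul_fst_snd : cComul k d ≫ (crossFst A f ⊗ₘ crossSnd A B) = 𝟙 _ := by
  rw [MonoidalCategory.tensorHom_def', reassoc_of% h.comul_whiskerLeft_snd, crossFst]
  calc
    _ = A ◁ (d ≫ f ▷ B) ⊗≫ 𝟙 _ := by monoidal
    _ = _ := by rw [h.counit_comul]; monoidal

theorem comul_snd_fst : cComul k d ≫ (crossSnd A B ⊗ₘ crossFst A f) = twist μ[A] k := by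
  rw [MonoidalCategory.tensorHom_def', reassoc_of% h.comul_whiskerLeft_fst, tensorCoact_eq_twist,
    crossSnd]
  calc
    _ = Δ[A] ▷ B ⊗≫ (A ◁ twist μ[A] k ≫ ε[A] ▷ (B ⊗ A)) ⊗≫ 𝟙 _ := by monoidal
    _ = (Δ[A] ≫ ε[A] ▷ A) ▷ B ⊗≫ twist μ[A] k ⊗≫ 𝟙 _ := by rw [whisker_exchange]; monoidal
    _ = _ := by rw [ComonObj.counit_comul]; monoidal

theorem comul_snd_snd : cComul k d ≫ (crossSnd A B ⊗ₘ crossSnd A B) = crossSnd A B ≫ d := by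
  rw [MonoidalCategory.tensorHom_def', reassoc_of% h.comul_whiskerLeft_snd, crossSnd]
  calc
    _ = (A ◁ d ≫ ε[A] ▷ (B ⊗ B)) ⊗≫ 𝟙 _ := by monoidal
    _ = _ := by rw [whisker_exchange]; monoidal

/-- The cross product as a bimonoid. -/
@[reducible]
def bimonObj : BimonObj (A ⊗ B) where
  one := (λ_ (𝟙_ C)).inv ≫ (η[A] ⊗ₘ e)
  mul := cMul b m
  one_mul := h.cMul_one_mul
  mul_one := h.isAct_cMul.one
  mul_assoc := by rw [h.isAct_cMul.mul, Iso.hom_inv_id_assoc]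
  counit := (ε[A] ⊗ₘ f) ≫ (λ_ (𝟙_ C)).hom
  comul := cComul k d
  counit_comul := h.cComul_counit_comul
  comul_counit := h.isCoact_cComul.counit
  comul_assoc := h.isCoact_cComul.comul
  mul_comul := h.cMul_cComul
  one_comul := h.one_cComul
  mul_counit := h.cMul_counit
  one_counit := h.one_counit_cross

/-- In the convolution algebra of `A ⊗ B` the identity factors as `u * v`, one factor through `A`
and one through `B`. Inverting each with its own antipode and reversing the order gives the inverse
`v' * u'`. -/
theorem antipode {s : B ⟶ B} (hs : d ≫ s ▷ B ≫ m = f ≫ e) (hs' : d ≫ B ◁ s ≫ m = f ≫ e) :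
    (cComul k d ≫ (twist μ[A] k ≫ (s ⊗ₘ 𝒮[A]) ≫ twist b Δ[A]) ▷ (A ⊗ B) ≫ cMul b m =
      ((ε[A] ⊗ₘ f) ≫ (λ_ (𝟙_ C)).hom) ≫ (λ_ (𝟙_ C)).inv ≫ (η[A] ⊗ₘ e)) ∧
    (cComul k d ≫ (A ⊗ B) ◁ (twist μ[A] k ≫ (s ⊗ₘ 𝒮[A]) ≫ twist b Δ[A]) ≫ cMul b m =
      ((ε[A] ⊗ₘ f) ≫ (λ_ (𝟙_ C)).hom) ≫ (λ_ (𝟙_ C)).inv ≫ (η[A] ⊗ₘ e)) := by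
  let _ := h.bimonObj
  -- A convolution product of maps that factor through `A` or `B` needs only the coproduct followed
  -- by two projections and the product of two inclusions, all of which are known.
  have key {P Q R T : C} (x : A ⊗ B ⟶ P) (y : P ⟶ R) (z : R ⟶ A ⊗ B) (x' : A ⊗ B ⟶ Q) (y' : Q ⟶ T)
      (z' : T ⟶ A ⊗ B) : Δ[A ⊗ B] ≫ (x ≫ y ≫ z) ▷ (A ⊗ B) ≫ (A ⊗ B) ◁ (x' ≫ y' ≫ z') ≫ μ[A ⊗ B] =
        (cComul k d ≫ (x ⊗ₘ x')) ≫ (y ⊗ₘ y') ≫ (z ⊗ₘ z') ≫ cMul b m := by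
    rw [← MonoidalCategory.tensorHom_def_assoc, ← tensorHom_comp_tensorHom,
      ← tensorHom_comp_tensorHom]
    simp only [Category.assoc]
    rfl
  have hA : crossFst A f ≫ (ε[A] ≫ η[A]) ≫ crossInl A e = ε[A ⊗ B] ≫ η[A ⊗ B] := by
    have h1 : crossFst A f ≫ ε[A] = (ε[A] ⊗ₘ f) ≫ (λ_ (𝟙_ C)).hom := by
      rw [crossFst, MonoidalCategory.tensorHom_def']; monoidal
    have h2 : η[A] ≫ crossInl A e = (λ_ (𝟙_ C)).inv ≫ (η[A] ⊗ₘ e) := by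
      rw [crossInl, MonoidalCategory.tensorHom_def]; monoidal
    simp only [Category.assoc, reassoc_of% h1, h2]
    exact (Category.assoc _ _ _).symm
  have hB : crossSnd A B ≫ (f ≫ e) ≫ crossInr A B = ε[A ⊗ B] ≫ η[A ⊗ B] := by
    have h1 : crossSnd A B ≫ f = (ε[A] ⊗ₘ f) ≫ (λ_ (𝟙_ C)).hom := by
      rw [crossSnd, MonoidalCategory.tensorHom_def]; monoidal
    have h2 : e ≫ crossInr A B = (λ_ (𝟙_ C)).inv ≫ (η[A] ⊗ₘ e) := by
      rw [crossInr, MonoidalCategory.tensorHom_def']; monoidal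
    simp only [Category.assoc, reassoc_of% h1, h2]
    exact (Category.assoc _ _ _).symm
  let u : Conv (A ⊗ B) (A ⊗ B) := crossFst A f ≫ 𝟙 A ≫ crossInl A e
  let u' : Conv (A ⊗ B) (A ⊗ B) := crossFst A f ≫ 𝒮[A] ≫ crossInl A e
  let v : Conv (A ⊗ B) (A ⊗ B) := crossSnd A B ≫ 𝟙 B ≫ crossInr A B
  let v' : Conv (A ⊗ B) (A ⊗ B) := crossSnd A B ≫ s ≫ crossInr A B
  have u1 : u' * u = 1 := (key _ _ _ _ _ _).trans (by
    rw [h.comul_fst_fst, h.inl_inl_mul, Conv.one_eq, ← hA, ← HopfObj.antipode_left]; simp)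
  have u2 : u * u' = 1 := (key _ _ _ _ _ _).trans (by
    rw [h.comul_fst_fst, h.inl_inl_mul, Conv.one_eq, ← hA, ← HopfObj.antipode_right]; simp)
  have v1 : v' * v = 1 := (key _ _ _ _ _ _).trans (by
    rw [h.comul_snd_snd, h.inr_inr_mul, Conv.one_eq, ← hB, ← hs]; simp)
  have v2 : v * v' = 1 := (key _ _ _ _ _ _).trans (by
    rw [h.comul_snd_snd, h.inr_inr_mul, Conv.one_eq, ← hB, ← hs']; simp)
  have uv : u * v = (𝟙 (A ⊗ B) : A ⊗ B ⟶ A ⊗ B) := (key _ _ _ _ _ _).trans (by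
    rw [h.comul_fst_snd, h.inl_inr_mul]; simp)
  -- In this order the projections contribute `twist μ k` and the inclusions contribute `twist b Δ`,
  -- the outer parts of the antipode formula.
  have vu : v' * u' = (twist μ[A] k ≫ (s ⊗ₘ 𝒮[A]) ≫ twist b Δ[A] : A ⊗ B ⟶ A ⊗ B) :=
    (key _ _ _ _ _ _).trans (by rw [h.comul_snd_fst, h.inr_inl_mul])
  have w1 : v' * u' * (u * v) = 1 := by
    rw [mul_assoc, ← mul_assoc u', u1, _root_.one_mul, v1]
  have w2 : u * v * (v' * u') = 1 := by
    rw [mul_assoc, ← mul_assoc v, v2, _root_.one_mul, u2]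
  rw [vu, uv] at w1 w2
  have w1 : cComul k d ≫ (twist μ[A] k ≫ (s ⊗ₘ 𝒮[A]) ≫ twist b Δ[A]) ▷ (A ⊗ B) ≫
      (A ⊗ B) ◁ 𝟙 (A ⊗ B) ≫ cMul b m = _ := w1
  have w2 : cComul k d ≫ 𝟙 (A ⊗ B) ▷ (A ⊗ B) ≫
      (A ⊗ B) ◁ (twist μ[A] k ≫ (s ⊗ₘ 𝒮[A]) ≫ twist b Δ[A]) ≫ cMul b m = _ := w2
  rw [whiskerLeft_id, Category.id_comp] at w1
  rw [id_whiskerRight, Category.id_comp] at w2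
  exact ⟨w1, w2⟩

/-- The cross product as a Hopf monoid. -/
@[reducible]
def hopfObj {s : B ⟶ B} (hs : d ≫ s ▷ B ≫ m = f ≫ e) (hs' : d ≫ B ◁ s ≫ m = f ≫ e) :
    HopfObj (A ⊗ B) where
  toBimonObj := h.bimonObj
  antipode := twist μ[A] k ≫ (s ⊗ₘ 𝒮[A]) ≫ twist b Δ[A]
  antipode_left := (h.antipode hs hs').1
  antipode_right := (h.antipode hs hs').2

/-- The outer factors are twists, hence invertible, and the middle one is a tensor product of
isomorphisms. -/
theorem isIso_antipode [IsIso 𝒮[A]] (s : B ⟶ B) [IsIso s] :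
    IsIso (twist μ[A] k ≫ (s ⊗ₘ 𝒮[A]) ≫ twist b Δ[A]) := by
  have := isIso_twist (isAct_mul A) h.crossed.isCoact
  have := isIso_twist h.crossed.isAct (isCoact_comul A)
  infer_instance

end IsCrossedBimon

/-! ### Restricting composite structures along maps -/

section Restriction

variable {C : Type u} [Category.{v} C] [MonoidalCategory C] {H X P Q : C}

/-- Associativity on generalized elements. With `x` and `y` the inclusions of the factors it yields
four facts: both restrictions are actions, the action is their composite, and the action of `B` is
linear over `A`. -/
theorem IsAct.comp {e : 𝟙_ C ⟶ H} {m : H ⊗ H ⟶ H} {a : X ⊗ H ⟶ X} (h : IsAct e m a) (x : P ⟶ H)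
    (y : Q ⟶ H) :
    X ◁ ((x ⊗ₘ y) ≫ m) ≫ a = (α_ X P Q).inv ≫ (X ◁ x ≫ a) ▷ Q ≫ X ◁ y ≫ a := by
  rw [whiskerLeft_comp, Category.assoc, h.mul, MonoidalCategory.tensorHom_def]
  calc
    _ = 𝟙 _ ⊗≫ X ◁ x ▷ Q ⊗≫ ((X ⊗ H) ◁ y ≫ a ▷ H) ≫ a := by monoidal
    _ = _ := by rw [whisker_exchange]; monoidal

theorem IsCoact.comp {e : H ⟶ 𝟙_ C} {m : H ⟶ H ⊗ H} {c : X ⟶ X ⊗ H} (h : IsCoact e m c) (x : H ⟶ P)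
    (y : H ⟶ Q) :
    c ≫ X ◁ (m ≫ (x ⊗ₘ y)) = (c ≫ X ◁ y) ≫ (c ≫ X ◁ x) ▷ Q ≫ (α_ X P Q).hom := by
  rw [whiskerLeft_comp, reassoc_of% h.comul, MonoidalCategory.tensorHom_def']
  calc
    _ = c ≫ (c ▷ H ≫ (X ⊗ H) ◁ y) ⊗≫ X ◁ x ▷ Q ⊗≫ 𝟙 _ := by monoidal
    _ = _ := by rw [← whisker_exchange]; monoidal

end Restriction

section DoubleTwist

variable {C : Type u} [Category.{v} C] [MonoidalCategory C] [BraidedCategory C]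

theorem dTwist_nat_right {A B X Y Y' : C} {a : X ⊗ A ⟶ X} {a' : X ⊗ B ⟶ X} {c : Y ⟶ Y ⊗ A}
    {c' : Y ⟶ Y ⊗ B} {y : Y' ⟶ Y' ⊗ A} {y' : Y' ⟶ Y' ⊗ B} {g : Y ⟶ Y'} (h : g ≫ y = c ≫ g ▷ A)
    (h' : g ≫ y' = c' ≫ g ▷ B) :
    X ◁ g ≫ dTwist a a' y y' = dTwist a a' c c' ≫ g ▷ X := by
  calc
    _ = X ◁ (g ≫ y') ⊗≫ twist a y ▷ B ⊗≫ Y' ◁ a' := by rw [dTwist]; monoidal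
    _ = X ◁ c' ⊗≫ (X ◁ g ≫ twist a y) ▷ B ⊗≫ Y' ◁ a' := by rw [h']; monoidal
    _ = X ◁ c' ⊗≫ twist a c ▷ B ⊗≫ (g ▷ (X ⊗ B) ≫ Y' ◁ a') := by rw [twist_nat_right h]; monoidal
    _ = _ := by rw [← whisker_exchange, dTwist]; monoidal

end DoubleTwist

/-! ### Recovering crossed modules over the factors -/

namespace IsCrossedBimon

variable {C : Type u} [Category.{v} C] [MonoidalCategory C] [BraidedCategory C] {A : C} [HopfObj A]
  {B : C} {b : B ⊗ A ⟶ B} {k : B ⟶ B ⊗ A} {e : 𝟙_ C ⟶ B} {m : B ⊗ B ⟶ B}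
  {f : B ⟶ 𝟙_ C} {d : B ⟶ B ⊗ B} (h : IsCrossedBimon A b k e m f d)
include h

section

variable {X : C} {a : X ⊗ A ⟶ X} {a' : X ⊗ B ⟶ X} {c : X ⟶ X ⊗ A} {c' : X ⟶ X ⊗ B}

theorem whiskerLeft_one_dTwist (ha : IsAct η[A] μ[A] a) (ha' : IsAct e m a') :
    X ◁ e ≫ dTwist a a' k d = (ρ_ X).hom ≫ (λ_ X).inv ≫ e ▷ X := by
  calc
    _ = X ◁ (e ≫ d) ⊗≫ twist a k ▷ B ⊗≫ B ◁ a' := by rw [dTwist]; monoidal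
    _ = 𝟙 _ ⊗≫ X ◁ e ⊗≫ ((X ⊗ B) ◁ e ≫ twist a k ▷ B) ⊗≫ B ◁ a' := by
      rw [h.one_comul, MonoidalCategory.tensorHom_def]; monoidal
    _ = 𝟙 _ ⊗≫ (X ◁ e ≫ twist a k) ⊗≫ B ◁ (X ◁ e ≫ a') := by rw [whisker_exchange]; monoidal
    _ = _ := by rw [whiskerLeft_unit_twist ha h.one_coact, ha'.one]; monoidal

theorem dTwist_whiskerLeft_counit (hc : IsCoact ε[A] Δ[A] c) (hc' : IsCoact f d c') :
    dTwist b m c c' ≫ X ◁ f = f ▷ X ≫ (λ_ X).hom ≫ (ρ_ X).inv := by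
  calc
    _ = B ◁ c' ⊗≫ twist b c ▷ B ⊗≫ X ◁ (m ≫ f) := by rw [dTwist]; monoidal
    _ = B ◁ c' ⊗≫ (twist b c ▷ B ≫ (X ⊗ B) ◁ f) ⊗≫ X ◁ f ⊗≫ 𝟙 _ := by
      rw [h.mul_counit, MonoidalCategory.tensorHom_def']; monoidal
    _ = B ◁ (c' ≫ X ◁ f) ⊗≫ (twist b c ≫ X ◁ f) ⊗≫ 𝟙 _ := by rw [← whisker_exchange]; monoidal
    _ = _ := by rw [twist_counit_whiskerLeft hc h.counit_act, hc'.counit]; monoidal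

theorem dTwist_counit_whiskerRight (ha : IsAct η[A] μ[A] a) (a' : X ⊗ B ⟶ X) :
    dTwist a a' k d ≫ f ▷ X = a' ≫ (λ_ X).inv := by
  calc
    _ = X ◁ d ⊗≫ twist a k ▷ B ⊗≫ (B ◁ a' ≫ f ▷ X) := by rw [dTwist]; monoidal
    _ = X ◁ d ⊗≫ (twist a k ≫ f ▷ X) ▷ B ⊗≫ a' ⊗≫ 𝟙 _ := by rw [whisker_exchange]; monoidal
    _ = X ◁ (d ≫ f ▷ B) ⊗≫ a' ⊗≫ 𝟙 _ := by
      rw [twist_counit_whiskerRight ha h.counit_coact]; monoidal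
    _ = _ := by rw [h.counit_comul]; monoidal

theorem one_whiskerRight_dTwist (hc : IsCoact ε[A] Δ[A] c) (c' : X ⟶ X ⊗ B) :
    e ▷ X ≫ dTwist b m c c' = (λ_ X).hom ≫ c' := by
  calc
    _ = (e ▷ X ≫ B ◁ c') ⊗≫ twist b c ▷ B ⊗≫ X ◁ m := by rw [dTwist]; monoidal
    _ = 𝟙 _ ⊗≫ c' ⊗≫ (e ▷ X ≫ twist b c) ▷ B ⊗≫ X ◁ m := by rw [← whisker_exchange]; monoidal
    _ = 𝟙 _ ⊗≫ c' ⊗≫ X ◁ (e ▷ B ≫ m) := by rw [whiskerRight_unit_twist hc h.one_act]; monoidal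
    _ = _ := by rw [h.one_mul]; monoidal

/-- On the image of `A` the second strand is the unit of `B`, which `dTwist` carries past `X`
without change, so only the twist over `A` survives. -/
theorem inl_twist (ha : IsAct η[A] μ[A] a) (ha' : IsAct e m a') :
    X ◁ crossInl A e ≫ twist (dAct a a') (cComul k d) = twist a Δ[A] ≫ crossInl A e ▷ X := by
  rw [twist_cComul ha, crossInl]
  calc
    _ = 𝟙 _ ⊗≫ ((X ⊗ A) ◁ e ≫ twist a Δ[A] ▷ B) ⊗≫ A ◁ dTwist a a' k d ⊗≫ 𝟙 _ := by monoidal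
    _ = 𝟙 _ ⊗≫ twist a Δ[A] ⊗≫ A ◁ (X ◁ e ≫ dTwist a a' k d) ⊗≫ 𝟙 _ := by
      rw [whisker_exchange]; monoidal
    _ = _ := by rw [h.whiskerLeft_one_dTwist ha ha']; monoidal

omit h in
theorem inr_twist (ha : IsAct η[A] μ[A] a) (a' : X ⊗ B ⟶ X) :
    X ◁ crossInr A B ≫ twist (dAct a a') (cComul k d) = dTwist a a' k d ≫ crossInr A B ▷ X := by
  rw [twist_cComul ha, crossInr]
  calc
    _ = 𝟙 _ ⊗≫ (X ◁ η[A] ≫ twist a Δ[A]) ▷ B ⊗≫ A ◁ dTwist a a' k d ⊗≫ 𝟙 _ := by monoidal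
    _ = 𝟙 _ ⊗≫ (η[A] ▷ (X ⊗ B) ≫ A ◁ dTwist a a' k d) ⊗≫ 𝟙 _ := by
      rw [whiskerLeft_one_twist ha]; monoidal
    _ = _ := by rw [← whisker_exchange]; monoidal

theorem twist_fst (hc : IsCoact ε[A] Δ[A] c) (hc' : IsCoact f d c') :
    twist (cMul b m) (dCoact c c') ≫ X ◁ crossFst A f = crossFst A f ▷ X ≫ twist μ[A] c := by
  rw [twist_cMul hc, crossFst]
  calc
    _ = 𝟙 _ ⊗≫ A ◁ dTwist b m c c' ⊗≫ (twist μ[A] c ▷ B ≫ (X ⊗ A) ◁ f) ⊗≫ 𝟙 _ := by monoidal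
    _ = 𝟙 _ ⊗≫ A ◁ (dTwist b m c c' ≫ X ◁ f) ⊗≫ twist μ[A] c ⊗≫ 𝟙 _ := by
      rw [← whisker_exchange]; monoidal
    _ = _ := by rw [h.dTwist_whiskerLeft_counit hc hc']; monoidal

omit h in
theorem twist_snd (hc : IsCoact ε[A] Δ[A] c) (c' : X ⟶ X ⊗ B) :
    twist (cMul b m) (dCoact c c') ≫ X ◁ crossSnd A B = crossSnd A B ▷ X ≫ dTwist b m c c' := by
  rw [twist_cMul hc, crossSnd]
  calc
    _ = 𝟙 _ ⊗≫ A ◁ dTwist b m c c' ⊗≫ (twist μ[A] c ≫ X ◁ ε[A]) ▷ B ⊗≫ 𝟙 _ := by monoidal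
    _ = 𝟙 _ ⊗≫ (A ◁ dTwist b m c c' ≫ ε[A] ▷ (X ⊗ B)) ⊗≫ 𝟙 _ := by
      rw [twist_counit hc]; monoidal
    _ = _ := by rw [whisker_exchange]; monoidal

end

theorem inl_fst : crossInl A e ≫ crossFst A f = 𝟙 A := by
  calc
    _ = 𝟙 _ ⊗≫ A ◁ (e ≫ f) ⊗≫ 𝟙 _ := by rw [crossInl, crossFst]; monoidal
    _ = _ := by rw [h.one_counit]; monoidal

omit h in
theorem inr_snd : crossInr A B ≫ crossSnd A B = 𝟙 B := by
  calc
    _ = 𝟙 _ ⊗≫ (η[A] ≫ ε[A]) ▷ B ⊗≫ 𝟙 _ := by rw [crossInr, crossSnd]; monoidal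
    _ = _ := by rw [BimonObj.one_counit]; monoidal

theorem act_fst : tensorAct μ[A] b ≫ crossFst A f = crossFst A f ▷ A ≫ μ[A] := by
  rw [crossFst, reassoc_of% tensorAct_whiskerLeft μ[A] h.counit_act, rightUnitor_act]
  simp

omit h in
theorem act_snd : tensorAct μ[A] b ≫ crossSnd A B = crossSnd A B ▷ A ≫ b := by
  have : μ[A] ≫ ε[A] = ε[A] ▷ A ≫ unitAct A := by
    rw [unitAct, Bimon.mul_counit, MonoidalCategory.tensorHom_def]; monoidal
  rw [crossSnd, reassoc_of% tensorAct_whiskerRight b this, leftUnitor_act]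
  simp

omit h in
theorem inr_coact : crossInr A B ≫ tensorCoact Δ[A] k = k ≫ crossInr A B ▷ A := by
  have : η[A] ≫ Δ[A] = unitCoact A ≫ η[A] ▷ A := by
    rw [unitCoact, Bimon.one_comul, MonoidalCategory.tensorHom_def']; monoidal
  rw [crossInr, Category.assoc, tensorCoact_whiskerRight k this, Iso.inv_comp_eq,
    comp_whiskerRight, reassoc_of% leftUnitor_coact]
  simp

omit h in
theorem inr_comul : crossInr A B ≫ A ◁ d ≫ (α_ A B B).inv = d ≫ crossInr A B ▷ B := by
  calc
    _ = 𝟙 _ ⊗≫ (η[A] ▷ B ≫ A ◁ d) ⊗≫ 𝟙 _ := by rw [crossInr]; monoidal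
    _ = _ := by rw [← whisker_exchange, crossInr]; monoidal

section

variable {X : C} {a : X ⊗ A ⟶ X} {a' : X ⊗ B ⟶ X} {c : X ⟶ X ⊗ A} {c' : X ⟶ X ⊗ B}

/-- The crossed module axiom for a cross product implies those for its factors. -/
theorem compat_factors (ha : IsAct η[A] μ[A] a) (hc : IsCoact ε[A] Δ[A] c)
    (ha' : IsAct e m a') (hc' : IsCoact f d c')
    (w : twist (dAct a a') (cComul k d) ≫ twist (cMul b m) (dCoact c c') =
      dCoact c c' ▷ (A ⊗ B) ≫ (α_ X _ _).hom ≫ X ◁ twist (cMul b m) (cComul k d) ≫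
        (α_ X _ _).inv ≫ dAct a a' ▷ (A ⊗ B)) :
    (twist a Δ[A] ≫ twist μ[A] c =
      c ▷ A ≫ (α_ X A A).hom ≫ X ◁ twist μ[A] Δ[A] ≫ (α_ X A A).inv ≫ a ▷ A) ∧
    a ≫ c' = c' ▷ A ≫ tensorAct a b ∧ a' ≫ c = tensorCoact c k ≫ a' ▷ A ∧
    dTwist a a' k d ≫ dTwist b m c c' =
      c' ▷ B ≫ (α_ X B B).hom ≫ X ◁ dTwist b m k d ≫ (α_ X B B).inv ≫ a' ▷ B := by
  have kH := isCoact_tensorCoact_comul (isCoact_comul A) h.crossed.isCoact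
  have bH := isAct_tensorAct_mul (isAct_mul A) h.crossed.isAct
  have wl : twist a Δ[A] ≫ crossInl A e ▷ X ≫ twist (cMul b m) (dCoact c c') =
      dCoact c c' ▷ A ≫ (α_ X _ _).hom ≫ X ◁ twist (tensorAct μ[A] b) Δ[A] ≫ (α_ X _ _).inv ≫
        a ▷ (A ⊗ B) := by
    rw [← reassoc_of% h.inl_twist ha ha', w]
    calc
      _ = (X ◁ crossInl A e ≫ dCoact c c' ▷ (A ⊗ B)) ⊗≫ X ◁ twist (cMul b m) (cComul k d) ⊗≫
          dAct a a' ▷ (A ⊗ B) := by monoidal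
      _ = dCoact c c' ▷ A ⊗≫ X ◁ ((A ⊗ B) ◁ crossInl A e ≫ twist (cMul b m) (cComul k d)) ⊗≫
          dAct a a' ▷ (A ⊗ B) := by rw [whisker_exchange]; monoidal
      _ = dCoact c c' ▷ A ⊗≫ X ◁ twist (tensorAct μ[A] b) Δ[A] ⊗≫
          (X ◁ crossInl A e ≫ dAct a a') ▷ (A ⊗ B) := by
        rw [cMul, h.inl_twist bH h.inner_act]; monoidal
      _ = _ := by rw [inl_dAct a ha']; monoidal
  have wf : twist (dAct a a') (cComul k d) ≫ crossFst A f ▷ X ≫ twist μ[A] c =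
      c ▷ (A ⊗ B) ≫ (α_ X _ _).hom ≫ X ◁ twist μ[A] (tensorCoact Δ[A] k) ≫ (α_ X _ _).inv ≫
        dAct a a' ▷ A := by
    rw [← h.twist_fst hc hc', reassoc_of% w]
    calc
      _ = dCoact c c' ▷ (A ⊗ B) ⊗≫ X ◁ twist (cMul b m) (cComul k d) ⊗≫
          (dAct a a' ▷ (A ⊗ B) ≫ X ◁ crossFst A f) := by monoidal
      _ = dCoact c c' ▷ (A ⊗ B) ⊗≫ X ◁ (twist (cMul b m) (cComul k d) ≫ (A ⊗ B) ◁ crossFst A f) ⊗≫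
          dAct a a' ▷ A := by rw [← whisker_exchange]; monoidal
      _ = (dCoact c c' ≫ X ◁ crossFst A f) ▷ (A ⊗ B) ⊗≫ X ◁ twist μ[A] (tensorCoact Δ[A] k) ⊗≫
          dAct a a' ▷ A := by
        rw [cComul, h.twist_fst kH h.inner_coact]; monoidal
      _ = _ := by rw [dCoact_fst c hc']; monoidal
  have ws : twist (dAct a a') (cComul k d) ≫ crossSnd A B ▷ X ≫ dTwist b m c c' =
      c' ▷ (A ⊗ B) ≫ (α_ X _ _).hom ≫
        X ◁ dTwist b m (tensorCoact Δ[A] k) (A ◁ d ≫ (α_ A B B).inv) ≫ (α_ X _ _).inv ≫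
        dAct a a' ▷ B := by
    rw [← twist_snd hc, reassoc_of% w]
    calc
      _ = dCoact c c' ▷ (A ⊗ B) ⊗≫ X ◁ twist (cMul b m) (cComul k d) ⊗≫
          (dAct a a' ▷ (A ⊗ B) ≫ X ◁ crossSnd A B) := by monoidal
      _ = dCoact c c' ▷ (A ⊗ B) ⊗≫ X ◁ (twist (cMul b m) (cComul k d) ≫ (A ⊗ B) ◁ crossSnd A B) ⊗≫
          dAct a a' ▷ B := by rw [← whisker_exchange]; monoidal
      _ = (dCoact c c' ≫ X ◁ crossSnd A B) ▷ (A ⊗ B) ⊗≫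
          X ◁ dTwist b m (tensorCoact Δ[A] k) (A ◁ d ≫ (α_ A B B).inv) ⊗≫
          dAct a a' ▷ B := by
        rw [cComul, twist_snd kH]; monoidal
      _ = _ := by rw [dCoact_snd hc]; monoidal
  refine ⟨?_, ?_, ?_, ?_⟩
  · have := wl =≫ X ◁ crossFst A f
    simp only [Category.assoc] at this
    rw [h.twist_fst hc hc', ← comp_whiskerRight_assoc, h.inl_fst, id_whiskerRight,
      Category.id_comp] at this
    rw [this]
    calc
      _ = dCoact c c' ▷ A ⊗≫ X ◁ twist (tensorAct μ[A] b) Δ[A] ⊗≫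
          (a ▷ (A ⊗ B) ≫ X ◁ crossFst A f) := by monoidal
      _ = dCoact c c' ▷ A ⊗≫ X ◁ (twist (tensorAct μ[A] b) Δ[A] ≫ A ◁ crossFst A f) ⊗≫
          a ▷ A := by rw [← whisker_exchange]; monoidal
      _ = (dCoact c c' ≫ X ◁ crossFst A f) ▷ A ⊗≫ X ◁ twist μ[A] Δ[A] ⊗≫ a ▷ A := by
        rw [← twist_nat_left h.act_fst]; monoidal
      _ = _ := by rw [dCoact_fst c hc']; monoidal
  · have := wl =≫ X ◁ crossSnd A B
    simp only [Category.assoc] at this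
    rw [twist_snd hc] at this
    -- From `A` to `B`, inclusion followed by projection factors through the unit object. The counit
    -- and the unit reduce the two twists to a bare action and a bare coaction.
    have e1 : twist a Δ[A] ≫ crossInl A e ▷ X ≫ crossSnd A B ▷ X ≫ dTwist b m c c' = a ≫ c' := by
      have e2 : crossInl A e ≫ crossSnd A B = ε[A] ≫ e := by
        calc
          _ = 𝟙 _ ⊗≫ (A ◁ e ≫ ε[A] ▷ B) ⊗≫ 𝟙 _ := by rw [crossInl, crossSnd]; monoidal
          _ = _ := by rw [whisker_exchange]; monoidal
      rw [← comp_whiskerRight_assoc, e2, comp_whiskerRight_assoc,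
        h.one_whiskerRight_dTwist hc, reassoc_of% twist_comul_counit]
      simp
    rw [← e1, this, tensorAct_eq_twist a b]
    calc
      _ = dCoact c c' ▷ A ⊗≫ X ◁ twist (tensorAct μ[A] b) Δ[A] ⊗≫
          (a ▷ (A ⊗ B) ≫ X ◁ crossSnd A B) := by monoidal
      _ = dCoact c c' ▷ A ⊗≫ X ◁ (twist (tensorAct μ[A] b) Δ[A] ≫ A ◁ crossSnd A B) ⊗≫
          a ▷ B := by rw [← whisker_exchange]; monoidal
      _ = (dCoact c c' ≫ X ◁ crossSnd A B) ▷ A ⊗≫ X ◁ twist b Δ[A] ⊗≫ a ▷ B := by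
        rw [← twist_nat_left act_snd]; monoidal
      _ = _ := by rw [dCoact_snd hc]; monoidal
  · have := X ◁ crossInr A B ≫= wf
    rw [reassoc_of% inr_twist ha] at this
    have e1 : dTwist a a' k d ≫ crossInr A B ▷ X ≫ crossFst A f ▷ X ≫ twist μ[A] c = a' ≫ c := by
      have e2 : crossInr A B ≫ crossFst A f = f ≫ η[A] := by
        calc
          _ = 𝟙 _ ⊗≫ (η[A] ▷ B ≫ A ◁ f) ⊗≫ 𝟙 _ := by rw [crossInr, crossFst]; monoidal
          _ = _ := by rw [← whisker_exchange]; monoidal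
      rw [← comp_whiskerRight_assoc, e2, comp_whiskerRight_assoc,
        one_twist_mul, reassoc_of% h.dTwist_counit_whiskerRight ha]
      simp
    rw [← e1, this, tensorCoact_eq_twist c k]
    calc
      _ = (X ◁ crossInr A B ≫ c ▷ (A ⊗ B)) ⊗≫ X ◁ twist μ[A] (tensorCoact Δ[A] k) ⊗≫
          dAct a a' ▷ A := by monoidal
      _ = c ▷ B ⊗≫ X ◁ (A ◁ crossInr A B ≫ twist μ[A] (tensorCoact Δ[A] k)) ⊗≫
          dAct a a' ▷ A := by rw [whisker_exchange]; monoidal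
      _ = c ▷ B ⊗≫ X ◁ twist μ[A] k ⊗≫ (X ◁ crossInr A B ≫ dAct a a') ▷ A := by
        rw [twist_nat_right inr_coact]; monoidal
      _ = _ := by rw [inr_dAct ha]; monoidal
  · have := X ◁ crossInr A B ≫= ws
    rw [reassoc_of% inr_twist ha, ← comp_whiskerRight_assoc, inr_snd, id_whiskerRight,
      Category.id_comp] at this
    rw [this]
    calc
      _ = (X ◁ crossInr A B ≫ c' ▷ (A ⊗ B)) ⊗≫
          X ◁ dTwist b m (tensorCoact Δ[A] k) (A ◁ d ≫ (α_ A B B).inv) ⊗≫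
          dAct a a' ▷ B := by monoidal
      _ = c' ▷ B ⊗≫ X ◁ (B ◁ crossInr A B ≫
          dTwist b m (tensorCoact Δ[A] k) (A ◁ d ≫ (α_ A B B).inv)) ⊗≫
          dAct a a' ▷ B := by rw [whisker_exchange]; monoidal
      _ = c' ▷ B ⊗≫ X ◁ dTwist b m k d ⊗≫ (X ◁ crossInr A B ≫ dAct a a') ▷ B := by
        rw [dTwist_nat_right inr_coact inr_comul]; monoidal
      _ = _ := by rw [inr_dAct ha]; monoidal

end

section

variable {X : C}

/-! Restriction of an action and a coaction of a cross product to its factors. -/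

theorem isAct_inl {a : X ⊗ (A ⊗ B) ⟶ X}
    (ha : IsAct ((λ_ (𝟙_ C)).inv ≫ (η[A] ⊗ₘ e)) (cMul b m) a) :
    IsAct η[A] μ[A] (X ◁ crossInl A e ≫ a) where
  one := by
    have : η[A] ≫ crossInl A e = (λ_ (𝟙_ C)).inv ≫ (η[A] ⊗ₘ e) := by
      rw [crossInl, MonoidalCategory.tensorHom_def]; monoidal
    rw [← whiskerLeft_comp_assoc, this, ha.one]
  mul := by
    rw [← ha.comp, h.inl_inl_mul, whiskerLeft_comp, Category.assoc]

theorem isAct_inr {a : X ⊗ (A ⊗ B) ⟶ X}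
    (ha : IsAct ((λ_ (𝟙_ C)).inv ≫ (η[A] ⊗ₘ e)) (cMul b m) a) :
    IsAct e m (X ◁ crossInr A B ≫ a) where
  one := by
    have : e ≫ crossInr A B = (λ_ (𝟙_ C)).inv ≫ (η[A] ⊗ₘ e) := by
      rw [crossInr, MonoidalCategory.tensorHom_def']; monoidal
    rw [← whiskerLeft_comp_assoc, this, ha.one]
  mul := by
    rw [← ha.comp, h.inr_inr_mul, whiskerLeft_comp, Category.assoc]

theorem dAct_inl_inr {a : X ⊗ (A ⊗ B) ⟶ X}
    (ha : IsAct ((λ_ (𝟙_ C)).inv ≫ (η[A] ⊗ₘ e)) (cMul b m) a) :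
    dAct (X ◁ crossInl A e ≫ a) (X ◁ crossInr A B ≫ a) = a := by
  rw [dAct, ← ha.comp, h.inl_inr_mul]
  simp

theorem tensorAct_inl_inr {a : X ⊗ (A ⊗ B) ⟶ X}
    (ha : IsAct ((λ_ (𝟙_ C)).inv ≫ (η[A] ⊗ₘ e)) (cMul b m) a) :
    tensorAct (X ◁ crossInl A e ≫ a) b ≫ X ◁ crossInr A B ≫ a =
      (X ◁ crossInr A B ≫ a) ▷ A ≫ X ◁ crossInl A e ≫ a := by
  have e1 := ha.comp (crossInr A B) (crossInl A e)
  have e2 := h.dAct_inl_inr ha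
  rw [dAct] at e2
  rw [h.inr_inl_mul, Iso.eq_inv_comp] at e1
  rw [tensorAct_eq_twist, ← e1]
  simp only [Category.assoc] at e2 ⊢
  rw [e2]

theorem isCoact_fst {c : X ⟶ X ⊗ (A ⊗ B)}
    (hc : IsCoact ((ε[A] ⊗ₘ f) ≫ (λ_ (𝟙_ C)).hom) (cComul k d) c) :
    IsCoact ε[A] Δ[A] (c ≫ X ◁ crossFst A f) where
  counit := by
    have : crossFst A f ≫ ε[A] = (ε[A] ⊗ₘ f) ≫ (λ_ (𝟙_ C)).hom := by
      rw [crossFst, MonoidalCategory.tensorHom_def']; monoidal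
    rw [Category.assoc, ← whiskerLeft_comp, this, hc.counit]
  comul := by
    rw [← hc.comp, h.comul_fst_fst, whiskerLeft_comp, Category.assoc]

theorem isCoact_snd {c : X ⟶ X ⊗ (A ⊗ B)}
    (hc : IsCoact ((ε[A] ⊗ₘ f) ≫ (λ_ (𝟙_ C)).hom) (cComul k d) c) :
    IsCoact f d (c ≫ X ◁ crossSnd A B) where
  counit := by
    have : crossSnd A B ≫ f = (ε[A] ⊗ₘ f) ≫ (λ_ (𝟙_ C)).hom := by
      rw [crossSnd, MonoidalCategory.tensorHom_def]; monoidal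
    rw [Category.assoc, ← whiskerLeft_comp, this, hc.counit]
  comul := by
    rw [← hc.comp, h.comul_snd_snd, whiskerLeft_comp, Category.assoc]

theorem dCoact_fst_snd {c : X ⟶ X ⊗ (A ⊗ B)}
    (hc : IsCoact ((ε[A] ⊗ₘ f) ≫ (λ_ (𝟙_ C)).hom) (cComul k d) c) :
    dCoact (c ≫ X ◁ crossFst A f) (c ≫ X ◁ crossSnd A B) = c := by
  rw [dCoact, ← hc.comp, h.comul_fst_snd]
  simp

theorem tensorCoact_fst_snd {c : X ⟶ X ⊗ (A ⊗ B)}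
    (hc : IsCoact ((ε[A] ⊗ₘ f) ≫ (λ_ (𝟙_ C)).hom) (cComul k d) c) :
    (c ≫ X ◁ crossSnd A B) ≫ tensorCoact (c ≫ X ◁ crossFst A f) k =
      (c ≫ X ◁ crossFst A f) ≫ (c ≫ X ◁ crossSnd A B) ▷ A := by
  have e1 := hc.comp (crossSnd A B) (crossFst A f)
  have e2 := h.dCoact_fst_snd hc
  rw [dCoact] at e2
  rw [h.comul_snd_fst, ← Category.assoc, ← Iso.comp_inv_eq] at e1
  rw [tensorCoact_eq_twist, ← e1]
  simp only [Category.assoc] at e2 ⊢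
  rw [reassoc_of% e2]

end

end IsCrossedBimon

/-! ### The cross product and its crossed modules -/

section CrossProduct

variable {C : Type u} [Category.{v} C] [MonoidalCategory C] [BraidedCategory C]

theorem isCrossedModule_iff_twist {H X : C} [HopfObj H] {a : X ⊗ H ⟶ X} {c : X ⟶ X ⊗ H} :
    IsCrossedModule H a c ↔ IsAct η[H] μ[H] a ∧ IsCoact ε[H] Δ[H] c ∧
      twist a Δ[H] ≫ twist μ[H] c =
        c ▷ H ≫ (α_ X H H).hom ≫ X ◁ twist μ[H] Δ[H] ≫ (α_ X H H).inv ≫ a ▷ H := by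
  rw [isCrossedModule_iff, tensorAct_eq_twist]

variable (A : C) [HopfObj A] [IsIso 𝒮[A]] (B : CrossedModule A) [HopfObj B]

/-- Tensor products, coherence maps and the braiding of crossed modules are computed in `C`, so each
axiom is the underlying equation of one for `B`, or says that a structure map of `B` is linear or
colinear over `A`. -/
theorem isCrossedBimon : IsCrossedBimon A B.act B.coact (uOne A B) (uMul A B) (uCounit A B)
    (uComul A B) where
  crossed := B.isCrossedModule
  one_mul := congrArg CrossedModule.Hom.hom (MonObj.one_mul B)
  isAct := ⟨congrArg CrossedModule.Hom.hom (isAct_mul B).one,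
    congrArg CrossedModule.Hom.hom (isAct_mul B).mul⟩
  counit_comul := congrArg CrossedModule.Hom.hom (ComonObj.counit_comul B)
  isCoact := ⟨congrArg CrossedModule.Hom.hom (isCoact_comul B).counit,
    congrArg CrossedModule.Hom.hom (isCoact_comul B).comul⟩
  one_act := η[B].act_hom
  one_coact := η[B].hom_coact
  mul_act := μ[B].act_hom
  mul_coact := μ[B].hom_coact
  counit_act := ε[B].act_hom
  counit_coact := ε[B].hom_coact
  comul_act := Δ[B].act_hom
  comul_coact := Δ[B].hom_coact
  -- The braiding of crossed modules over `A` has a twist over `A` as underlying morphism, so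
  -- `twist` formed in that category is `dTwist` in `C` by definition.
  mul_comul := congrArg CrossedModule.Hom.hom (mul_comul_eq_twist B)
  one_comul := congrArg CrossedModule.Hom.hom (Bimon.one_comul B)
  mul_counit := congrArg CrossedModule.Hom.hom (Bimon.mul_counit B)
  one_counit := congrArg CrossedModule.Hom.hom (BimonObj.one_counit (M := B))

theorem uComul_uAntipode_left :
    uComul A B ≫ uAntipode A B ▷ B.X ≫ uMul A B = uCounit A B ≫ uOne A B :=
  congrArg CrossedModule.Hom.hom (HopfObj.antipode_left B)

theorem uComul_uAntipode_right :
    uComul A B ≫ B.X ◁ uAntipode A B ≫ uMul A B = uCounit A B ≫ uOne A B :=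
  congrArg CrossedModule.Hom.hom (HopfObj.antipode_right B)

/-- The cross product of `A` and `B` as a Hopf algebra. -/
@[reducible]
def crossHopfObj : HopfObj (A ⊗ B.X) :=
  (isCrossedBimon A B).hopfObj (uComul_uAntipode_left A B) (uComul_uAntipode_right A B)

theorem isIso_uAntipode [IsIso 𝒮[B]] : IsIso (uAntipode A B) :=
  inferInstanceAs (IsIso ((CrossedModule.forget A).map 𝒮[B]))

theorem crossMul_eq : cMul B.act (uMul A B) = crossMul A B := by
  rw [cMul, dAct, tensorAct_eq_twist, twist, crossMul, MonoidalCategory.tensorHom_def]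
  monoidal

theorem crossComul_eq : cComul B.coact (uComul A B) = crossComul A B := by
  rw [cComul, dCoact, tensorCoact_eq_twist, twist, crossComul, MonoidalCategory.tensorHom_def']
  monoidal

theorem crossAntipode_eq :
    twist μ[A] B.coact ≫ (uAntipode A B ⊗ₘ 𝒮[A]) ≫ twist B.act Δ[A] = crossAntipode A B := by
  rw [twist, twist, crossAntipode]
  monoidal

variable {A B}

section

variable (X : CrossedModule B)

theorem isAct_uAct : IsAct (uOne A B) (uMul A B) (uAct X) :=
  ⟨congrArg CrossedModule.Hom.hom X.isCrossedModule.act_one,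
    congrArg CrossedModule.Hom.hom X.isCrossedModule.act_mul⟩

theorem isCoact_uCoact : IsCoact (uCounit A B) (uComul A B) (uCoact X) :=
  ⟨congrArg CrossedModule.Hom.hom X.isCrossedModule.coact_counit,
    congrArg CrossedModule.Hom.hom X.isCrossedModule.coact_comul⟩

theorem dTwist_uAct_uCoact :
    dTwist X.X.act (uAct X) B.coact (uComul A B) ≫ dTwist B.act (uMul A B) X.X.coact (uCoact X) =
      uCoact X ▷ B.X ≫ (α_ X.X.X B.X B.X).hom ≫
        X.X.X ◁ dTwist B.act (uMul A B) B.coact (uComul A B) ≫ (α_ X.X.X B.X B.X).inv ≫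
        uAct X ▷ B.X :=
  congrArg CrossedModule.Hom.hom (isCrossedModule_iff_twist.1 X.isCrossedModule).2.2

attribute [local instance] crossHopfObj

/-- The four mixed conditions say exactly that the action and the coaction of `B` on `X` are
morphisms of crossed modules over `A`. -/
theorem isCrossedModule_cross : IsCrossedModule (A ⊗ B.X) (crossAct X) (crossCoact X) :=
  isCrossedModule_iff_twist.2
    ⟨X.X.isCrossedModule.isAct.dAct (isAct_uAct X) X.act.act_hom,
      X.X.isCrossedModule.isCoact.dCoact (isCoact_uCoact X) X.coact.hom_coact,
      compat_dAct_dCoact X.X.isCrossedModule.isAct X.X.isCrossedModule.isCoact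
        B.isCrossedModule.isAct B.isCrossedModule.isCoact
        (isCrossedModule_iff_twist.1 X.X.isCrossedModule).2.2 X.coact.act_hom X.act.hom_coact
        (dTwist_uAct_uCoact X)⟩

end

/-- A crossed module over `B` from its structure morphisms in `C`. -/
def CrossedModule.ofFactors (X : C) (a : X ⊗ A ⟶ X) (c : X ⟶ X ⊗ A) (a' : X ⊗ B.X ⟶ X)
    (c' : X ⟶ X ⊗ B.X) (h : IsCrossedModule A a c) (ha' : IsAct (uOne A B) (uMul A B) a')
    (hc' : IsCoact (uCounit A B) (uComul A B) c')
    (lin : tensorAct a B.act ≫ a' = a' ▷ A ≫ a) (colin : c' ≫ tensorCoact c B.coact = c ≫ c' ▷ A)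
    (h2 : a ≫ c' = c' ▷ A ≫ tensorAct a B.act) (h3 : a' ≫ c = tensorCoact c B.coact ≫ a' ▷ A)
    (h4 : dTwist a a' B.coact (uComul A B) ≫ dTwist B.act (uMul A B) c c' =
      c' ▷ B.X ≫ (α_ X B.X B.X).hom ≫ X ◁ dTwist B.act (uMul A B) B.coact (uComul A B) ≫
        (α_ X B.X B.X).inv ≫ a' ▷ B.X) :
    CrossedModule B where
  X := ⟨X, a, c, h⟩
  act := ⟨a', lin, h3⟩
  coact := ⟨c', h2, colin⟩
  isCrossedModule := isCrossedModule_iff_twist.2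
    ⟨⟨CrossedModule.hom_ext ha'.one, CrossedModule.hom_ext ha'.mul⟩,
      ⟨CrossedModule.hom_ext hc'.counit, CrossedModule.hom_ext hc'.comul⟩,
      CrossedModule.hom_ext h4⟩

theorem CrossedModule.eq_of {H : C} [HopfObj H] {M : CrossedModule H} {a : M.X ⊗ H ⟶ M.X}
    {c : M.X ⟶ M.X ⊗ H} {h : IsCrossedModule H a c} (ha : a = M.act) (hc : c = M.coact) :
    CrossedModule.mk M.X a c h = M := by
  subst ha hc
  rfl

theorem CrossedModule.ofFactors_eq {Y : CrossedModule B} {a c a' c'} {h ha' hc' lin colin h2 h3 h4}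
    (ea : a = Y.X.act) (ec : c = Y.X.coact) (ea' : a' = uAct Y) (ec' : c' = uCoact Y) :
    ofFactors (B := B) Y.X.X a c a' c' h ha' hc' lin colin h2 h3 h4 = Y := by
  subst ea ec ea' ec'
  rfl

/-- Equality of functors involves transports along equalities of objects; this pushes them down to
the underlying category. -/
theorem CrossedModule.eqToHom_comp_hom {H : C} [HopfObj H] {M M' N N' : CrossedModule H}
    (f : M' ⟶ N') (h : M = M') (h' : N' = N) :
    Hom.hom (eqToHom h ≫ f ≫ eqToHom h') = eqToHom (congrArg CrossedModule.X h) ≫ f.hom ≫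
      eqToHom (congrArg CrossedModule.X h') := by
  subst h h'
  rfl

section

attribute [local instance] crossHopfObj

/-- The crossed module over `B` underlying a crossed module over the cross product. -/
def crossRestrict (Y : CrossedModule (A ⊗ B.X)) : CrossedModule B :=
  have hB := isCrossedBimon A B
  have ha := Y.isCrossedModule.isAct
  have hc := Y.isCrossedModule.isCoact
  have hw := hB.compat_factors (hB.isAct_inl ha) (hB.isCoact_fst hc) (hB.isAct_inr ha)
    (hB.isCoact_snd hc) (by
      rw [hB.dAct_inl_inr ha, hB.dCoact_fst_snd hc]
      exact (isCrossedModule_iff_twist.1 Y.isCrossedModule).2.2)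
  .ofFactors Y.X (Y.X ◁ crossInl A (uOne A B) ≫ Y.act) (Y.coact ≫ Y.X ◁ crossFst A (uCounit A B))
    (Y.X ◁ crossInr A B.X ≫ Y.act) (Y.coact ≫ Y.X ◁ crossSnd A B.X)
    (isCrossedModule_iff_twist.2 ⟨hB.isAct_inl ha, hB.isCoact_fst hc, hw.1⟩)
    (hB.isAct_inr ha) (hB.isCoact_snd hc) (hB.tensorAct_inl_inr ha) (hB.tensorCoact_fst_snd hc)
    hw.2.1 hw.2.2.1 hw.2.2.2

theorem whiskerLeft_act_hom {P : C} {M N : CrossedModule (A ⊗ B.X)} (g : M ⟶ N)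
    (x : P ⟶ A ⊗ B.X) :
    (M.X ◁ x ≫ M.act) ≫ g.hom = g.hom ▷ P ≫ N.X ◁ x ≫ N.act := by
  rw [Category.assoc, g.act_hom, whisker_exchange_assoc]

theorem hom_coact_whiskerLeft {P : C} {M N : CrossedModule (A ⊗ B.X)} (g : M ⟶ N)
    (x : A ⊗ B.X ⟶ P) :
    g.hom ≫ N.coact ≫ N.X ◁ x = (M.coact ≫ M.X ◁ x) ≫ g.hom ▷ P := by
  rw [reassoc_of% g.hom_coact, ← whisker_exchange, Category.assoc]

variable (A B) in
/-- The inverse of `crossFunctor`. -/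
def crossInverse : CrossedModule (A ⊗ B.X) ⥤ CrossedModule B where
  obj Y := crossRestrict Y
  map g := ⟨⟨g.hom, whiskerLeft_act_hom g _, hom_coact_whiskerLeft g _⟩,
    CrossedModule.hom_ext (whiskerLeft_act_hom g _),
    CrossedModule.hom_ext (hom_coact_whiskerLeft g _)⟩

theorem crossFunctor_crossInverse :
    crossFunctor (isCrossedModule_cross (A := A) (B := B)) ⋙ crossInverse A B = 𝟭 _ := by
  have e (X : CrossedModule B) :
      crossRestrict ((crossFunctor (isCrossedModule_cross (A := A) (B := B))).obj X) = X := by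
    unfold crossRestrict
    exact CrossedModule.ofFactors_eq (Y := X)
      (inl_dAct _ (isAct_uAct X)) (dCoact_fst _ (isCoact_uCoact X))
      (inr_dAct X.X.isCrossedModule.isAct _) (dCoact_snd X.X.isCrossedModule.isCoact _)
  refine CategoryTheory.Functor.ext e (fun X Y f => ?_)
  refine CrossedModule.hom_ext (CrossedModule.hom_ext ?_)
  refine Eq.trans ?_ (congrArg CrossedModule.Hom.hom
    (CrossedModule.eqToHom_comp_hom f (e X) (e Y).symm)).symm
  refine Eq.trans ?_ (CrossedModule.eqToHom_comp_hom f.hom _ _).symm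
  -- Neither functor changes underlying objects, so both transports in `C` go from an object to
  -- itself and are identities by definition.
  exact ((Category.id_comp (f.hom.hom ≫ 𝟙 Y.X.X)).trans (Category.comp_id f.hom.hom)).symm

theorem crossInverse_crossFunctor :
    crossInverse A B ⋙ crossFunctor (isCrossedModule_cross (A := A) (B := B)) = 𝟭 _ := by
  have hB := isCrossedBimon A B
  have e (Y : CrossedModule (A ⊗ B.X)) :
      (crossFunctor (isCrossedModule_cross (A := A) (B := B))).obj (crossRestrict Y) = Y :=
    CrossedModule.eq_of (hB.dAct_inl_inr Y.isCrossedModule.isAct)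
      (hB.dCoact_fst_snd Y.isCrossedModule.isCoact)
  refine CategoryTheory.Functor.ext e (fun X Y f => CrossedModule.hom_ext ?_)
  refine Eq.trans ?_ (CrossedModule.eqToHom_comp_hom f (e X) (e Y).symm).symm
  exact ((Category.id_comp (f.hom ≫ 𝟙 Y.X)).trans (Category.comp_id f.hom)).symm

/-! ### Strict monoidal and braided structure of the functor -/

/-- `tensorAct_eq_twist` is used over three Hopf algebras: `A`, `B` among crossed modules, and the
cross product. By `twist_cComul` the expansions agree up to one interchange. -/
theorem tensorAct_crossAct (X Y : CrossedModule B) :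
    tensorAct (crossAct X) (crossAct Y) = crossAct (X ⊗ Y) := by
  have e1 : crossAct (X ⊗ Y) = dAct (tensorAct X.X.act Y.X.act)
      ((α_ _ _ _).hom ≫ X.X.X ◁ dTwist Y.X.act (uAct Y) B.coact (uComul A B) ≫ (α_ _ _ _).inv ≫
        uAct X ▷ Y.X.X) :=
    congrArg (dAct (tensorAct X.X.act Y.X.act))
      (congrArg CrossedModule.Hom.hom (tensorAct_eq_twist X.act Y.act))
  have e2 : tensorAct (crossAct X) (crossAct Y) = (α_ _ _ _).hom ≫
      X.X.X ◁ twist (dAct Y.X.act (uAct Y)) (cComul B.coact (uComul A B)) ≫ (α_ _ _ _).inv ≫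
      dAct X.X.act (uAct X) ▷ Y.X.X := tensorAct_eq_twist (crossAct X) (crossAct Y)
  rw [e1, e2, twist_cComul Y.X.isCrossedModule.isAct, dAct, dAct, tensorAct_eq_twist]
  calc
    _ = 𝟙 _ ⊗≫ X.X.X ◁ twist Y.X.act Δ[A] ▷ B.X ⊗≫
        ((X.X.X ⊗ A) ◁ dTwist Y.X.act (uAct Y) B.coact (uComul A B) ≫ X.X.act ▷ _) ⊗≫
        uAct X ▷ Y.X.X := by monoidal
    _ = _ := by rw [whisker_exchange]; monoidal

theorem tensorCoact_crossCoact (X Y : CrossedModule B) :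
    tensorCoact (crossCoact X) (crossCoact Y) = crossCoact (X ⊗ Y) := by
  have e1 : crossCoact (X ⊗ Y) = dCoact (tensorCoact X.X.coact Y.X.coact)
      (uCoact X ▷ Y.X.X ≫ (α_ _ _ _).hom ≫
        X.X.X ◁ dTwist B.act (uMul A B) Y.X.coact (uCoact Y) ≫ (α_ _ _ _).inv) :=
    congrArg (dCoact (tensorCoact X.X.coact Y.X.coact))
      (congrArg CrossedModule.Hom.hom (tensorCoact_eq_twist X.coact Y.coact))
  have e2 : tensorCoact (crossCoact X) (crossCoact Y) = dCoact X.X.coact (uCoact X) ▷ Y.X.X ≫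
      (α_ _ _ _).hom ≫ X.X.X ◁ twist (cMul B.act (uMul A B)) (dCoact Y.X.coact (uCoact Y)) ≫
      (α_ _ _ _).inv := tensorCoact_eq_twist (crossCoact X) (crossCoact Y)
  rw [e1, e2, twist_cMul Y.X.isCrossedModule.isCoact, dCoact, dCoact, tensorCoact_eq_twist]
  calc
    _ = uCoact X ▷ Y.X.X ⊗≫
        (X.X.coact ▷ _ ≫ (X.X.X ⊗ A) ◁ dTwist B.act (uMul A B) Y.X.coact (uCoact Y)) ⊗≫
        X.X.X ◁ twist μ[A] Y.X.coact ▷ B.X ⊗≫ 𝟙 _ := by monoidal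
    _ = _ := by rw [← whisker_exchange]; monoidal

theorem unitAct_cross : unitAct (A ⊗ B.X) = crossAct (𝟙_ (CrossedModule B)) := by
  have e1 : crossAct (𝟙_ (CrossedModule B)) = dAct (unitAct A) ((λ_ B.X).hom ≫ uCounit A B) := rfl
  have e2 : unitAct (A ⊗ B.X) =
    (λ_ (A ⊗ B.X)).hom ≫ (ε[A] ⊗ₘ uCounit A B) ≫ (λ_ (𝟙_ C)).hom := rfl
  rw [e1, e2, dAct, unitAct, MonoidalCategory.tensorHom_def]
  monoidal

theorem unitCoact_cross : unitCoact (A ⊗ B.X) = crossCoact (𝟙_ (CrossedModule B)) := by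
  have e1 : crossCoact (𝟙_ (CrossedModule B)) = dCoact (unitCoact A) (uOne A B ≫ (λ_ B.X).inv) := rfl
  have e2 : unitCoact (A ⊗ B.X) =
    ((λ_ (𝟙_ C)).inv ≫ (η[A] ⊗ₘ uOne A B)) ≫ (λ_ (A ⊗ B.X)).inv := rfl
  rw [e1, e2, dCoact, unitCoact, MonoidalCategory.tensorHom_def']
  monoidal

variable (A B) in
/-- The strict monoidal structure of `crossFunctor`. -/
noncomputable def crossFunctorCoreMonoidal :
    (crossFunctor (isCrossedModule_cross (A := A) (B := B))).CoreMonoidal where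
  εIso := CrossedModule.mkIso (Iso.refl (𝟙_ C))
    (by
      refine (Category.comp_id _).trans (unitAct_cross.trans ?_)
      exact ((congrArg (· ≫ _) (id_whiskerRight _ _)).trans (Category.id_comp _)).symm)
    (by
      refine (Category.id_comp _).trans (unitCoact_cross.symm.trans ?_)
      exact ((congrArg (_ ≫ ·) (id_whiskerRight _ _)).trans (Category.comp_id _)).symm)
  μIso X Y := CrossedModule.mkIso (Iso.refl (X.X.X ⊗ Y.X.X))
    (by
      refine (Category.comp_id _).trans ((tensorAct_crossAct X Y).trans ?_)
      exact ((congrArg (· ≫ _) (id_whiskerRight _ _)).trans (Category.id_comp _)).symm)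
    (by
      refine (Category.id_comp _).trans ((tensorCoact_crossCoact X Y).symm.trans ?_)
      exact ((congrArg (_ ≫ ·) (id_whiskerRight _ _)).trans (Category.comp_id _)).symm)
  μIso_hom_natural_left f Z :=
    CrossedModule.hom_ext ((Category.comp_id _).trans (Category.id_comp _).symm)
  μIso_hom_natural_right Z f :=
    CrossedModule.hom_ext ((Category.comp_id _).trans (Category.id_comp _).symm)
  associativity X Y Z := CrossedModule.hom_ext (by
    change 𝟙 (X.X.X ⊗ Y.X.X) ▷ Z.X.X ≫ 𝟙 ((X.X.X ⊗ Y.X.X) ⊗ Z.X.X) ≫ (α_ X.X.X Y.X.X Z.X.X).hom =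
      (α_ X.X.X Y.X.X Z.X.X).hom ≫ X.X.X ◁ 𝟙 (Y.X.X ⊗ Z.X.X) ≫ 𝟙 (X.X.X ⊗ Y.X.X ⊗ Z.X.X)
    simp)
  left_unitality X := CrossedModule.hom_ext (by
    change (λ_ X.X.X).hom = 𝟙 (𝟙_ C) ▷ X.X.X ≫ 𝟙 (𝟙_ C ⊗ X.X.X) ≫ (λ_ X.X.X).hom
    simp)
  right_unitality X := CrossedModule.hom_ext (by
    change (ρ_ X.X.X).hom = X.X.X ◁ 𝟙 (𝟙_ C) ≫ 𝟙 (X.X.X ⊗ 𝟙_ C) ≫ (ρ_ X.X.X).hom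
    simp)

variable (A B) in
/-- The strict braided structure of `crossFunctor`. -/
@[reducible]
noncomputable def crossFunctorBraided [IsIso 𝒮[B]] [IsIso 𝒮[A ⊗ B.X]] :
    (crossFunctor (isCrossedModule_cross (A := A) (B := B))).Braided where
  __ := (crossFunctorCoreMonoidal A B).toMonoidal
  -- With identities as structure maps, the condition is equality of the two braidings, a twist over
  -- `A ⊗ B` and a `dTwist`.
  braided _ _ := CrossedModule.hom_ext ((Category.id_comp _).trans
    ((twist_dAct_dCoact _ _ _ _).symm.trans (Category.comp_id _).symm))

theorem isIso_crossHopfObj_antipode [IsIso 𝒮[B]] : IsIso 𝒮[A ⊗ B.X] :=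
  have := isIso_uAntipode A B
  (isCrossedBimon A B).isIso_antipode (uAntipode A B)

end

end CrossProduct

end Braided

theorem mainTheorem7 {C : Type u} [Category.{v} C] [MonoidalCategory C] [BraidedCategory C]
    (A : C) [HopfObj A] [IsIso 𝒮[A]]
    (B : Braided.CrossedModule A) [HopfObj B] [IsIso 𝒮[B]] :
    ∃ (_ : HopfObj (A ⊗ B.X)) (_ : IsIso 𝒮[A ⊗ B.X]),
      (η[A ⊗ B.X] = Braided.crossOne A B ∧
        μ[A ⊗ B.X] = Braided.crossMul A B ∧
        ε[A ⊗ B.X] = Braided.crossCounit A B ∧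
        Δ[A ⊗ B.X] = Braided.crossComul A B ∧
        𝒮[A ⊗ B.X] = Braided.crossAntipode A B) ∧
      ∃ (h : ∀ X : Braided.CrossedModule B, Braided.IsCrossedModule (A ⊗ B.X)
          (Braided.crossAct X) (Braided.crossCoact X))
        (_ : (Braided.crossFunctor h).Braided),
        (∃ G : Braided.CrossedModule (A ⊗ B.X) ⥤ Braided.CrossedModule B,
          Braided.crossFunctor h ⋙ G = 𝟭 _ ∧ G ⋙ Braided.crossFunctor h = 𝟭 _) ∧
        (Functor.LaxMonoidal.ε (Braided.crossFunctor h)).hom = 𝟙 (𝟙_ C) ∧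
        ∀ X Y : Braided.CrossedModule B,
          (Functor.LaxMonoidal.μ (Braided.crossFunctor h) X Y).hom = 𝟙 (X.X.X ⊗ Y.X.X) := by
  let _ := Braided.crossHopfObj A B
  have hS : IsIso 𝒮[A ⊗ B.X] := Braided.isIso_crossHopfObj_antipode
  exact ⟨Braided.crossHopfObj A B, hS,
    ⟨rfl, Braided.crossMul_eq A B, rfl, Braided.crossComul_eq A B, Braided.crossAntipode_eq A B⟩,
    Braided.isCrossedModule_cross, Braided.crossFunctorBraided A B,
    ⟨Braided.crossInverse A B, Braided.crossFunctor_crossInverse,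
      Braided.crossInverse_crossFunctor⟩, rfl, fun _ _ => rfl⟩
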